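/- Let $d,K\ge 1$, $\mathcal I=\{1,\dots,d\}$, $\mathcal K=\{1,\dots,K\}$, $\alpha>0$, $\beta=\max\{\tfrac12,1-\tfrac\alpha2\}$. Let $\mathcal Q$ be an irreducible transition rate matrix on $\mathcal K$ with stationary distribution $\pi$. For $n\in\mathbb N=\{1,2,\dots\}$, $i\in\mathcal I$, $k\in\mathcal K$ let $\lambda_i^n(k)\ge 0$, $\mu_i^n(k)>0$, $\gamma_i^n(k)>0$ be such that, as $n\to\infty$, $$n^{-1}\lambda_i^n(k)\to\lambda_i(k)>0,\quad \mu_i^n(k)\to\mu_i(k)>0,\quad \gamma_i^n(k)\to\gamma_i(k)>0,$$ $$n^{-\beta}\big(\lambda_i^n(k)-n\lambda_i(k)\big)\to\hat\lambda_i(k)\in\mathbb R,\qquad n^{1-\beta}\big(\mu_i^n(k)-\mu_i(k)\big)\to\hat\mu_i(k)\in\mathbb R .$$ Put $\lambda_i^\pi=\sum_k\pi_k\lambda_i(k)$, $\mu_i^\pi=\sum_k\pi_k\mu_i(k)$, $\rho_i=\lambda_i^\pi/\mu_i^\pi$, and assume $\sum_{i}\rho_i=1$. For each $n$, on some probability space,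 let $J^n$ be a càdlàg Markov chain on $\mathcal K$ with transition rate matrix $n^\alpha\mathcal Q$ and initial law $\pi$, and let $A_{*,i},S_{*,i},R_{*,i}$ $(i\in\mathcal I)$ be unit-rate Poisson processes, mutually independent and independent of $J^n$. Let $Q^n,Z^n$ be càdlàg $\mathbb Z_+^d$-valued processes (customers of each class in queue and in service) and $X^n=Q^n+Z^n$, such that $X^n(0)$ is deterministic and, almost surely, for all $t\ge0$ and $i\in\mathcal I$, $\sum_jZ^n_j(t)\le n$ and $X_i^n(t)=X_i^n(0)+A_i^n(t)-S_i^n(t)-R_i^n(t)$, where $$A_i^n(t)=A_{*,i}\Big(\int_0^t\lambda_i^n(J^n(s))\,ds\Big),\quad S_i^n(t)=S_{*,i}(T_i^n(t)),\quad R_i^n(t)=R_{*,i}(V_i^n(t)),$$ $$T_i^n(t)=\int_0^t\mu_i^n(J^n(s))Z_i^n(s)\,ds,\qquad V_i^n(t)=\int_0^t\gamma_i^n(J^n(s))Q_i^n(s)\,ds .$$ Write $e=(1,\dots,1)$, $e_d=(0,\dots,0,1)$, and let $\mathcal N$ be the class of null sets. Let $\mathcal F^n_t$ be generated by $\mathcal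 N$ and $A^n(s),S^n(s),R^n(s),Q^n(s),Z^n(s),X^n(s),J^n(s)$, $s\le t$. Let $\tau^n(t)=\inf\{r\ge t: J^n(r)=1\}$ and $$\hat L^n_i(t)=n^{1-\beta}\int_0^t(\lambda_i(J^n(s))-\lambda_i^\pi)\,ds-n^{1-\beta}\rho_i\int_0^t(\mu_i(J^n(s))-\mu_i^\pi)\,ds .$$ With $\tau=\tau^n(t)$, let $\mathcal G^n_{t,r}$ be generated by $\mathcal N$ and $$A_i^n(\tau+r)-A_i^n(\tau),\quad S_{*,i}(T_i^n(\tau)+r)-S_i^n(\tau),\quad R_{*,i}(V_i^n(\tau)+r)-R_i^n(\tau),\quad \hat L_i^n(\tau+r)-\hat L_i^n(\tau),\qquad i\in\mathcal I .$$ The (preemptive) scheduling policy $Z^n$ is called admissible if, almost surely, $\langle e,Z^n(t)\rangle=\min\{\langle e,X^n(t)\rangle,n\}$ for all $t\ge0$, if $Z^n(t)$ is $\mathcal F^n_t$-measurable for all $t\ge 0$, and if $\mathcal F_t^n$ and $\mathcal G^n_{t,r}$ are independent for all $t,r\ge0$. Let $\hat X_i^n=n^{-\beta}(X_i^n-\rho_in)$,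 and let $\hat U^n(t)=\dfrac{Z^n(t)-X^n(t)}{n-\langle e,X^n(t)\rangle}$ if $\langle e,X^n(t)\rangle>n$ and $\hat U^n(t)=e_d$ otherwise. Fix $c>0$ and $m\ge1$, and with $|\cdot|$ the Euclidean norm and $a^+=\max\{a,0\}$ let $\mathscr R(x,u)=c\,\big|\langle e,x\rangle^+u\big|^m$. **Lemma.** For every sequence of admissible scheduling policies such that $$\sup_{n\in\mathbb N}\ \limsup_{T\to\infty}\frac1T\,\mathbb E\Big[\int_0^T\mathscr R(\hat X^n(s),\hat U^n(s))\,ds\Big]<\infty ,$$ one has $$\sup_{n\in\mathbb N}\ \limsup_{T\to\infty}\frac1T\,\mathbb E\Big[\int_0^T|\hat X^n(s)|^m\,ds\Big]<\infty .$$ -/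

import Mathlib

open MeasureTheory ProbabilityTheory Filter Topology
open scoped NNReal ENNReal

/-- Right-continuous paths with left limits on `[0, ∞)`. -/
def IsCadlagPath {E : Type*} [TopologicalSpace E] (f : ℝ≥0 → E) : Prop :=
  ∀ t, ContinuousWithinAt f (Set.Ici t) t ∧ ∃ l, Tendsto f (𝓝[<] t) (𝓝 l)

/-- `∫₀ᵗ f(s) ds` for a function of a nonnegative time. -/
noncomputable def timeIntegral (f : ℝ≥0 → ℝ) (t : ℝ≥0) : ℝ :=
  ∫ s in (0 : ℝ)..t, f s.toNNReal

/-- A unit-rate Poisson process: a counting process with independent increments, the increment over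
`[s, t]` being Poisson with mean `t - s`. (Paths are nondecreasing, so the natural number
subtraction is the true one.) -/
structure IsUnitPoisson {Ω : Type*} [MeasurableSpace Ω] (P : Measure Ω) (N : ℝ≥0 → Ω → ℕ) :
    Prop where
  measurable : ∀ t, Measurable (N t)
  zero : ∀ ω, N 0 ω = 0
  mono : ∀ ω, Monotone fun t => N t ω
  cadlag : ∀ ω, IsCadlagPath fun t => N t ω
  indep : HasIndepIncrements N P
  law : ∀ s t, s ≤ t → P.map (fun ω => N t ω - N s ω) = poissonMeasure (t - s)

/-- `G` is the transition rate matrix (generator) of an irreducible chain. -/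
structure IsIrreducibleGenerator {K : ℕ} (G : Matrix (Fin K) (Fin K) ℝ) : Prop where
  offDiag_nonneg : ∀ k l, k ≠ l → 0 ≤ G k l
  row_sum : ∀ k, ∑ l, G k l = 0
  irreducible : ∀ k l, Relation.ReflTransGen (fun a b => a ≠ b ∧ 0 < G a b) k l

/-- `J` is a càdlàg continuous-time Markov chain on `Fin K` with transition rate matrix `G` and
initial law `p`, expressed through its finite-dimensional distributions. -/
structure IsMarkovChain {Ω : Type*} [MeasurableSpace Ω] {K : ℕ} (P : Measure Ω)
    (G : Matrix (Fin K) (Fin K) ℝ) (p : Fin K → ℝ) (J : ℝ≥0 → Ω → Fin K) : Prop where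
  measurable : ∀ t, Measurable (J t)
  cadlag : ∀ ω, IsCadlagPath fun t => J t ω
  fdd : ∀ (N : ℕ) (t : ℕ → ℝ≥0) (k : ℕ → Fin K), Monotone t → t 0 = 0 →
    P.real {ω | ∀ j ≤ N, J (t j) ω = k j} =
      p (k 0) * ∏ j ∈ Finset.range N,
        NormedSpace.exp (((t (j + 1) : ℝ) - t j) • G) (k j) (k (j + 1))

/-- Parameters of a sequence of `d`-class Markov-modulated `M/M/n + M` queues with a `K`-state
environment. The functions `lamn n i k`, `mun n i k`, `gamn n i k` are the arrival, service and
abandonment rates of class `i` in the `n`-th system while the environment is in state `k`. -/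
structure ModelParams (d K : ℕ) where
  /-- exponent of the speed of the environment -/
  α : ℝ
  /-- unscaled transition rate matrix of the environment -/
  gen : Matrix (Fin K) (Fin K) ℝ
  /-- stationary distribution of the environment -/
  stat : Fin K → ℝ
  lamn : ℕ → Fin d → Fin K → ℝ
  mun : ℕ → Fin d → Fin K → ℝ
  gamn : ℕ → Fin d → Fin K → ℝ
  lam : Fin d → Fin K → ℝ
  mu : Fin d → Fin K → ℝ
  gam : Fin d → Fin K → ℝ
  lamHat : Fin d → Fin K → ℝ
  muHat : Fin d → Fin K → ℝ

namespace ModelParams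

variable {d K : ℕ} (M : ModelParams d K)

noncomputable def β : ℝ := max (1 / 2) (1 - M.α / 2)

/-- averaged arrival rate `λ_i^π` -/
noncomputable def lamPi (i : Fin d) : ℝ := ∑ k, M.stat k * M.lam i k

/-- averaged service rate `μ_i^π` -/
noncomputable def muPi (i : Fin d) : ℝ := ∑ k, M.stat k * M.mu i k

noncomputable def ρ (i : Fin d) : ℝ := M.lamPi i / M.muPi i

/-- Standing assumptions on the parameters: a fast irreducible environment, convergence of the
rates, and critical load (the "averaged" Halfin-Whitt regime). -/
structure IsAveragedHW : Prop where
  α_pos : 0 < M.α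
  gen_irreducible : IsIrreducibleGenerator M.gen
  stat_nonneg : ∀ k, 0 ≤ M.stat k
  stat_sum : ∑ k, M.stat k = 1
  stat_invariant : ∀ l, ∑ k, M.stat k * M.gen k l = 0
  lamn_nonneg : ∀ n, 1 ≤ n → ∀ i k, 0 ≤ M.lamn n i k
  mun_pos : ∀ n, 1 ≤ n → ∀ i k, 0 < M.mun n i k
  gamn_pos : ∀ n, 1 ≤ n → ∀ i k, 0 < M.gamn n i k
  lam_pos : ∀ i k, 0 < M.lam i k
  mu_pos : ∀ i k, 0 < M.mu i k
  gam_pos : ∀ i k, 0 < M.gam i k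
  tendsto_lam : ∀ i k, Tendsto (fun n : ℕ => (n : ℝ)⁻¹ * M.lamn n i k) atTop (𝓝 (M.lam i k))
  tendsto_mu : ∀ i k, Tendsto (fun n : ℕ => M.mun n i k) atTop (𝓝 (M.mu i k))
  tendsto_gam : ∀ i k, Tendsto (fun n : ℕ => M.gamn n i k) atTop (𝓝 (M.gam i k))
  tendsto_lamHat : ∀ i k, Tendsto
    (fun n : ℕ => (n : ℝ) ^ (-M.β) * (M.lamn n i k - n * M.lam i k)) atTop (𝓝 (M.lamHat i k))
  tendsto_muHat : ∀ i k, Tendsto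
    (fun n : ℕ => (n : ℝ) ^ (1 - M.β) * (M.mun n i k - M.mu i k)) atTop (𝓝 (M.muHat i k))
  critical : ∑ i, M.ρ i = 1

end ModelParams

/-- The processes of one queueing system: unit-rate counting processes `Astar`, `Sstar`, `Rstar`
driving arrivals, services and abandonments, the environment `J`, the queue lengths `Q`, and the
scheduling policy `Z` (numbers of customers in service). -/
structure QueueProcesses (Ω : Type*) (d K : ℕ) where
  Astar : Fin d → ℝ≥0 → Ω → ℕ
  Sstar : Fin d → ℝ≥0 → Ω → ℕ
  Rstar : Fin d → ℝ≥0 → Ω → ℕ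
  J : ℝ≥0 → Ω → Fin K
  Q : ℝ≥0 → Ω → Fin d → ℕ
  Z : ℝ≥0 → Ω → Fin d → ℕ

namespace QueueProcesses

variable {Ω : Type*} {d K : ℕ} (S : QueueProcesses Ω d K) (M : ModelParams d K) (n : ℕ)

/-- numbers of customers in the system, `X = Q + Z` -/
def X (t : ℝ≥0) (ω : Ω) (i : Fin d) : ℕ := S.Q t ω i + S.Z t ω i

/-- `∫₀ᵗ λ_i^n(J(s)) ds` -/
noncomputable def clockA (i : Fin d) (t : ℝ≥0) (ω : Ω) : ℝ≥0 :=
  (timeIntegral (fun s => M.lamn n i (S.J s ω)) t).toNNReal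

/-- `∫₀ᵗ μ_i^n(J(s)) Z_i(s) ds` -/
noncomputable def clockS (i : Fin d) (t : ℝ≥0) (ω : Ω) : ℝ≥0 :=
  (timeIntegral (fun s => M.mun n i (S.J s ω) * S.Z s ω i) t).toNNReal

/-- `∫₀ᵗ γ_i^n(J(s)) Q_i(s) ds` -/
noncomputable def clockR (i : Fin d) (t : ℝ≥0) (ω : Ω) : ℝ≥0 :=
  (timeIntegral (fun s => M.gamn n i (S.J s ω) * S.Q s ω i) t).toNNReal

/-- arrivals of class `i` up to time `t` -/
noncomputable def arr (i : Fin d) (t : ℝ≥0) (ω : Ω) : ℕ := S.Astar i (S.clockA M n i t ω) ω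

/-- service completions of class `i` up to time `t` -/
noncomputable def srv (i : Fin d) (t : ℝ≥0) (ω : Ω) : ℕ := S.Sstar i (S.clockS M n i t ω) ω

/-- abandonments of class `i` up to time `t` -/
noncomputable def abn (i : Fin d) (t : ℝ≥0) (ω : Ω) : ℕ := S.Rstar i (S.clockR M n i t ω) ω

/-- `S` is a version of the `n`-th system of the model `M`, with a deterministic initial number of
customers of each class. -/
structure IsModel [MeasurableSpace Ω] (P : Measure Ω) : Prop where
  poisson_A : ∀ i, IsUnitPoisson P (S.Astar i)
  poisson_S : ∀ i, IsUnitPoisson P (S.Sstar i)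
  poisson_R : ∀ i, IsUnitPoisson P (S.Rstar i)
  chain : IsMarkovChain P ((n : ℝ) ^ M.α • M.gen) M.stat S.J
  indep_poisson : iIndepFun
    (fun (j : Fin d ⊕ Fin d ⊕ Fin d) (ω : Ω) (t : ℝ≥0) =>
      Sum.elim S.Astar (Sum.elim S.Sstar S.Rstar) j t ω) P
  indep_env : IndepFun (fun (ω : Ω) (t : ℝ≥0) => S.J t ω)
    (fun (ω : Ω) (j : Fin d ⊕ Fin d ⊕ Fin d) (t : ℝ≥0) =>
      Sum.elim S.Astar (Sum.elim S.Sstar S.Rstar) j t ω) P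
  measurable_Q : ∀ t, Measurable (S.Q t)
  measurable_Z : ∀ t, Measurable (S.Z t)
  cadlag_Q : ∀ ω, IsCadlagPath fun t => S.Q t ω
  cadlag_Z : ∀ ω, IsCadlagPath fun t => S.Z t ω
  initial : ∃ x₀ : Fin d → ℕ, ∀ᵐ ω ∂P, S.X 0 ω = x₀
  capacity : ∀ᵐ ω ∂P, ∀ t, ∑ i, S.Z t ω i ≤ n
  dynamics : ∀ᵐ ω ∂P, ∀ t i, (S.X t ω i : ℤ) =
    S.X 0 ω i + S.arr M n i t ω - S.srv M n i t ω - S.abn M n i t ω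

/-- The diffusion-scaled environment process `L̂^n_i`. -/
noncomputable def LHat (i : Fin d) (t : ℝ≥0) (ω : Ω) : ℝ :=
  (n : ℝ) ^ (1 - M.β) * timeIntegral (fun s => M.lam i (S.J s ω) - M.lamPi i) t
    - (n : ℝ) ^ (1 - M.β) * M.ρ i * timeIntegral (fun s => M.mu i (S.J s ω) - M.muPi i) t

/-- The first time from `t` on at which the environment is in its first state. -/
noncomputable def τ [NeZero K] (t : ℝ≥0) (ω : Ω) : ℝ≥0 := sInf {r | t ≤ r ∧ S.J r ω = 0}

/-- The σ-algebra generated by the (measurable) null sets. -/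
@[reducible] def nullSigma [MeasurableSpace Ω] (P : Measure Ω) : MeasurableSpace Ω :=
  MeasurableSpace.generateFrom {s | MeasurableSet s ∧ P s = 0}

/-- The history `ℱ_t^n` of all processes up to time `t`, augmented by the null sets. -/
@[reducible] noncomputable def history [MeasurableSpace Ω] (P : Measure Ω) (t : ℝ≥0) : MeasurableSpace Ω :=
  (⨆ s : Set.Iic t,
    (⨆ i, (MeasurableSpace.comap (S.arr M n i s) ⊤ ⊔ MeasurableSpace.comap (S.srv M n i s) ⊤ ⊔
      MeasurableSpace.comap (S.abn M n i s) ⊤)) ⊔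
    MeasurableSpace.comap (S.Q s) inferInstance ⊔ MeasurableSpace.comap (S.Z s) inferInstance ⊔
    MeasurableSpace.comap (S.X s) inferInstance ⊔ MeasurableSpace.comap (S.J s) ⊤)
  ⊔ nullSigma P

/-- The future `𝒢_{t,r}^n`: increments after the time `τ(t)`. Services and abandonments enter
through the driving Poisson processes, beyond the points that their internal clocks have reached
at time `τ(t)`. -/
@[reducible] noncomputable def future [NeZero K] [MeasurableSpace Ω] (P : Measure Ω) (t r : ℝ≥0) :
    MeasurableSpace Ω :=
  (⨆ i,
    (MeasurableSpace.comap
      (fun ω => (S.arr M n i (S.τ t ω + r) ω : ℤ) - S.arr M n i (S.τ t ω) ω) ⊤ ⊔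
    MeasurableSpace.comap
      (fun ω => (S.Sstar i (S.clockS M n i (S.τ t ω) ω + r) ω : ℤ)
        - S.srv M n i (S.τ t ω) ω) ⊤ ⊔
    MeasurableSpace.comap
      (fun ω => (S.Rstar i (S.clockR M n i (S.τ t ω) ω + r) ω : ℤ)
        - S.abn M n i (S.τ t ω) ω) ⊤ ⊔
    MeasurableSpace.comap
      (fun ω => S.LHat M n i (S.τ t ω + r) ω - S.LHat M n i (S.τ t ω) ω) (borel ℝ)))
  ⊔ nullSigma P

/-- The scheduling policy `Z` is admissible: work-conserving and non-anticipative. Preemption is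
allowed, that is, `Z` may be changed at any time, which is no restriction on `Z`. -/
structure IsAdmissible [NeZero K] [MeasurableSpace Ω] (P : Measure Ω) : Prop where
  workConserving : ∀ᵐ ω ∂P, ∀ t, ∑ i, S.Z t ω i = min (∑ i, S.X t ω i) n
  adapted : ∀ t, Measurable[S.history M n P t] (S.Z t)
  nonAnticipative : ∀ t r, Indep (S.history M n P t) (S.future M n P t r) P

/-- The diffusion-scaled process `X̂^n_i = n^{-β}(X^n_i - ρ_i n)`, with Euclidean norm. -/
noncomputable def XHat (t : ℝ≥0) (ω : Ω) : EuclideanSpace ℝ (Fin d) :=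
  WithLp.toLp 2 fun i => (n : ℝ) ^ (-M.β) * ((S.X t ω i : ℝ) - M.ρ i * n)

/-- The proportions-scheduling policy `Û^n`: the composition of the queue if there are more than
`n` customers, and the last unit vector otherwise. -/
noncomputable def UHat (t : ℝ≥0) (ω : Ω) : EuclideanSpace ℝ (Fin d) :=
  WithLp.toLp 2 fun i =>
    if n < ∑ j, S.X t ω j then
      ((S.Z t ω i : ℝ) - S.X t ω i) / ((n : ℝ) - ∑ j, (S.X t ω j : ℝ))
    else if (i : ℕ) + 1 = d then 1 else 0

end QueueProcesses

/-- The running cost `c |⟨e, x⟩⁺ u|^m`. -/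
noncomputable def runningCost {d : ℕ} (c m : ℝ) (x u : EuclideanSpace ℝ (Fin d)) : ℝ :=
  c * ‖(max (∑ i, x i) 0) • u‖ ^ m

/-- `limsup_{T → ∞} (1/T) E[∫₀ᵀ f(s) ds]` of a nonnegative process, as an extended real. -/
noncomputable def longRunAverage {Ω : Type*} [MeasurableSpace Ω] (P : Measure Ω)
    (f : ℝ≥0 → Ω → ℝ) : ℝ≥0∞ :=
  limsup (fun T : ℝ => (ENNReal.ofReal T)⁻¹ *
    ∫⁻ ω, ∫⁻ s in Set.Ioc (0 : ℝ) T, ENNReal.ofReal (f s.toNNReal ω) ∂volume ∂P) atTop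

/-- The ergodic cost of the `n`-th system. -/
noncomputable def ergodicCost {Ω : Type*} [MeasurableSpace Ω] {d K : ℕ} (M : ModelParams d K)
    (c m : ℝ) (n : ℕ) (P : Measure Ω) (S : QueueProcesses Ω d K) : ℝ≥0∞ :=
  longRunAverage P fun s ω => runningCost c m (S.XHat M n s ω) (S.UHat n s ω)

/-!
The argument is pathwise and does not see the scheduling policy: whatever an admissible policy does,
the number of customers differs from its centring only by noise and by the queues, and the running
cost is exactly a power of the norm of the scaled queue
(`QueueProcesses.IsRegularPath.runningCost_eq`). So it suffices to bound, for each size `n` of the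
system, `E ∫₀ᵀ |X̂|^m` by a constant times `E ∫₀ᵀ |Q̂|^m + T`, up to a constant in time. A single `n` is
trivial, since at most `n` customers are in service; the point is uniformity over large `n`.

*Deterministic part.* Cut time into windows of a fixed length `h` and write `N = n^(1-β)`.
If over a window the arrivals of class `i` stay within `ε` of `ρᵢ N ∫ μᵢ` and the services within `ε`
of their compensator `∫ μᵢ (ρᵢ N + xᵢ - qᵢ)`, then `xᵢ` solves a linear equation with a restoring force
`-μᵢ xᵢ`, up to errors of size `ε + ∫ q` and the abandonments. Abandonments only push `xᵢ` down, so
`∑ xᵢ⁺` contracts by a fixed factor. For `xᵢ⁻` look at the last time in the window at which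
all servers were busy: then `∑ xⱼ ≥ 0`, so `xᵢ⁻ ≤ ∑ xⱼ⁺`, and afterwards queues are empty and nobody
abandons (`IsScaledPath.exists_full_or_idle`, `IsControlledWindow.neg_x_le`). Hence `|x|` contracts
along the windows up to the errors, which sums to `exists_bound_of_controlled`.

*Noise.* Poisson noise has order `√n ≤ n^β` on clock intervals of length `n`, with all moments
(`IsUnitPoisson.lintegral_cellDev_pow_le`). The service clock, however, runs at a speed chosen by the
policy, and may linger for many windows in an interval of bad noise. Only *active* windows, in which
clock and count advance noticeably, need control of the services: in the other ones nearly no customer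
of the class was in service for a time `h`, so that the class has few customers or the other errors
are of order `N` (`IsControlledWindow.services_or`). The number of active windows which
start in the same clock interval is at most linear in the noise there, so that the noise summed over
active windows is bounded by the sum over the intervals of a higher power, and no longer depends on
the policy (`IsClockedPath.sum_noise_rpow_le`).

*Environment.* With `f = λᵢ - ρᵢ μᵢ`, of mean zero under the stationary law, `n^(1-β) ∫ f(J)` over a
window has all moments uniformly in `n`: the Poisson equation for `f` gives exponential moments of
`∫ f(J)` through the finite-dimensional distributions of `J`, and a dyadic chaining bound controls the
maximum over the window (`exists_lintegral_exp_le`, `lintegral_maxDev_pow_le`,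
`exists_environment_bound`). Here `n^(2-2β) ≤ n^α` is used.

`QueueProcesses.exists_pathwise_bound` combines these on a path, and
`QueueProcesses.exists_expectedMoment_le` takes expectations.
-/

/-! ### A maximal inequality by dyadic splitting -/

lemma exists_add_pow_le (p : ℕ) : ∃ C : ℝ≥0, 1 ≤ C ∧ ∀ x y : ℝ≥0∞,
    (x + y) ^ p ≤ C * x ^ p + (3 / 2 : ℝ≥0) * y ^ p := by
  obtain ⟨ε, hε, hε'⟩ : ∃ ε : ℝ≥0, 0 < ε ∧ (1 + ε) ^ p ≤ 3 / 2 := by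
    have h : Tendsto (fun ε : ℝ≥0 => (1 + ε) ^ p) (𝓝[>] 0) (𝓝 1) := by
      have : Tendsto (fun ε : ℝ≥0 => (1 + ε) ^ p) (𝓝 0) (𝓝 ((1 + 0) ^ p)) :=
        (by fun_prop : Continuous fun ε : ℝ≥0 => (1 + ε) ^ p).tendsto 0
      simpa using this.mono_left nhdsWithin_le_nhds
    have h1 : (1 : ℝ≥0) < 3 / 2 := by
      rw [lt_div_iff₀ (by norm_num)]; norm_num
    obtain ⟨ε, h2, h3⟩ := ((h.eventually_lt_const h1).and self_mem_nhdsWithin).exists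
    exact ⟨ε, h3, h2.le⟩
  refine ⟨(1 + ε⁻¹) ^ p, one_le_pow₀ (by simp), fun x y => ?_⟩
  rcases le_total x (ε * y) with h | h
  · calc (x + y) ^ p ≤ (ε * y + y) ^ p := by gcongr
      _ = ((1 + ε) ^ p : ℝ≥0) * y ^ p := by
        rw [ENNReal.coe_pow, ← mul_pow]; push_cast; ring
      _ ≤ (3 / 2 : ℝ≥0) * y ^ p := by gcongr
      _ ≤ _ := le_add_self
  · have hy : y ≤ (ε⁻¹ : ℝ≥0) * x := by
      calc y = (ε⁻¹ : ℝ≥0) * (ε * y) := by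
            rw [← mul_assoc, ← ENNReal.coe_mul, inv_mul_cancel₀ hε.ne', ENNReal.coe_one, one_mul]
        _ ≤ _ := by gcongr
    calc (x + y) ^ p ≤ (x + (ε⁻¹ : ℝ≥0) * x) ^ p := by gcongr
      _ = ((1 + ε⁻¹) ^ p : ℝ≥0) * x ^ p := by
        rw [ENNReal.coe_pow, ← mul_pow]; push_cast; ring
      _ ≤ _ := le_self_add

/-- The largest deviation from the initial value over the first `L` steps after `s`. -/
noncomputable def maxDev {Ω : Type*} (ξ : ℕ → Ω → ℝ) (s L : ℕ) (ω : Ω) : ℝ≥0∞ :=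
  (Finset.range (L + 1)).sup fun j => ‖ξ (s + j) ω - ξ s ω‖ₑ

lemma measurable_maxDev {Ω : Type*} [MeasurableSpace Ω] {ξ : ℕ → Ω → ℝ}
    (hξ : ∀ i, Measurable (ξ i)) (s L : ℕ) : Measurable (maxDev ξ s L) := by
  unfold maxDev
  simp_rw [Finset.sup_eq_iSup]
  refine Measurable.biSup _ (Set.to_countable _) fun j _ => ?_
  exact ((hξ _).sub (hξ _)).enorm

lemma le_maxDev {Ω : Type*} (ξ : ℕ → Ω → ℝ) (s : ℕ) {j L : ℕ} (h : j ≤ L) (ω : Ω) :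
    ‖ξ (s + j) ω - ξ s ω‖ₑ ≤ maxDev ξ s L ω :=
  Finset.le_sup (f := fun j => ‖ξ (s + j) ω - ξ s ω‖ₑ) (Finset.mem_range.2 (by omega))

lemma maxDev_mono {Ω : Type*} (ξ : ℕ → Ω → ℝ) (s : ℕ) {L L' : ℕ} (h : L ≤ L') (ω : Ω) :
    maxDev ξ s L ω ≤ maxDev ξ s L' ω :=
  Finset.sup_mono (Finset.range_mono (by omega))

lemma maxDev_ne_top {Ω : Type*} (ξ : ℕ → Ω → ℝ) (s L : ℕ) (ω : Ω) : maxDev ξ s L ω ≠ ⊤ := by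
  unfold maxDev
  rw [← lt_top_iff_ne_top, Finset.sup_lt_iff (by simp)]
  intro j _
  exact enorm_lt_top

lemma maxDev_two_pow_succ_le {Ω : Type*} (ξ : ℕ → Ω → ℝ) (s k : ℕ) (ω : Ω) :
    maxDev ξ s (2 ^ (k + 1)) ω ≤ ‖ξ (s + 2 ^ k) ω - ξ s ω‖ₑ +
      max (maxDev ξ s (2 ^ k) ω) (maxDev ξ (s + 2 ^ k) (2 ^ k) ω) := by
  refine Finset.sup_le fun j hj => ?_
  rw [Finset.mem_range, pow_succ] at hj
  rcases le_total j (2 ^ k) with h | h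
  · exact (le_maxDev ξ s h ω).trans ((le_max_left _ _).trans le_add_self)
  · have h1 := le_maxDev ξ (s + 2 ^ k) (show j - 2 ^ k ≤ 2 ^ k by omega) ω
    rw [show s + 2 ^ k + (j - 2 ^ k) = s + j by omega] at h1
    calc ‖ξ (s + j) ω - ξ s ω‖ₑ
        = ‖(ξ (s + 2 ^ k) ω - ξ s ω) + (ξ (s + j) ω - ξ (s + 2 ^ k) ω)‖ₑ := by congr 1; ring
      _ ≤ _ := enorm_add_le _ _
      _ ≤ _ := by gcongr; exact h1.trans (le_max_right _ _)

/-- If increments over `j` steps have `p`-th moments of order `j ^ q` with `q ≥ 2`, then so has their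
maximum. Halving the time interval, the maximum over both halves costs at most a factor
`3 / 2 * 2 < 2 ^ q`, which closes an induction on dyadic lengths. -/
lemma lintegral_maxDev_pow_le (p : ℕ) : ∃ C : ℝ≥0, ∀ {Ω : Type*} [MeasurableSpace Ω]
    (P : Measure Ω) (ξ : ℕ → Ω → ℝ) (_ : ∀ i, Measurable (ξ i)) (q : ℕ) (_ : 2 ≤ q) (D : ℝ≥0∞)
    (_ : ∀ i j, ∫⁻ ω, ‖ξ (i + j) ω - ξ i ω‖ₑ ^ p ∂P ≤ D * (j : ℝ≥0∞) ^ q) (s L : ℕ),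
    1 ≤ L → ∫⁻ ω, maxDev ξ s L ω ^ p ∂P ≤ C * (D * ((2 * L : ℕ) : ℝ≥0∞) ^ q) := by
  obtain ⟨C, hC1, hC⟩ := exists_add_pow_le p
  refine ⟨C, ?_⟩
  intro Ω _ P ξ hξ q hq D hD s L hL
  have key : ∀ k s, ∫⁻ ω, maxDev ξ s (2 ^ k) ω ^ p ∂P ≤
      C * (D * ((2 ^ k : ℕ) : ℝ≥0∞) ^ q) := by
    intro k
    induction k with
    | zero =>
      intro s
      have h0 : ∀ ω, maxDev ξ s (2 ^ 0) ω = ‖ξ (s + 1) ω - ξ s ω‖ₑ := by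
        intro ω
        simp [maxDev, Finset.range_add_one]
      simp_rw [h0]
      refine (hD s 1).trans ?_
      simp only [pow_zero, Nat.cast_one, one_pow, mul_one]
      exact le_mul_of_one_le_left' (by exact_mod_cast hC1)
    | succ k ih =>
      intro s
      have hm1 := measurable_maxDev hξ s (2 ^ k)
      have hm2 := measurable_maxDev hξ (s + 2 ^ k) (2 ^ k)
      have hm3 : Measurable fun ω => ‖ξ (s + 2 ^ k) ω - ξ s ω‖ₑ := ((hξ _).sub (hξ _)).enorm
      calc ∫⁻ ω, maxDev ξ s (2 ^ (k + 1)) ω ^ p ∂P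
          ≤ ∫⁻ ω, (C * ‖ξ (s + 2 ^ k) ω - ξ s ω‖ₑ ^ p + (3 / 2 : ℝ≥0) *
              (maxDev ξ s (2 ^ k) ω ^ p + maxDev ξ (s + 2 ^ k) (2 ^ k) ω ^ p)) ∂P := by
            refine lintegral_mono fun ω => ?_
            refine (pow_le_pow_left₀ (zero_le) (maxDev_two_pow_succ_le ξ s k ω) _).trans ?_
            refine (hC _ _).trans ?_
            gcongr
            rcases max_choice (maxDev ξ s (2 ^ k) ω) (maxDev ξ (s + 2 ^ k) (2 ^ k) ω) with h | h <;>
              rw [h]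
            · exact le_self_add
            · exact le_add_self
        _ = C * ∫⁻ ω, ‖ξ (s + 2 ^ k) ω - ξ s ω‖ₑ ^ p ∂P + (3 / 2 : ℝ≥0) *
              (∫⁻ ω, maxDev ξ s (2 ^ k) ω ^ p ∂P +
                ∫⁻ ω, maxDev ξ (s + 2 ^ k) (2 ^ k) ω ^ p ∂P) := by
            rw [lintegral_add_left (by fun_prop), lintegral_const_mul _ (by fun_prop),
              lintegral_const_mul _ (by fun_prop), lintegral_add_left (by fun_prop)]
        _ ≤ C * (D * ((2 ^ k : ℕ) : ℝ≥0∞) ^ q) + (3 / 2 : ℝ≥0) *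
              (C * (D * ((2 ^ k : ℕ) : ℝ≥0∞) ^ q) + C * (D * ((2 ^ k : ℕ) : ℝ≥0∞) ^ q)) := by
            gcongr
            · exact hD _ _
            · exact ih _
            · exact ih _
        _ = 4 * (C * (D * ((2 ^ k : ℕ) : ℝ≥0∞) ^ q)) := by
            generalize (C * (D * ((2 ^ k : ℕ) : ℝ≥0∞) ^ q)) = y
            have h3 : ((3 / 2 : ℝ≥0) : ℝ≥0∞) * (y + y) = 3 * y := by
              rw [← two_mul, ← mul_assoc]
              congr 1
              have : ((3 / 2 : ℝ≥0) * 2 : ℝ≥0) = 3 := by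
                rw [div_mul_cancel₀]; norm_num
              exact_mod_cast this
            rw [h3]
            ring
        _ ≤ 2 ^ q * (C * (D * ((2 ^ k : ℕ) : ℝ≥0∞) ^ q)) := by
            gcongr
            calc (4 : ℝ≥0∞) = 2 ^ 2 := by norm_num
              _ ≤ 2 ^ q := pow_le_pow_right₀ (by norm_num) hq
        _ = C * (D * ((2 ^ (k + 1) : ℕ) : ℝ≥0∞) ^ q) := by
            rw [pow_succ 2 k]; push_cast; rw [mul_pow]; ring
  obtain ⟨k, hk1, hk2⟩ : ∃ k, L ≤ 2 ^ k ∧ 2 ^ k ≤ 2 * L := by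
    refine ⟨Nat.clog 2 L, Nat.le_pow_clog (by norm_num) L, ?_⟩
    rcases hL.eq_or_lt with rfl | hL
    · simp
    · have := Nat.pow_pred_clog_lt_self (b := 2) (by norm_num) hL
      have h1 : 0 < Nat.clog 2 L := Nat.clog_pos (by norm_num) hL
      obtain ⟨r, hr⟩ : ∃ r, Nat.clog 2 L = r + 1 := ⟨_, (Nat.succ_pred_eq_of_pos h1).symm⟩
      rw [hr] at this ⊢
      simp only [Nat.pred_succ] at this
      rw [pow_succ]; omega
  calc ∫⁻ ω, maxDev ξ s L ω ^ p ∂P ≤ ∫⁻ ω, maxDev ξ s (2 ^ k) ω ^ p ∂P :=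
        lintegral_mono fun ω => pow_le_pow_left₀ (zero_le) (maxDev_mono ξ s hk1 ω) _
    _ ≤ _ := key k s
    _ ≤ _ := by gcongr

/-! ### Fluctuations of a Poisson process -/

lemma lintegral_exp_poissonMeasure (r : ℝ≥0) (θ : ℝ) :
    ∫⁻ k : ℕ, ENNReal.ofReal (Real.exp (θ * k)) ∂(poissonMeasure r) =
      ENNReal.ofReal (Real.exp (r * (Real.exp θ - 1))) := by
  have h : HasSum (fun k : ℕ => Real.exp (-r) * r ^ k / k.factorial * Real.exp (θ * k))
      (Real.exp (r * (Real.exp θ - 1))) := by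
    have h1 := (NormedSpace.expSeries_div_hasSum_exp (r * Real.exp θ : ℝ)).mul_left (Real.exp (-r))
    rw [← Real.exp_eq_exp_ℝ, ← Real.exp_add] at h1
    convert! h1 using 1
    · ext k
      rw [mul_comm θ, Real.exp_nat_mul, mul_pow]; ring
    · congr 1; ring
  rw [poissonMeasure, lintegral_sum_measure, ← h.tsum_eq, ENNReal.ofReal_tsum_of_nonneg
    (fun k => by positivity) h.summable]
  refine tsum_congr fun k => ?_
  rw [lintegral_smul_measure, lintegral_dirac, smul_eq_mul, ← ENNReal.ofReal_mul (by positivity)]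

lemma pow_two_mul_le_exp_add_exp (x : ℝ) (q : ℕ) :
    x ^ (2 * q) ≤ (2 * q).factorial * (Real.exp x + Real.exp (-x)) := by
  have h1 := Real.pow_div_factorial_le_exp |x| (abs_nonneg x) (2 * q)
  have h2 : |x| ^ (2 * q) = x ^ (2 * q) := by rw [pow_mul, pow_mul, sq_abs]
  rw [h2, div_le_iff₀ (by positivity)] at h1
  refine h1.trans ?_
  rw [mul_comm]
  gcongr
  rcases abs_cases x with ⟨h, _⟩ | ⟨h, _⟩ <;> rw [h]
  · linarith [Real.exp_pos (-x)]
  · linarith [Real.exp_pos x]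

lemma enorm_pow_two_mul_le {x A : ℝ} (hA : 0 < A) (q : ℕ) {θ : ℝ} (hθ : θ ^ 2 = A⁻¹) :
    ‖x‖ₑ ^ (2 * q) ≤ ENNReal.ofReal ((2 * q).factorial * A ^ q) *
      (ENNReal.ofReal (Real.exp (θ * x)) + ENNReal.ofReal (Real.exp (-θ * x))) := by
  rw [← ENNReal.ofReal_add (by positivity) (by positivity), ← ENNReal.ofReal_mul (by positivity),
    Real.enorm_eq_ofReal_abs, ← ENNReal.ofReal_pow (abs_nonneg _)]
  refine ENNReal.ofReal_le_ofReal ?_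
  have h := pow_two_mul_le_exp_add_exp (θ * x) q
  have hy : |x| ^ (2 * q) = A ^ q * (θ * x) ^ (2 * q) := by
    rw [mul_pow, pow_mul θ, hθ, pow_mul |x|, sq_abs, ← pow_mul, ← mul_assoc, ← mul_pow,
      mul_inv_cancel₀ hA.ne', one_pow, one_mul]
  rw [hy, neg_mul]
  calc _ ≤ A ^ q * ((2 * q).factorial * (Real.exp (θ * x) + Real.exp (-(θ * x)))) := by gcongr
    _ = _ := by ring

namespace IsUnitPoisson

/-- The compensated process at integer times. -/
noncomputable def comp {Ω : Type*} (N : ℝ≥0 → Ω → ℕ) (j : ℕ) (ω : Ω) : ℝ := (N j ω : ℝ) - j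

/-- The fluctuation of the compensated process over a cell of length `n`, on the scale `√n`. -/
noncomputable def cellDev {Ω : Type*} (N : ℝ≥0 → Ω → ℕ) (n j : ℕ) (ω : Ω) : ℝ :=
  1 + ((maxDev (comp N) (j * n) n ω).toReal + 1) / √n

lemma one_le_cellDev {Ω : Type*} (N : ℝ≥0 → Ω → ℕ) (n j : ℕ) (ω : Ω) : 1 ≤ cellDev N n j ω := by
  unfold cellDev
  have : 0 ≤ ((maxDev (comp N) (j * n) n ω).toReal + 1) / √n := by positivity
  linarith

lemma sqrt_mul_cellDev_le (N : ℝ≥0 → Ω → ℕ) (n j : ℕ) (hn : 1 ≤ n) (ω : Ω) :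
    (maxDev (comp N) (j * n) n ω).toReal + 1 ≤ √n * cellDev N n j ω := by
  have hs : 0 < √(n : ℝ) := Real.sqrt_pos.2 (by exact_mod_cast hn)
  unfold cellDev
  rw [mul_add, mul_div_cancel₀ _ hs.ne']
  linarith

variable {Ω : Type*} [MeasurableSpace Ω] {P : Measure Ω} {N : ℝ≥0 → Ω → ℕ}

lemma measurable_comp (hN : IsUnitPoisson P N) (j : ℕ) : Measurable (comp N j) :=
  (measurable_from_top.comp (hN.measurable j)).sub_const _

lemma lintegral_comp_pow_le (hN : IsUnitPoisson P N) (q i j : ℕ) :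
    ∫⁻ ω, ‖comp N (i + j) ω - comp N i ω‖ₑ ^ (2 * (q + 1)) ∂P ≤
      ENNReal.ofReal ((2 * (q + 1)).factorial * (2 * Real.exp 1)) * (j : ℝ≥0∞) ^ (q + 1) := by
  rcases Nat.eq_zero_or_pos j with rfl | hj
  · simp
  have hj' : (0 : ℝ) < j := by exact_mod_cast hj
  have hs : 0 < √(j : ℝ) := Real.sqrt_pos.2 hj'
  have hs1 : 1 ≤ √(j : ℝ) := Real.one_le_sqrt.2 (by exact_mod_cast hj)
  have hsq : √(j : ℝ) ^ 2 = j := Real.sq_sqrt hj'.le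
  have hexp : ∀ θ : ℝ, |θ| ≤ 1 → θ ^ 2 = (j : ℝ)⁻¹ →
      ∫⁻ ω, ENNReal.ofReal (Real.exp (θ * (comp N (i + j) ω - comp N i ω))) ∂P ≤
        ENNReal.ofReal (Real.exp 1) := by
    intro θ hθ hθ2
    have hlaw := hN.law i (i + j : ℕ) (by exact_mod_cast Nat.le_add_right i j)
    have hmap := lintegral_map (μ := P) (f := fun k : ℕ => ENNReal.ofReal (Real.exp (θ * k)))
      (g := fun ω => N ((i + j : ℕ) : ℝ≥0) ω - N i ω) (by fun_prop)
      ((Measurable.of_discrete (f := fun x : ℕ × ℕ => x.1 - x.2)).comp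
        ((hN.measurable _).prodMk (hN.measurable _)))
    rw [hlaw, lintegral_exp_poissonMeasure] at hmap
    have h1 : ∀ ω, ENNReal.ofReal (Real.exp (θ * (comp N (i + j) ω - comp N i ω))) =
        ENNReal.ofReal (Real.exp (-(θ * j))) *
          ENNReal.ofReal (Real.exp (θ * ((N ((i + j : ℕ) : ℝ≥0) ω - N i ω : ℕ) : ℝ))) := by
      intro ω
      have hle : N i ω ≤ N ((i + j : ℕ) : ℝ≥0) ω :=
        hN.mono ω (by exact_mod_cast Nat.le_add_right i j)
      rw [← ENNReal.ofReal_mul (by positivity), ← Real.exp_add, Nat.cast_sub hle]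
      congr 2
      unfold comp
      push_cast
      ring
    simp_rw [h1]
    rw [lintegral_const_mul' _ _ ENNReal.ofReal_ne_top, ← hmap,
      ← ENNReal.ofReal_mul (by positivity), ← Real.exp_add]
    refine ENNReal.ofReal_le_ofReal (Real.exp_le_exp.2 ?_)
    have h2 : ((((i + j : ℕ) : ℝ≥0) - (i : ℝ≥0) : ℝ≥0) : ℝ) = j := by
      push_cast
      rw [add_tsub_cancel_left]; simp
    rw [h2]
    have h3 := Real.abs_exp_sub_one_sub_id_le hθ
    have h4 := (abs_le.1 h3).2
    calc -(θ * j) + j * (Real.exp θ - 1) = j * (Real.exp θ - 1 - θ) := by ring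
      _ ≤ j * θ ^ 2 := by gcongr
      _ = 1 := by rw [hθ2, mul_inv_cancel₀ hj'.ne']
  set θ : ℝ := (√(j : ℝ))⁻¹ with hθ
  have hθ1 : |θ| ≤ 1 := by
    rw [abs_of_pos (by positivity)]; exact inv_le_one_of_one_le₀ hs1
  have hθ2 : θ ^ 2 = (j : ℝ)⁻¹ := by rw [hθ, inv_pow, hsq]
  refine (lintegral_mono fun ω => enorm_pow_two_mul_le hj' (q + 1) hθ2).trans ?_
  have hm : Measurable fun ω => ENNReal.ofReal (Real.exp (θ * (comp N (i + j) ω - comp N i ω))) := by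
    have := hN.measurable_comp (i + j)
    have := hN.measurable_comp i
    fun_prop
  rw [lintegral_const_mul' _ _ ENNReal.ofReal_ne_top, lintegral_add_left hm]
  calc _ ≤ ENNReal.ofReal ((2 * (q + 1)).factorial * (j : ℝ) ^ (q + 1)) *
        (ENNReal.ofReal (Real.exp 1) + ENNReal.ofReal (Real.exp 1)) := by
        gcongr
        · exact hexp θ hθ1 hθ2
        · exact hexp (-θ) (by rwa [abs_neg]) (by rw [neg_sq, hθ2])
    _ = _ := by
        rw [← ENNReal.ofReal_add (by positivity) (by positivity),
          ← ENNReal.ofReal_mul (by positivity), ← ENNReal.ofReal_natCast (n := j),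
          ← ENNReal.ofReal_pow (by positivity), ← ENNReal.ofReal_mul (by positivity)]
        congr 1; ring

lemma measurable_cellDev (hN : IsUnitPoisson P N) (n j : ℕ) : Measurable (cellDev N n j) := by
  have := measurable_maxDev hN.measurable_comp (j * n) n
  unfold cellDev
  fun_prop

/-- Deviation of the process from its mean within a cell. -/
lemma abs_sub_sub_le (hN : IsUnitPoisson P N) {n j : ℕ} (hn : 1 ≤ n) (ω : Ω) {v : ℝ≥0}
    (h1 : (j * n : ℕ) ≤ v) (h2 : v ≤ (j * n + n : ℕ)) :
    |((N v ω : ℝ) - v) - ((N (j * n : ℕ) ω : ℝ) - (j * n : ℕ))| ≤ √n * cellDev N n j ω := by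
  refine le_trans ?_ (sqrt_mul_cellDev_le N n j hn ω)
  have hdev : ∀ i ≤ n, |comp N (j * n + i) ω - comp N (j * n) ω| ≤
      (maxDev (comp N) (j * n) n ω).toReal := by
    intro i hi
    have := le_maxDev (comp N) (j * n) hi ω
    rw [← ENNReal.toReal_le_toReal enorm_ne_top (maxDev_ne_top _ _ _ _), toReal_enorm] at this
    exact this
  -- the integers on either side of `v`
  set i := ⌊v⌋₊ with hi
  have hi1 : (i : ℝ≥0) ≤ v := Nat.floor_le zero_le
  have hi2 : v < i + 1 := Nat.lt_floor_add_one v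
  have hji : j * n ≤ i := Nat.le_floor h1
  have hlow := hdev (i - j * n) (by
    have : (i : ℝ≥0) ≤ (j * n + n : ℕ) := hi1.trans h2
    have : i ≤ j * n + n := by exact_mod_cast this
    omega)
  rw [Nat.add_sub_cancel' hji] at hlow
  have hi1' : (i : ℝ) ≤ v := by exact_mod_cast hi1
  have hi2' : (v : ℝ) < i + 1 := by exact_mod_cast hi2
  have hN1 : (N i ω : ℝ) ≤ N v ω := by exact_mod_cast hN.mono ω hi1
  generalize (maxDev (comp N) (j * n) n ω).toReal = y at hlow hdev ⊢
  unfold comp at hlow hdev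
  rw [abs_le] at hlow ⊢
  constructor
  · linarith [hlow.1]
  · rcases h2.eq_or_lt with h | h
    · have h3 := hdev n le_rfl
      rw [abs_le] at h3
      rw [h, NNReal.coe_natCast]
      linarith [h3.2]
    · have hup := hdev (i + 1 - j * n) (by
        have : (i : ℝ≥0) < (j * n + n : ℕ) := hi1.trans_lt h
        have : i < j * n + n := by exact_mod_cast this
        omega)
      rw [Nat.add_sub_cancel' (by omega), abs_le] at hup
      have hN2 : (N v ω : ℝ) ≤ N (i + 1 : ℕ) ω := by
        have : v ≤ ((i + 1 : ℕ) : ℝ≥0) := by push_cast; exact hi2.le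
        exact_mod_cast hN.mono ω this
      have := hup.2
      push_cast at this hN2 ⊢
      linarith

/-- Moments of the cell fluctuations, uniformly in the cell and its length. -/
lemma lintegral_cellDev_pow_le (q : ℕ) : ∃ C : ℝ≥0, ∀ {Ω : Type*} [MeasurableSpace Ω]
    (P : Measure Ω) [IsProbabilityMeasure P] (N : ℝ≥0 → Ω → ℕ) (_ : IsUnitPoisson P N) (n j : ℕ)
    (_ : 1 ≤ n), ∫⁻ ω, ENNReal.ofReal (cellDev N n j ω ^ q) ∂P ≤ C := by
  obtain ⟨C, hC⟩ := lintegral_maxDev_pow_le (2 * (q + 2))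
  refine ⟨3 ^ (2 * (q + 2)) * (2 + C * (Real.toNNReal ((2 * (q + 2)).factorial * (2 * Real.exp 1)) * 2 ^ (q + 2))), ?_⟩
  intro Ω _ P _ N hN n j hn
  have h1 := hC P (comp N) hN.measurable_comp (q + 2) (by omega) _
    (fun i j => hN.lintegral_comp_pow_le (q + 1) i j) (j * n) n hn
  have hn0 : (0 : ℝ) < n := by exact_mod_cast hn
  have hs : 0 < √(n : ℝ) := Real.sqrt_pos.2 hn0
  have hs1 : 1 ≤ √(n : ℝ) := Real.one_le_sqrt.2 (by exact_mod_cast hn)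
  have hpt : ∀ ω, ENNReal.ofReal (cellDev N n j ω ^ q) ≤ 3 ^ (2 * (q + 2)) * (2 +
      ENNReal.ofReal (((n : ℝ) ^ (q + 2))⁻¹) * maxDev (comp N) (j * n) n ω ^ (2 * (q + 2))) := by
    intro ω
    set y := (maxDev (comp N) (j * n) n ω).toReal with hy
    have hy0 : 0 ≤ y := ENNReal.toReal_nonneg
    rw [← ENNReal.ofReal_toReal (maxDev_ne_top (comp N) (j * n) n ω), ← hy,
      ← ENNReal.ofReal_pow hy0, ← ENNReal.ofReal_mul (by positivity)]
    have e2 : (2 : ℝ≥0∞) = ENNReal.ofReal 2 := by simp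
    have e3 : (3 : ℝ≥0∞) = ENNReal.ofReal 3 := by simp
    rw [e3, e2, ← ENNReal.ofReal_pow (by norm_num), ← ENNReal.ofReal_add (by norm_num) (by positivity),
      ← ENNReal.ofReal_mul (by positivity)]
    refine ENNReal.ofReal_le_ofReal ?_
    have h1c := one_le_cellDev N n j ω
    calc cellDev N n j ω ^ q ≤ cellDev N n j ω ^ (2 * (q + 2)) :=
          pow_le_pow_right₀ h1c (by omega)
      _ ≤ (3 * max 1 (y / √n)) ^ (2 * (q + 2)) := by
          gcongr
          unfold cellDev
          rw [← hy, add_div]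
          have : 1 / √(n : ℝ) ≤ 1 := by rw [div_le_one hs]; exact hs1
          linarith [le_max_left 1 (y / √n), le_max_right 1 (y / √n)]
      _ = 3 ^ (2 * (q + 2)) * (max 1 (y / √n)) ^ (2 * (q + 2)) := mul_pow _ _ _
      _ ≤ 3 ^ (2 * (q + 2)) * (2 + ((n : ℝ) ^ (q + 2))⁻¹ * y ^ (2 * (q + 2))) := by
          gcongr
          have h2 : (y / √n) ^ (2 * (q + 2)) = ((n : ℝ) ^ (q + 2))⁻¹ * y ^ (2 * (q + 2)) := by
            rw [div_pow, pow_mul √(n : ℝ), Real.sq_sqrt hn0.le]; field_simp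
          rcases max_choice 1 (y / √n) with h | h <;> rw [h]
          · rw [one_pow]
            have : 0 ≤ ((n : ℝ) ^ (q + 2))⁻¹ * y ^ (2 * (q + 2)) := by positivity
            linarith
          · rw [h2]; linarith
  refine (lintegral_mono hpt).trans ?_
  rw [lintegral_const_mul' _ _ (by simp), lintegral_add_left (by fun_prop), lintegral_const,
    measure_univ, mul_one, lintegral_const_mul' _ _ ENNReal.ofReal_ne_top]
  push_cast
  refine mul_le_mul_right (add_le_add_right ?_ _) _
  calc _ ≤ ENNReal.ofReal (((n : ℝ) ^ (q + 2))⁻¹) * _ := mul_le_mul_right h1 _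
    _ = _ := by
      rw [ENNReal.ofReal_inv_of_pos (by positivity), ENNReal.ofReal_pow hn0.le, ENNReal.ofReal_natCast]
      push_cast
      rw [mul_pow, ENNReal.ofReal]
      have h0 : (n : ℝ≥0∞) ^ (q + 2) ≠ 0 := by simp; omega
      have h0' : (n : ℝ≥0∞) ^ (q + 2) ≠ ⊤ := by simp
      generalize (((2 * (q + 2)).factorial * (2 * Real.exp 1)).toNNReal : ℝ≥0∞) = a
      generalize (2 : ℝ≥0∞) ^ (q + 2) = b
      generalize (C : ℝ≥0∞) = c
      rw [show c * (a * (b * (n : ℝ≥0∞) ^ (q + 2))) = (n : ℝ≥0∞) ^ (q + 2) * (c * (a * b)) by ring,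
        ← mul_assoc, ENNReal.inv_mul_cancel h0 h0', one_mul]

end IsUnitPoisson

lemma poissonMeasure_two_le_le (r : ℝ≥0) :
    poissonMeasure r {k | 2 ≤ k} ≤ ENNReal.ofReal ((r : ℝ) ^ 2) := by
  have h1 : (poissonMeasure r).real {k | 2 ≤ k} = 1 - (poissonMeasure r).real {0, 1} := by
    rw [← probReal_compl_eq_one_sub .of_discrete]
    congr 1; ext k; simp; omega
  have h2 : (poissonMeasure r).real {0, 1} = Real.exp (-r) * (1 + r) := by
    rw [Set.insert_eq, measureReal_union (by simp) .of_discrete, poissonMeasure_real_singleton,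
      poissonMeasure_real_singleton]
    simp; ring
  rw [← ENNReal.ofReal_toReal (measure_ne_top (poissonMeasure r) {k | 2 ≤ k})]
  refine ENNReal.ofReal_le_ofReal ?_
  change (poissonMeasure r).real _ ≤ _
  rw [h1, h2]
  have h3 := Real.add_one_le_exp (-(r : ℝ))
  have h4 : (-(r : ℝ) + 1) * (1 + r) ≤ Real.exp (-r) * (1 + r) := by gcongr
  nlinarith

namespace IsUnitPoisson

variable {Ω : Type*} [MeasurableSpace Ω] {P : Measure Ω} {N : ℝ≥0 → Ω → ℕ}

lemma measure_two_le_le (hN : IsUnitPoisson P N) {s t : ℝ≥0} (h : s ≤ t) :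
    P {ω | N s ω + 2 ≤ N t ω} ≤ ENNReal.ofReal (((t - s : ℝ≥0) : ℝ) ^ 2) := by
  have hm : Measurable fun ω => N t ω - N s ω :=
    (Measurable.of_discrete (f := fun x : ℕ × ℕ => x.1 - x.2)).comp
      ((hN.measurable t).prodMk (hN.measurable s))
  refine le_trans (le_of_eq ?_) (poissonMeasure_two_le_le (t - s))
  rw [← hN.law s t h, Measure.map_apply hm .of_discrete]
  congr 1; ext ω
  have := hN.mono ω h
  simp only [Set.mem_ofPred_eq, Set.mem_preimage] at this ⊢
  omega

/-- Almost surely, the jump times in a bounded interval keep a positive distance from each other and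
all jumps have size one. -/
lemma ae_exists_le_add_one (hN : IsUnitPoisson P N) :
    ∀ᵐ ω ∂P, ∀ U : ℕ, ∃ δ : ℝ≥0, 0 < δ ∧ ∀ u v : ℝ≥0, u ≤ v → v ≤ U → v ≤ u + δ →
      N v ω ≤ N u ω + 1 := by
  rw [ae_all_iff]
  intro U
  -- `B M` : some two adjacent intervals of length `1 / M` carry at least two jumps
  set B : ℕ → Set Ω := fun M => ⋃ j ∈ Finset.range (U * (M + 1) + 1),
    {ω | N ((j : ℝ≥0) / (M + 1 : ℕ)) ω + 2 ≤ N (((j + 2 : ℕ) : ℝ≥0) / (M + 1 : ℕ)) ω} with hB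
  have hBle : ∀ M : ℕ, P (B M) ≤ ENNReal.ofReal (4 * (U + 1) / ((M : ℝ) + 1)) := by
    intro M
    refine (measure_biUnion_finset_le _ _).trans ?_
    have hM : (0 : ℝ) < (M : ℝ) + 1 := by positivity
    calc _ ≤ ∑ j ∈ Finset.range (U * (M + 1) + 1), ENNReal.ofReal ((2 / ((M : ℝ) + 1)) ^ 2) := by
          refine Finset.sum_le_sum fun j _ => ?_
          refine (hN.measure_two_le_le (by gcongr; omega)).trans (le_of_eq ?_)
          congr 2
          rw [← NNReal.sub_div]
          push_cast
          rw [add_tsub_cancel_left]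
          rfl
      _ = ENNReal.ofReal ((U * (M + 1) + 1 : ℕ) * (2 / ((M : ℝ) + 1)) ^ 2) := by
          rw [Finset.sum_const, Finset.card_range, nsmul_eq_mul, ENNReal.ofReal_mul (by positivity),
            ENNReal.ofReal_natCast]
      _ ≤ _ := by
          refine ENNReal.ofReal_le_ofReal ?_
          rw [div_pow, mul_div_assoc', div_le_div_iff₀ (by positivity) hM]
          push_cast
          have : (0 : ℝ) ≤ M := by positivity
          have : (0 : ℝ) ≤ U := by positivity
          have h1 : ((U : ℝ) * (M + 1) + 1) ≤ (U + 1) * (M + 1) := by nlinarith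
          calc _ ≤ ((U : ℝ) + 1) * (M + 1) * 2 ^ 2 * (M + 1) := by gcongr
            _ = _ := by ring
  have hnull : P (⋂ M, B M) = 0 := by
    refine le_antisymm (ge_of_tendsto' (x := atTop) (f := fun M : ℕ =>
      ENNReal.ofReal (4 * (U + 1) / ((M : ℝ) + 1))) ?_ fun M => ?_) zero_le
    · have : Tendsto (fun M : ℕ => 4 * ((U : ℝ) + 1) / ((M : ℝ) + 1)) atTop (𝓝 0) :=
        tendsto_const_nhds.div_atTop (tendsto_atTop_add_const_right _ _ tendsto_natCast_atTop_atTop)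
      simpa using ENNReal.tendsto_ofReal this
    · exact (measure_mono (Set.iInter_subset _ M)).trans (hBle M)
  filter_upwards [measure_eq_zero_iff_ae_notMem.1 hnull] with ω hω
  simp only [Set.mem_iInter, not_forall] at hω
  obtain ⟨M, hM⟩ := hω
  simp only [hB, Set.mem_iUnion, not_exists, Finset.mem_range, Set.mem_ofPred_eq, not_le] at hM
  have hM0 : (0 : ℝ≥0) < (M + 1 : ℕ) := by exact_mod_cast Nat.succ_pos M
  refine ⟨1 / (M + 1 : ℕ), by positivity, fun u v huv hvU hv => ?_⟩
  set j := ⌊u * (M + 1 : ℕ)⌋₊ with hj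
  have hj1 : (j : ℝ≥0) ≤ u * (M + 1 : ℕ) := Nat.floor_le zero_le
  have hj2 : u * (M + 1 : ℕ) < j + 1 := Nat.lt_floor_add_one _
  have hjU : j < U * (M + 1) + 1 := by
    have h1 : (j : ℝ≥0) ≤ ((U * (M + 1) : ℕ) : ℝ≥0) := by
      refine hj1.trans ?_
      rw [Nat.cast_mul]
      gcongr
      exact huv.trans hvU
    have : j ≤ U * (M + 1) := by exact_mod_cast h1
    omega
  have h1 := hM j hjU
  have h2 : N ((j : ℝ≥0) / (M + 1 : ℕ)) ω ≤ N u ω :=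
    hN.mono ω ((div_le_iff₀ hM0).2 hj1)
  have h3 : N v ω ≤ N (((j + 2 : ℕ) : ℝ≥0) / (M + 1 : ℕ)) ω := by
    refine hN.mono ω (hv.trans ?_)
    rw [le_div_iff₀ hM0, add_mul, div_mul_cancel₀ _ hM0.ne']
    push_cast at hj2 ⊢
    calc u * (M + 1) + 1 ≤ j + 1 + 1 := by gcongr
      _ = j + 2 := by ring
  omega

end IsUnitPoisson

/-! ### Windows: counting and the scalar comparison principle -/

/-- A monotone clock that advances by at least `δ` at each of the steps in `s` spends at most
`(b - a) / δ + 1` of them in `[a, b]`. -/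
lemma card_le_of_increments {Φ : ℕ → ℝ} (hΦ : Monotone Φ) {δ a b : ℝ} (hδ : 0 < δ) (hab : a ≤ b)
    (s : Finset ℕ) (hs : ∀ k ∈ s, a ≤ Φ k ∧ Φ k ≤ b ∧ Φ k + δ ≤ Φ (k + 1)) :
    (s.card : ℝ) ≤ (b - a) / δ + 1 := by
  have hinj : Set.InjOn (fun k => ⌊(Φ k - a) / δ⌋₊) s := by
    have key : ∀ k ∈ s, ∀ l ∈ s, k < l → ⌊(Φ k - a) / δ⌋₊ < ⌊(Φ l - a) / δ⌋₊ := by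
      intro k hk l hl hkl
      obtain ⟨h1, -, h3⟩ := hs k hk
      have h4 : Φ (k + 1) ≤ Φ l := hΦ hkl
      have h5 : (Φ k - a) / δ + 1 ≤ (Φ l - a) / δ := by
        rw [div_add_one hδ.ne']; gcongr; linarith
      have h6 : 0 ≤ (Φ k - a) / δ := div_nonneg (by linarith) hδ.le
      rw [← Nat.succ_le_iff, Nat.succ_eq_add_one, ← Nat.floor_add_one h6]
      exact Nat.floor_mono h5
    intro k hk l hl hkl
    rcases lt_trichotomy k l with h | h | h
    · exact absurd hkl (key k hk l hl h).ne
    · exact h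
    · exact absurd hkl (key l hl k hk h).ne'
  have hmaps : Set.MapsTo (fun k => ⌊(Φ k - a) / δ⌋₊) s
      (Finset.range (⌊(b - a) / δ⌋₊ + 1)) := by
    intro k hk
    obtain ⟨-, h2, -⟩ := hs k hk
    simp only [Finset.coe_range, Set.mem_Iio]
    exact Nat.lt_succ_of_le (Nat.floor_mono (by gcongr))
  have h := Finset.card_le_card_of_injOn _ hmaps hinj
  rw [Finset.card_range] at h
  have h2 : ((⌊(b - a) / δ⌋₊ : ℕ) : ℝ) ≤ (b - a) / δ :=
    Nat.floor_le (div_nonneg (by linarith) hδ.le)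
  have h3 : (s.card : ℝ) ≤ (⌊(b - a) / δ⌋₊ : ℕ) + 1 := by exact_mod_cast h
  linarith

section Comparison

variable {v μ : ℝ → ℝ} {a b e l u : ℝ}

/-- A function pulled towards zero, up to perturbations of size `e`, cannot exceed its initial
positive part by more than `e`. -/
lemma le_posPart_add_of_le_sub_integral (hint : IntervalIntegrable (fun s => μ s * v s) volume a b)
    (hl : 0 ≤ l) (hμ : ∀ s ∈ Set.Icc a b, l ≤ μ s) {B : ℝ}
    (hB : ∀ s ∈ Set.Icc a b, |μ s * v s| ≤ B)
    (hv : ∀ s t, a ≤ s → s ≤ t → t ≤ b → v t ≤ v s + e - ∫ r in s..t, μ r * v r)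
    {t : ℝ} (hat : a ≤ t) (htb : t ≤ b) : v t ≤ max (v a) 0 + e := by
  by_contra! hcon
  set p := max (v a) 0 with hp
  have hp0 : 0 ≤ p := le_max_right _ _
  set A : Set ℝ := {s | a ≤ s ∧ s ≤ t ∧ v s ≤ p} with hA
  have hAa : a ∈ A := ⟨le_rfl, hat, le_max_left _ _⟩
  have hAbdd : BddAbove A := ⟨t, fun s hs => hs.2.1⟩
  set σ := sSup A with hσ
  have haσ : a ≤ σ := le_csSup hAbdd hAa
  have hσt : σ ≤ t := csSup_le ⟨a, hAa⟩ fun s hs => hs.2.1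
  have hB0 : 0 ≤ B := (abs_nonneg _).trans (hB a ⟨le_rfl, hat.trans htb⟩)
  set gap := v t - (p + e) with hgap
  have hgap0 : 0 < gap := by linarith
  obtain ⟨s, hs, hsσ⟩ := exists_lt_of_lt_csSup ⟨a, hAa⟩
    (show σ - gap / (2 * (B + 1)) < sSup A by
      have : 0 < gap / (2 * (B + 1)) := by positivity
      linarith)
  have hsσ' : s ≤ σ := le_csSup hAbdd hs
  have hi : ∀ x y, a ≤ x → x ≤ y → y ≤ b →
      IntervalIntegrable (fun s => μ s * v s) volume x y := by
    intro x y h1 h2 h3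
    refine hint.mono_set ?_
    rw [Set.uIcc_of_le h2, Set.uIcc_of_le (h1.trans (h2.trans h3))]
    exact Set.Icc_subset_Icc h1 h3
  have h1 := hv s t hs.1 hs.2.1 htb
  rw [← intervalIntegral.integral_add_adjacent_intervals (hi s σ hs.1 hsσ' (hσt.trans htb))
    (hi σ t haσ hσt htb)] at h1
  have h2 : 0 ≤ ∫ r in σ..t, μ r * v r := by
    rw [intervalIntegral.integral_of_le hσt]
    refine setIntegral_nonneg measurableSet_Ioc fun r hr => ?_
    have hr1 : a ≤ r := haσ.trans hr.1.le
    have hr2 : r ≤ b := hr.2.trans htb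
    refine mul_nonneg (hl.trans (hμ r ⟨hr1, hr2⟩)) ?_
    by_contra! hneg
    exact absurd (le_csSup hAbdd (show r ∈ A from ⟨hr1, hr.2, hneg.le.trans hp0⟩)) (not_le.2 hr.1)
  have h3 : |∫ r in s..σ, μ r * v r| ≤ B * |σ - s| := by
    refine intervalIntegral.norm_integral_le_of_norm_le_const (f := fun r => μ r * v r) fun r hr => ?_
    rw [Set.uIoc_of_le hsσ'] at hr
    exact hB r ⟨hs.1.trans hr.1.le, hr.2.trans (hσt.trans htb)⟩
  rw [abs_of_nonneg (sub_nonneg.2 hsσ')] at h3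
  have h4 : B * (σ - s) ≤ gap / 2 := by
    calc B * (σ - s) ≤ (B + 1) * (gap / (2 * (B + 1))) := by gcongr <;> linarith
      _ = gap / 2 := by field_simp
  have h5 := (abs_le.1 h3).1
  linarith [hs.2.2]

/-- Over a whole interval the positive part contracts. -/
lemma le_mul_posPart_add_of_le_sub_integral
    (hint : IntervalIntegrable (fun s => μ s * v s) volume a b)
    (hl : 0 ≤ l) (hab : a ≤ b) (hμ : ∀ s ∈ Set.Icc a b, l ≤ μ s) {B : ℝ}
    (hB : ∀ s ∈ Set.Icc a b, |μ s * v s| ≤ B)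
    (hv : ∀ s t, a ≤ s → s ≤ t → t ≤ b → v t ≤ v s + e - ∫ r in s..t, μ r * v r)
    {η : ℝ} (hη : η ≤ 1 / 2) (hη' : η ≤ l * (b - a) / 2) :
    v b ≤ (1 - η) * max (v a) 0 + e := by
  set p := max (v a) 0 with hp
  have hp0 : 0 ≤ p := le_max_right _ _
  by_cases h : ∃ s ∈ Set.Icc a b, v s ≤ p / 2
  · obtain ⟨s, hs, hsp⟩ := h
    have hsub : Set.Icc s b ⊆ Set.Icc a b := Set.Icc_subset_Icc_left hs.1
    have h1 := le_posPart_add_of_le_sub_integral (v := v) (μ := μ) (a := s) (b := b) (e := e)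
      (hint.mono_set (by rwa [Set.uIcc_of_le hs.2, Set.uIcc_of_le hab])) hl
      (fun r hr => hμ r (hsub hr)) (fun r hr => hB r (hsub hr))
      (fun x y hx hxy hy => hv x y (hs.1.trans hx) hxy hy) hs.2 le_rfl
    have h2 : max (v s) 0 ≤ p / 2 := max_le hsp (by linarith)
    nlinarith
  · push Not at h
    have h1 := hv a b le_rfl hab le_rfl
    have h2 : l * (p / 2) * (b - a) ≤ ∫ r in a..b, μ r * v r := by
      have : ∫ r in a..b, l * (p / 2) ≤ ∫ r in a..b, μ r * v r := by
        refine intervalIntegral.integral_mono_on hab (by simp) hint fun r hr => ?_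
        have h3 := hμ r hr
        have h4 := (h r hr).le
        calc l * (p / 2) ≤ μ r * (p / 2) := by gcongr
          _ ≤ μ r * v r := by
            have : 0 ≤ μ r := hl.trans h3
            gcongr
      simp only [intervalIntegral.integral_const, smul_eq_mul] at this
      linarith
    have h3 : v a ≤ p := le_max_left _ _
    nlinarith

end Comparison

/-! ### The Poisson equation of an irreducible generator -/

namespace IsIrreducibleGenerator

variable {K : ℕ} {G : Matrix (Fin K) (Fin K) ℝ}

/-- Maximum principle: harmonic functions are constant. -/
lemma eq_of_mulVec_eq_zero (hG : IsIrreducibleGenerator G) {g : Fin K → ℝ}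
    (hg : G.mulVec g = 0) (k l : Fin K) : g k = g l := by
  have : Nonempty (Fin K) := ⟨k⟩
  obtain ⟨a, ha⟩ := Finite.exists_max g
  have key : ∀ b, g b = g a := by
    intro b
    induction hG.irreducible a b with
    | refl => rfl
    | @tail b c _ hbc ih =>
      have h1 : ∑ j, G b j * (g j - g a) = 0 := by
        have h2 : ∑ j, G b j * g j = 0 := congrFun hg b
        simp_rw [mul_sub]
        rw [Finset.sum_sub_distrib, h2, ← Finset.sum_mul, hG.row_sum b]
        simp
      have h2 : ∀ j ∈ Finset.univ, G b j * (g j - g a) ≤ 0 := by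
        intro j _
        by_cases hj : b = j
        · subst hj; rw [ih]; simp
        · exact mul_nonpos_of_nonneg_of_nonpos (hG.offDiag_nonneg b j hj) (by linarith [ha j])
      have h3 := (Finset.sum_eq_zero_iff_of_nonpos h2).1 h1 c (Finset.mem_univ c)
      rcases mul_eq_zero.1 h3 with h4 | h4
      · exact absurd h4 hbc.2.ne'
      · linarith
  rw [key k, key l]

/-- The Poisson equation is solvable for every centred right-hand side. -/
lemma exists_mulVec_eq (hG : IsIrreducibleGenerator G) {p : Fin K → ℝ}
    (hsum : ∑ k, p k = 1) (hinv : ∀ l, ∑ k, p k * G k l = 0) {f : Fin K → ℝ}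
    (hf : ∑ k, p k * f k = 0) : ∃ g : Fin K → ℝ, G.mulVec g = f := by
  classical
  set φ : (Fin K → ℝ) →ₗ[ℝ] ℝ := ∑ k, p k • LinearMap.proj k with hφ
  have hφa : ∀ x, φ x = ∑ k, p k * x k := fun x => by simp [hφ]
  have hle : LinearMap.range G.mulVecLin ≤ LinearMap.ker φ := by
    rintro _ ⟨x, rfl⟩
    rw [LinearMap.mem_ker, hφa]
    simp only [Matrix.mulVecLin_apply, Matrix.mulVec, dotProduct, Finset.mul_sum]
    rw [Finset.sum_comm]
    refine Finset.sum_eq_zero fun l _ => ?_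
    simp_rw [← mul_assoc]
    rw [← Finset.sum_mul, hinv l, zero_mul]
  have hker : Module.finrank ℝ (LinearMap.ker G.mulVecLin) ≤ 1 := by
    have h1 : LinearMap.ker G.mulVecLin ≤ Submodule.span ℝ {fun _ : Fin K => (1 : ℝ)} := by
      intro x hx
      have hx' : G.mulVec x = 0 := hx
      rw [Submodule.mem_span_singleton]
      rcases isEmpty_or_nonempty (Fin K) with h | ⟨⟨k⟩⟩
      · exact ⟨0, Subsingleton.elim _ _⟩
      · refine ⟨x k, funext fun l => ?_⟩
        simp [hG.eq_of_mulVec_eq_zero hx' k l]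
    exact (Submodule.finrank_mono h1).trans ((finrank_span_le_card _).trans (by simp))
  have hrange : 1 ≤ Module.finrank ℝ (LinearMap.range φ) := by
    have : LinearMap.range φ = ⊤ := by
      rw [LinearMap.range_eq_top]
      intro c
      refine ⟨fun _ => c, ?_⟩
      rw [hφa, ← Finset.sum_mul, hsum, one_mul]
    rw [this, finrank_top]; simp
  have h1 := LinearMap.finrank_range_add_finrank_ker G.mulVecLin
  have h2 := LinearMap.finrank_range_add_finrank_ker φ
  have heq := Submodule.eq_of_le_of_finrank_le hle (by omega)
  have : f ∈ LinearMap.range G.mulVecLin := by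
    rw [heq, LinearMap.mem_ker, hφa, hf]
  obtain ⟨g, hg⟩ := this
  exact ⟨g, hg⟩

end IsIrreducibleGenerator

section ExpDeriv

open scoped Matrix.Norms.Operator

lemma hasDerivAt_sum_exp_smul_mul {K : ℕ} (G : Matrix (Fin K) (Fin K) ℝ) (f v : Fin K → ℝ) (θ : ℝ)
    (k : Fin K) :
    HasDerivAt (fun h : ℝ => ∑ l, NormedSpace.exp (h • G) k l * (Real.exp (h * (θ * f l)) * v l))
      (∑ l, G k l * v l + θ * f k * v k) 0 := by
  have h2 : ∀ l, HasDerivAt (fun h : ℝ => NormedSpace.exp (h • G) k l) (G k l) 0 := by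
    intro l
    have h1 := hasDerivAt_exp_smul_const (𝕂 := ℝ) G (0 : ℝ)
    have h3 := ((Matrix.entryLinearMap ℝ ℝ k l).toContinuousLinearMap.hasFDerivAt).comp_hasDerivAt
      (0 : ℝ) h1
    simp only [zero_smul, NormedSpace.exp_zero, one_mul] at h3
    exact h3
  have h4 : ∀ l, HasDerivAt (fun h : ℝ => Real.exp (h * (θ * f l)) * v l) (θ * f l * v l) 0 := by
    intro l
    have := (((hasDerivAt_id (0 : ℝ)).mul_const (θ * f l)).exp).mul_const (v l)
    simpa using this
  have h5 := HasDerivAt.fun_sum (u := Finset.univ) fun l _ => (h2 l).mul (h4 l)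
  refine h5.congr_deriv ?_
  simp only [zero_smul, NormedSpace.exp_zero, zero_mul, Real.exp_zero, one_mul,
    Finset.sum_add_distrib]
  congr 1
  rw [Finset.sum_eq_single k]
  · simp
  · intro l _ hl; simp [hl.symm]
  · simp

end ExpDeriv

/-! ### Exponential moments of additive functionals of the environment -/

namespace IsMarkovChain

variable {Ω : Type*} [MeasurableSpace Ω] {K : ℕ} {P : Measure Ω} [IsProbabilityMeasure P]
  {G : Matrix (Fin K) (Fin K) ℝ} {p : Fin K → ℝ} {J : ℝ≥0 → Ω → Fin K}

/-- The Markov property at a deterministic time, for functions of finitely many past values. -/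
lemma integral_mul_eq (hJ : IsMarkovChain P G p J) {t : ℕ → ℝ≥0} (ht : Monotone t) (ht0 : t 0 = 0)
    (N : ℕ) (Φ : (Fin (N + 1) → Fin K) → ℝ) (ψ : Fin K → ℝ) :
    ∫ ω, Φ (fun j => J (t j) ω) * ψ (J (t (N + 1)) ω) ∂P =
      ∫ ω, Φ (fun j => J (t j) ω) * ∑ l, NormedSpace.exp (((t (N + 1) : ℝ) - t N) • G)
        (J (t N) ω) l * ψ l ∂P := by
  classical
  have hY : Measurable fun ω => (fun j : Fin (N + 1) => J (t j) ω) :=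
    measurable_pi_lambda _ fun j => hJ.measurable _
  have hY' : Measurable fun ω => ((fun j : Fin (N + 1) => J (t j) ω), J (t (N + 1)) ω) :=
    hY.prodMk (hJ.measurable _)
  have e1 : ∫ ω, Φ (fun j => J (t j) ω) * ψ (J (t (N + 1)) ω) ∂P =
      ∑ y, ∑ l, P.real {ω | (fun j : Fin (N + 1) => J (t j) ω) = y ∧ J (t (N + 1)) ω = l} *
        (Φ y * ψ l) := by
    have h := integral_map (μ := P) hY'.aemeasurable
      (f := fun z : (Fin (N + 1) → Fin K) × Fin K => Φ z.1 * ψ z.2)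
      (Measurable.of_discrete).aestronglyMeasurable
    have : IsProbabilityMeasure (P.map fun ω => ((fun j : Fin (N + 1) => J (t j) ω), J (t (N + 1)) ω)) :=
      Measure.isProbabilityMeasure_map hY'.aemeasurable
    rw [← h, integral_fintype (Integrable.of_finite), Fintype.sum_prod_type]
    refine Finset.sum_congr rfl fun y _ => Finset.sum_congr rfl fun l _ => ?_
    rw [map_measureReal_apply hY' .of_discrete, smul_eq_mul]
    congr 2
    ext ω
    simp
  have e2 : ∀ Ψ : (Fin (N + 1) → Fin K) → ℝ, ∫ ω, Ψ (fun j => J (t j) ω) ∂P =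
      ∑ y, P.real {ω | (fun j : Fin (N + 1) => J (t j) ω) = y} * Ψ y := by
    intro Ψ
    have h := integral_map (μ := P) hY.aemeasurable (f := Ψ)
      (Measurable.of_discrete).aestronglyMeasurable
    have : IsProbabilityMeasure (P.map fun ω => (fun j : Fin (N + 1) => J (t j) ω)) :=
      Measure.isProbabilityMeasure_map hY.aemeasurable
    rw [← h, integral_fintype (Integrable.of_finite)]
    refine Finset.sum_congr rfl fun y _ => ?_
    rw [map_measureReal_apply hY .of_discrete, smul_eq_mul]
    rfl
  have e3 := e2 fun y => Φ y * ∑ l, NormedSpace.exp (((t (N + 1) : ℝ) - t N) • G)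
        (y (Fin.last N)) l * ψ l
  simp only [Fin.val_last] at e3
  rw [e1, e3]
  refine Finset.sum_congr rfl fun y _ => ?_
  rw [Finset.mul_sum, Finset.mul_sum]
  refine Finset.sum_congr rfl fun l _ => ?_
  -- the path `y` followed by the state `l`
  set k : ℕ → Fin K := fun j => if h : j < N + 1 then y ⟨j, h⟩ else l with hk
  have hky : ∀ j (h : j < N + 1), k j = y ⟨j, h⟩ := fun j h => dif_pos h
  have hkl : k (N + 1) = l := dif_neg (lt_irrefl _)
  have f1 : {ω | (fun j : Fin (N + 1) => J (t j) ω) = y} = {ω | ∀ j ≤ N, J (t j) ω = k j} := by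
    ext ω
    simp only [Set.mem_ofPred_eq, funext_iff]
    constructor
    · intro h j hj
      rw [hky j (by omega)]; exact h ⟨j, by omega⟩
    · intro h j
      rw [h j (by omega), hky j j.2]
  have f2 : {ω | (fun j : Fin (N + 1) => J (t j) ω) = y ∧ J (t (N + 1)) ω = l} =
      {ω | ∀ j ≤ N + 1, J (t j) ω = k j} := by
    ext ω
    have := Set.ext_iff.1 f1 ω
    simp only [Set.mem_ofPred_eq] at this ⊢
    rw [this]
    constructor
    · rintro ⟨h1, h2⟩ j hj
      rcases hj.eq_or_lt with rfl | hj
      · rw [h2, hkl]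
      · exact h1 j (by omega)
    · intro h
      exact ⟨fun j hj => h j (by omega), by rw [h _ le_rfl, hkl]⟩
  rw [f2, f1, hJ.fdd _ t k ht ht0, hJ.fdd _ t k ht ht0, Finset.prod_range_succ, hkl,
    hky N (by omega)]
  have : y ⟨N, by omega⟩ = y (Fin.last N) := rfl
  rw [this]
  ring

/-- If `v` is almost invariant under one step of the chain tilted by `φ`, then the expectation of
the product of the tilts along `N` steps grows at most geometrically. -/
lemma integral_prod_mul_le (hJ : IsMarkovChain P G p J) {t : ℕ → ℝ≥0} (ht : Monotone t)
    (ht0 : t 0 = 0) {φ v : Fin K → ℝ} (hφ : ∀ k, 0 ≤ φ k) {h r : ℝ} (hr : 0 ≤ r)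
    (hstep : ∀ j, 1 ≤ j → (t (j + 1) : ℝ) - t j = h)
    (hle : ∀ k, ∑ l, NormedSpace.exp (h • G) k l * (φ l * v l) ≤ r * v k) (N : ℕ) :
    ∫ ω, (∏ j ∈ Finset.range N, φ (J (t (j + 2)) ω)) * v (J (t (N + 1)) ω) ∂P ≤
      r ^ N * ∫ ω, v (J (t 1) ω) ∂P := by
  induction N with
  | zero => simp
  | succ N ih =>
    have hmain := hJ.integral_mul_eq ht ht0 (N + 1)
      (fun y => ∏ j : Fin N, φ (y j.succ.succ)) (fun l => φ l * v l)
    have e2 : ∀ ω, (∏ j : Fin N, φ (J (t (j.succ.succ : Fin (N + 1 + 1))) ω)) =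
        ∏ j ∈ Finset.range N, φ (J (t (j + 2)) ω) := by
      intro ω
      rw [Finset.prod_range]
      rfl
    simp only [e2] at hmain
    have hbdd : ∀ F : Fin K → ℝ, Integrable
        (fun ω => (∏ j ∈ Finset.range N, φ (J (t (j + 2)) ω)) * F (J (t (N + 1)) ω)) P := by
      intro F
      obtain ⟨b, hb⟩ := Finite.exists_le φ
      obtain ⟨c, hc⟩ := Finite.exists_le fun k => |F k|
      have hm : ∀ (f : Fin K → ℝ) s, Measurable fun ω => f (J s ω) := fun f s =>
        (Measurable.of_discrete (f := f)).comp (hJ.measurable s)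
      refine Integrable.of_bound (C := (max b 0) ^ N * c)
        ((Finset.measurable_fun_prod _ fun j _ => hm φ _).mul (hm F _)).aestronglyMeasurable ?_
      refine Eventually.of_forall fun ω => ?_
      rw [norm_mul]
      gcongr
      · rw [Real.norm_of_nonneg (Finset.prod_nonneg fun j _ => hφ _)]
        calc _ ≤ ∏ j ∈ Finset.range N, max b 0 :=
              Finset.prod_le_prod (fun j _ => hφ _) fun j _ => (hb _).trans (le_max_left _ _)
          _ = _ := by simp
      · exact hc _
    calc ∫ ω, (∏ j ∈ Finset.range (N + 1), φ (J (t (j + 2)) ω)) * v (J (t (N + 1 + 1)) ω) ∂P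
        = ∫ ω, (∏ j ∈ Finset.range N, φ (J (t (j + 2)) ω)) *
            (φ (J (t (N + 1 + 1)) ω) * v (J (t (N + 1 + 1)) ω)) ∂P := by
          refine integral_congr_ae (Eventually.of_forall fun ω => ?_)
          simp only [Finset.prod_range_succ]
          ring
      _ ≤ ∫ ω, (∏ j ∈ Finset.range N, φ (J (t (j + 2)) ω)) * (r * v (J (t (N + 1)) ω)) ∂P := by
          rw [hmain, hstep (N + 1) (by omega)]
          refine integral_mono (hbdd fun k => ∑ l, NormedSpace.exp (h • G) k l * (φ l * v l))
            (hbdd fun k => r * v k) fun ω => ?_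
          exact mul_le_mul_of_nonneg_left (hle _) (Finset.prod_nonneg fun j _ => hφ _)
      _ = r * ∫ ω, (∏ j ∈ Finset.range N, φ (J (t (j + 2)) ω)) * v (J (t (N + 1)) ω) ∂P := by
          rw [← integral_const_mul]
          refine integral_congr_ae (Eventually.of_forall fun ω => ?_)
          simp only
          ring
      _ ≤ r * (r ^ N * ∫ ω, v (J (t 1) ω) ∂P) := by gcongr
      _ = _ := by ring

end IsMarkovChain

section RightContinuous

/-- The smallest multiple of `1 / (N + 1)` above `x`. -/
noncomputable def ceilGrid (N : ℕ) (x : ℝ≥0) : ℝ≥0 := (⌈x * (N + 1 : ℕ)⌉₊ : ℝ≥0) / (N + 1 : ℕ)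

lemma le_ceilGrid (N : ℕ) (x : ℝ≥0) : x ≤ ceilGrid N x := by
  rw [ceilGrid, le_div_iff₀ (by positivity)]
  exact Nat.le_ceil _

lemma tendsto_ceilGrid (x : ℝ≥0) : Tendsto (fun N => ceilGrid N x) atTop (𝓝[Set.Ici x] x) := by
  refine tendsto_nhdsWithin_iff.2 ⟨?_, Eventually.of_forall fun N => le_ceilGrid N x⟩
  have h1 : Tendsto (fun N : ℕ => x + 1 / ((N + 1 : ℕ) : ℝ≥0)) atTop (𝓝 (x + 0)) := by
    refine tendsto_const_nhds.add ?_
    have h := tendsto_one_div_add_atTop_nhds_zero_nat (𝕜 := ℝ)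
    rw [← NNReal.tendsto_coe]
    simpa using h
  rw [add_zero] at h1
  refine tendsto_of_tendsto_of_tendsto_of_le_of_le tendsto_const_nhds h1
    (fun N => le_ceilGrid N x) fun N => ?_
  have hN : (0 : ℝ≥0) < ((N + 1 : ℕ) : ℝ≥0) := by positivity
  simp only [ceilGrid]
  rw [div_le_iff₀ hN, add_mul, one_div, inv_mul_cancel₀ hN.ne']
  exact (Nat.ceil_lt_add_one zero_le).le

variable {g : ℝ≥0 → ℝ}

lemma measurable_comp_ceilGrid (g : ℝ≥0 → ℝ) (N : ℕ) : Measurable fun x => g (ceilGrid N x) :=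
  (Measurable.of_discrete (f := fun k : ℕ => g ((k : ℝ≥0) / (N + 1 : ℕ)))).comp
    (Nat.measurable_ceil.comp (measurable_id.mul_const _))

/-- Right-continuous functions are measurable. -/
lemma measurable_of_rightContinuous (hg : ∀ t, ContinuousWithinAt g (Set.Ici t) t) :
    Measurable g :=
  measurable_of_tendsto_metrizable (measurable_comp_ceilGrid g)
    (tendsto_pi_nhds.2 fun x => (hg x).tendsto.comp (tendsto_ceilGrid x))

lemma tendsto_riemann_unit (hg : ∀ t, ContinuousWithinAt g (Set.Ici t) t) {c : ℝ}
    (hc : ∀ t, |g t| ≤ c) :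
    Tendsto (fun N : ℕ => ∑ j ∈ Finset.range (N + 1), (1 / (N + 1 : ℕ) : ℝ) *
      g (((j + 1 : ℕ) : ℝ≥0) / (N + 1 : ℕ))) atTop (𝓝 (∫ x in (0 : ℝ)..1, g x.toNNReal)) := by
  have hstep : ∀ N : ℕ, ∑ j ∈ Finset.range (N + 1), (1 / (N + 1 : ℕ) : ℝ) *
      g (((j + 1 : ℕ) : ℝ≥0) / (N + 1 : ℕ)) = ∫ x in (0 : ℝ)..1, g (ceilGrid N x.toNNReal) := by
    intro N
    have hN : (0 : ℝ) < ((N + 1 : ℕ) : ℝ) := by positivity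
    have hint : ∀ a b : ℝ, IntervalIntegrable (fun x : ℝ => g (ceilGrid N x.toNNReal)) volume a b := by
      intro a b
      refine (intervalIntegrable_const (c := c)).mono_fun'
        ((measurable_comp_ceilGrid g N).comp measurable_real_toNNReal).aestronglyMeasurable ?_
      exact Eventually.of_forall fun x => hc _
    have h := intervalIntegral.sum_integral_adjacent_intervals (n := N + 1) (μ := volume)
      (f := fun x : ℝ => g (ceilGrid N x.toNNReal)) (a := fun j : ℕ => (j : ℝ) / (N + 1 : ℕ))
      fun k _ => hint _ _
    rw [Nat.cast_zero, zero_div, div_self hN.ne'] at h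
    rw [← h]
    refine Finset.sum_congr rfl fun j _ => ?_
    have hle : (j : ℝ) / (N + 1 : ℕ) ≤ ((j + 1 : ℕ) : ℝ) / (N + 1 : ℕ) := by gcongr; omega
    rw [intervalIntegral.integral_of_le hle,
      setIntegral_congr_fun (g := fun _ => g (((j + 1 : ℕ) : ℝ≥0) / (N + 1 : ℕ))) measurableSet_Ioc]
    · rw [← intervalIntegral.integral_of_le hle, intervalIntegral.integral_const, smul_eq_mul]
      congr 1
      rw [← sub_div]; push_cast; ring
    · intro x hx
      have hx0 : 0 ≤ x := le_trans (by positivity) hx.1.le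
      have hx1 : (j : ℝ≥0) < x.toNNReal * (N + 1 : ℕ) := by
        rw [← NNReal.coe_lt_coe, NNReal.coe_mul, Real.coe_toNNReal _ hx0]
        have := (div_lt_iff₀ hN).1 hx.1
        exact_mod_cast this
      have hx2 : x.toNNReal * (N + 1 : ℕ) ≤ (j + 1 : ℕ) := by
        rw [← NNReal.coe_le_coe, NNReal.coe_mul, Real.coe_toNNReal _ hx0]
        have := (le_div_iff₀ hN).1 hx.2
        exact_mod_cast this
      have : ⌈x.toNNReal * (N + 1 : ℕ)⌉₊ = j + 1 := by
        rw [Nat.ceil_eq_iff (by omega)]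
        exact ⟨by simpa using hx1, hx2⟩
      simp only [ceilGrid, this]
  simp_rw [hstep]
  refine intervalIntegral.tendsto_integral_filter_of_dominated_convergence (fun _ => c) ?_ ?_
    (by simp) ?_
  · exact Eventually.of_forall fun N =>
      ((measurable_comp_ceilGrid g N).comp measurable_real_toNNReal).aestronglyMeasurable
  · exact Eventually.of_forall fun N => Eventually.of_forall fun x _ => hc _
  · exact Eventually.of_forall fun x _ => (hg _).tendsto.comp (tendsto_ceilGrid _)

/-- Riemann sums at right end points converge for bounded right-continuous functions. -/
lemma tendsto_riemann (hg : ∀ t, ContinuousWithinAt g (Set.Ici t) t) {c : ℝ}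
    (hc : ∀ t, |g t| ≤ c) (s t : ℝ≥0) :
    Tendsto (fun N : ℕ => ∑ j ∈ Finset.range (N + 1), ((t : ℝ) / (N + 1 : ℕ)) *
      g (s + ((j + 1 : ℕ) : ℝ≥0) * (t / (N + 1 : ℕ)))) atTop
      (𝓝 (∫ x in (s : ℝ)..(s + t : ℝ), g x.toNNReal)) := by
  have h := (tendsto_riemann_unit (g := fun x => g (s + x * t)) (c := c) (fun x => ?_)
    fun x => hc _).const_mul (t : ℝ)
  · have e : (t : ℝ) * ∫ x in (0 : ℝ)..1, g (s + x.toNNReal * t) =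
        ∫ x in (s : ℝ)..(s + t : ℝ), g x.toNNReal := by
      have h1 := intervalIntegral.smul_integral_comp_mul_add (a := 0) (b := 1)
        (fun x : ℝ => g x.toNNReal) (t : ℝ) (s : ℝ)
      simp only [mul_zero, zero_add, mul_one, smul_eq_mul] at h1
      rw [add_comm (s : ℝ), ← h1]
      congr 1
      refine intervalIntegral.integral_congr fun x hx => ?_
      rw [Set.uIcc_of_le zero_le_one] at hx
      congr 1
      rw [Real.toNNReal_add (by have := hx.1; positivity) (by positivity), Real.toNNReal_mul (by positivity)]
      simp only [Real.toNNReal_coe]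
      ring
    rw [e] at h
    refine h.congr fun N => ?_
    rw [Finset.mul_sum]
    refine Finset.sum_congr rfl fun j _ => ?_
    rw [← mul_assoc, mul_one_div]
    congr 3
    rw [div_mul_eq_mul_div, mul_div_assoc]
  · refine ContinuousWithinAt.comp (f := fun y : ℝ≥0 => s + y * t) (s := Set.Ici x) (x := x)
      (hg (s + x * t)) (by fun_prop) fun y hy => ?_
    have : x ≤ y := hy
    simp only [Set.mem_Ici]
    gcongr

end RightContinuous

namespace IsMarkovChain

variable {Ω : Type*} [MeasurableSpace Ω] {K : ℕ} {P : Measure Ω}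
  {G : Matrix (Fin K) (Fin K) ℝ} {p : Fin K → ℝ} {J : ℝ≥0 → Ω → Fin K}

lemma rightContinuous (hJ : IsMarkovChain P G p J) (f : Fin K → ℝ) (ω : Ω) (t : ℝ≥0) :
    ContinuousWithinAt (fun s => f (J s ω)) (Set.Ici t) t :=
  (continuous_of_discreteTopology (f := f)).continuousAt.comp_continuousWithinAt
    (hJ.cadlag ω t).1

lemma measurable_integral (hJ : IsMarkovChain P G p J) (f : Fin K → ℝ) (s t : ℝ≥0) :
    Measurable fun ω => ∫ x in (s : ℝ)..(s + t : ℝ), f (J x.toNNReal ω) := by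
  obtain ⟨c, hc⟩ := Finite.exists_le fun k => |f k|
  refine measurable_of_tendsto_metrizable (f := fun N : ℕ => fun ω =>
    ∑ j ∈ Finset.range (N + 1), ((t : ℝ) / (N + 1 : ℕ)) *
      f (J (s + ((j + 1 : ℕ) : ℝ≥0) * (t / (N + 1 : ℕ))) ω)) (fun N => ?_)
    (tendsto_pi_nhds.2 fun ω => tendsto_riemann (hJ.rightContinuous f ω) (fun t => hc _) s t)
  refine Finset.measurable_fun_sum _ fun j _ => ?_
  exact ((Measurable.of_discrete (f := f)).comp (hJ.measurable _)).const_mul _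

end IsMarkovChain

/-- Exponential moments of additive functionals of a chain whose generator is accelerated by `κ`.
With `g` solving the Poisson equation for `f`, the function `1 + (θ / κ) g` is an approximate
eigenfunction of the tilted generator `κ G + θ f`, with eigenvalue of order `θ ^ 2 / κ`. -/
lemma exists_lintegral_exp_le {K : ℕ} {G : Matrix (Fin K) (Fin K) ℝ} {p f : Fin K → ℝ}
    (hG : IsIrreducibleGenerator G) (hsum : ∑ k, p k = 1) (hinv : ∀ l, ∑ k, p k * G k l = 0)
    (hf : ∑ k, p k * f k = 0) :
    ∃ C b : ℝ, 0 ≤ C ∧ 0 < b ∧ ∀ {Ω : Type*} [MeasurableSpace Ω] (P : Measure Ω)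
      [IsProbabilityMeasure P] (J : ℝ≥0 → Ω → Fin K) (κ θ : ℝ) (_ : 0 < κ) (_ : θ ≠ 0)
      (_ : |θ| ≤ b * κ) (_ : IsMarkovChain P (κ • G) p J) (s t : ℝ≥0),
      ∫⁻ ω, ENNReal.ofReal (Real.exp (θ * ∫ x in (s : ℝ)..(s + t : ℝ), f (J x.toNNReal ω))) ∂P ≤
        ENNReal.ofReal (3 * Real.exp (C * (θ ^ 2 / κ) * t)) := by
  obtain ⟨g, hg⟩ := hG.exists_mulVec_eq hsum hinv (f := fun k => -f k)
    (by simp [hf])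
  obtain ⟨c, hc⟩ := Finite.exists_le fun k => |f k|
  obtain ⟨b, hb⟩ := Finite.exists_le fun k => |g k|
  rcases isEmpty_or_nonempty (Fin K) with hemp | ⟨⟨k₀⟩⟩
  · simp at hsum
  have hc0 : 0 ≤ c := (abs_nonneg _).trans (hc k₀)
  have hb0 : 0 ≤ b := (abs_nonneg _).trans (hb k₀)
  refine ⟨2 * (c * b) + 1, 1 / (2 * (b + 1)), by positivity, by positivity, ?_⟩
  intro Ω _ P _ J κ θ hκ hθ hθκ hJ s t
  set C := 2 * (c * b) + 1 with hC
  set v : Fin K → ℝ := fun k => 1 + θ / κ * g k with hv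
  have hsmall : ∀ k, |θ / κ * g k| ≤ 1 / 2 := by
    intro k
    rw [abs_mul, abs_div, abs_of_pos hκ]
    have h1 : |θ| / κ ≤ 1 / (2 * (b + 1)) := by rwa [div_le_iff₀ hκ]
    calc |θ| / κ * |g k| ≤ 1 / (2 * (b + 1)) * (b + 1) := by
          gcongr; linarith [hb k]
      _ = 1 / 2 := by field_simp
  have hv1 : ∀ k, 1 / 2 ≤ v k := fun k => by
    have := (abs_le.1 (hsmall k)).1; simp only [hv]; linarith
  have hv2 : ∀ k, v k ≤ 3 / 2 := fun k => by
    have := (abs_le.1 (hsmall k)).2; simp only [hv]; linarith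
  set a := C * (θ ^ 2 / κ) with ha
  have ha0 : 0 ≤ a := by positivity
  -- one step of length `h` of the tilted chain
  have hderiv : ∀ k, ∑ l, (κ • G) k l * v l + θ * f k * v k < a * v k := by
    intro k
    have h1 : ∑ l, G k l * g l = -f k := congrFun hg k
    have h2 : ∑ l, (κ • G) k l * v l = κ * (∑ l, G k l + θ / κ * ∑ l, G k l * g l) := by
      rw [Finset.mul_sum, ← Finset.sum_add_distrib, Finset.mul_sum]
      refine Finset.sum_congr rfl fun l _ => ?_
      simp only [hv, Matrix.smul_apply, smul_eq_mul]; ring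
    rw [h2, h1, hG.row_sum k]
    have h3 : κ * (0 + θ / κ * -f k) + θ * f k * v k = θ ^ 2 / κ * (f k * g k) := by
      simp only [hv]; field_simp; ring
    rw [h3, ha]
    have h4 : f k * g k ≤ c * b := by
      calc f k * g k ≤ |f k * g k| := le_abs_self _
        _ = |f k| * |g k| := abs_mul _ _
        _ ≤ c * b := by gcongr; exacts [hc k, hb k]
    have h5 : 0 < θ ^ 2 / κ := by positivity
    have h6 : f k * g k < C * v k := by
      have : 0 ≤ c * b := by positivity
      have := hv1 k
      rw [hC]; nlinarith
    calc θ ^ 2 / κ * (f k * g k) < θ ^ 2 / κ * (C * v k) := by gcongr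
      _ = _ := by ring
  have hev : ∀ᶠ h in 𝓝[>] (0 : ℝ), ∀ k,
      ∑ l, NormedSpace.exp (h • κ • G) k l * (Real.exp (h * (θ * f l)) * v l) ≤
        (1 + h * a) * v k := by
    rw [eventually_all]
    intro k
    have h1 := (hasDerivAt_sum_exp_smul_mul (κ • G) f v θ k).hasDerivWithinAt (s := Set.Ioi 0)
    rw [hasDerivWithinAt_iff_tendsto_slope' (by simp)] at h1
    filter_upwards [h1.eventually_lt_const (hderiv k), self_mem_nhdsWithin] with h h2 h3
    have h3' : (0 : ℝ) < h := h3
    rw [slope_def_field, sub_zero, div_lt_iff₀ h3'] at h2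
    have h4 : ∑ l, NormedSpace.exp ((0 : ℝ) • κ • G) k l * (Real.exp (0 * (θ * f l)) * v l) = v k := by
      rw [Finset.sum_eq_single k]
      · simp
      · intro l _ hl; simp [hl.symm]
      · simp
    rw [h4] at h2
    linarith
  set R : ℕ → Ω → ℝ := fun N ω => ∑ j ∈ Finset.range (N + 1), ((t : ℝ) / (N + 1 : ℕ)) *
      f (J (s + ((j + 1 : ℕ) : ℝ≥0) * (t / (N + 1 : ℕ))) ω) with hR
  rcases eq_zero_or_pos (a := t) with rfl | ht
  · simp only [NNReal.coe_zero, add_zero, intervalIntegral.integral_same, mul_zero, Real.exp_zero,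
      lintegral_const, measure_univ, mul_one]
    exact ENNReal.ofReal_le_ofReal (by norm_num)
  have htR : (0 : ℝ) < t := ht
  have hm : ∀ (F : Fin K → ℝ) r, Measurable fun ω => F (J r ω) := fun F r =>
    (Measurable.of_discrete (f := F)).comp (hJ.measurable r)
  have hmR : ∀ N, Measurable (R N) := fun N =>
    Finset.measurable_fun_sum _ fun j _ => (hm f _).const_mul _
  have hbound : ∀ᶠ N : ℕ in atTop, ∫⁻ ω, ENNReal.ofReal (Real.exp (θ * R N ω)) ∂P ≤
      ENNReal.ofReal (3 * Real.exp (a * t)) := by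
    have hmesh : Tendsto (fun N : ℕ => (t : ℝ) / (N + 1 : ℕ)) atTop (𝓝[>] 0) := by
      refine tendsto_nhdsWithin_iff.2 ⟨?_, Eventually.of_forall fun N => ?_⟩
      · have := tendsto_one_div_add_atTop_nhds_zero_nat (𝕜 := ℝ)
        simpa [div_eq_mul_inv] using this.const_mul (t : ℝ)
      · simp only [Set.mem_Ioi]; positivity
    filter_upwards [hmesh.eventually hev] with N hN
    set h : ℝ := (t : ℝ) / (N + 1 : ℕ) with hh
    have hh0 : 0 < h := by positivity
    set tt : ℕ → ℝ≥0 := fun j => if j = 0 then 0 else s + ((j - 1 : ℕ) : ℝ≥0) * (t / (N + 1 : ℕ))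
      with htt
    have htt0 : tt 0 = 0 := by simp [htt]
    have htt1 : ∀ j, tt (j + 1) = s + (j : ℝ≥0) * (t / (N + 1 : ℕ)) := by intro j; simp [htt]
    have hmono : Monotone tt := by
      refine monotone_nat_of_le_succ fun j => ?_
      rcases j with _ | j
      · rw [htt0]; exact zero_le
      · rw [htt1, htt1]; gcongr; omega
    have hstep : ∀ j, 1 ≤ j → (tt (j + 1) : ℝ) - tt j = h := by
      intro j hj
      obtain ⟨i, rfl⟩ : ∃ i, j = i + 1 := ⟨j - 1, by omega⟩
      rw [htt1, htt1]; push_cast; rw [hh]; push_cast; ring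
    have hprod := hJ.integral_prod_mul_le hmono htt0 (φ := fun l => Real.exp (h * (θ * f l))) (v := v)
      (fun k => (Real.exp_pos _).le) (h := h) (r := 1 + h * a) (by positivity) hstep hN (N + 1)
    have hRexp : ∀ ω, Real.exp (θ * R N ω) =
        ∏ j ∈ Finset.range (N + 1), Real.exp (h * (θ * f (J (tt (j + 2)) ω))) := by
      intro ω
      rw [← Real.exp_sum, hR]
      congr 1
      rw [Finset.mul_sum]
      refine Finset.sum_congr rfl fun j _ => ?_
      rw [htt1 (j + 1)]
      ring
    have hRle : ∀ ω, |R N ω| ≤ t * c := by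
      intro ω
      refine (Finset.abs_sum_le_sum_abs _ _).trans ?_
      calc _ ≤ ∑ j ∈ Finset.range (N + 1), h * c := by
            refine Finset.sum_le_sum fun j _ => ?_
            rw [abs_mul, abs_of_pos hh0]
            gcongr
            exact hc _
        _ = t * c := by
            rw [Finset.sum_const, Finset.card_range, nsmul_eq_mul, hh]; field_simp
    have hi : Integrable (fun ω => Real.exp (θ * R N ω)) P := by
      refine Integrable.of_bound (C := Real.exp (|θ| * (t * c)))
        ((hmR N).const_mul θ).exp.aestronglyMeasurable (Eventually.of_forall fun ω => ?_)
      rw [Real.norm_of_nonneg (Real.exp_pos _).le]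
      refine Real.exp_le_exp.2 ((le_abs_self _).trans ?_)
      rw [abs_mul]
      gcongr
      exact hRle ω
    rw [← ofReal_integral_eq_lintegral_ofReal hi (Eventually.of_forall fun ω => (Real.exp_pos _).le)]
    refine ENNReal.ofReal_le_ofReal ?_
    have hv0 : ∀ r, Integrable (fun ω => v (J r ω)) P := fun r =>
      Integrable.of_bound (C := 3 / 2) (hm v r).aestronglyMeasurable (Eventually.of_forall fun ω => by
        rw [Real.norm_of_nonneg (by linarith [hv1 (J r ω)])]; exact hv2 _)
    calc ∫ ω, Real.exp (θ * R N ω) ∂P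
        ≤ ∫ ω, 2 * (Real.exp (θ * R N ω) * v (J (tt (N + 1 + 1)) ω)) ∂P := by
          refine integral_mono hi (Integrable.const_mul ?_ _) fun ω => ?_
          · refine hi.mul_bdd (c := 3 / 2) (hm v _).aestronglyMeasurable
              (Eventually.of_forall fun ω => ?_)
            rw [Real.norm_of_nonneg (by linarith [hv1 (J (tt (N + 1 + 1)) ω)])]; exact hv2 _
          · have := hv1 (J (tt (N + 1 + 1)) ω)
            have := Real.exp_pos (θ * R N ω)
            simp only
            nlinarith
      _ = 2 * ∫ ω, (Real.exp (θ * R N ω) * v (J (tt (N + 1 + 1)) ω)) ∂P := integral_const_mul _ _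
      _ ≤ 2 * ((1 + h * a) ^ (N + 1) * ∫ ω, v (J (tt 1) ω) ∂P) := by
          simp_rw [hRexp]
          gcongr
      _ ≤ 2 * (Real.exp (h * a) ^ (N + 1) * (3 / 2)) := by
          gcongr
          · exact integral_nonneg fun ω => (by norm_num : (0 : ℝ) ≤ 1 / 2).trans (hv1 _)
          · rw [add_comm]; exact Real.add_one_le_exp _
          · have := integral_mono (μ := P) (f := fun ω => v (J (tt 1) ω)) (g := fun _ => (3 / 2 : ℝ))
              (hv0 _)
              (integrable_const _) fun ω => hv2 _
            simpa using this
      _ = 3 * Real.exp (a * t) := by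
          rw [← Real.exp_nat_mul]
          have : ((N + 1 : ℕ) : ℝ) * (h * a) = a * t := by rw [hh]; field_simp
          rw [this]; ring
  have hlim : ∀ ω, Tendsto (fun N => ENNReal.ofReal (Real.exp (θ * R N ω))) atTop
      (𝓝 (ENNReal.ofReal (Real.exp (θ * ∫ x in (s : ℝ)..(s + t : ℝ), f (J x.toNNReal ω))))) := by
    intro ω
    have := tendsto_riemann (hJ.rightContinuous f ω) (c := c) (fun r => hc _) s t
    exact ENNReal.tendsto_ofReal ((Real.continuous_exp.tendsto _).comp (this.const_mul θ))
  calc _ = ∫⁻ ω, liminf (fun N => ENNReal.ofReal (Real.exp (θ * R N ω))) atTop ∂P :=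
        lintegral_congr fun ω => (hlim ω).liminf_eq.symm
    _ ≤ liminf (fun N => ∫⁻ ω, ENNReal.ofReal (Real.exp (θ * R N ω)) ∂P) atTop :=
        lintegral_liminf_le fun N => ((hmR N).const_mul θ).exp.ennreal_ofReal
    _ ≤ _ := liminf_le_of_frequently_le' hbound.frequently

/-- Even moments of additive functionals of the accelerated chain have diffusive order. -/
lemma exists_lintegral_pow_le {K : ℕ} {G : Matrix (Fin K) (Fin K) ℝ} {p f : Fin K → ℝ}
    (hG : IsIrreducibleGenerator G) (hsum : ∑ k, p k = 1) (hinv : ∀ l, ∑ k, p k * G k l = 0)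
    (hf : ∑ k, p k * f k = 0) (q : ℕ) :
    ∃ C : ℝ, 0 ≤ C ∧ ∀ {Ω : Type*} [MeasurableSpace Ω] (P : Measure Ω)
      [IsProbabilityMeasure P] (J : ℝ≥0 → Ω → Fin K) (κ : ℝ) (_ : 0 < κ)
      (_ : IsMarkovChain P (κ • G) p J) (s t : ℝ≥0),
      ∫⁻ ω, ‖∫ x in (s : ℝ)..(s + t : ℝ), f (J x.toNNReal ω)‖ₑ ^ (2 * (q + 1)) ∂P ≤
        ENNReal.ofReal (C * (t / κ) ^ (q + 1)) := by
  obtain ⟨C, b, hC, hb, hexp⟩ := exists_lintegral_exp_le hG hsum hinv hf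
  obtain ⟨c, hc⟩ := Finite.exists_le fun k => |f k|
  refine ⟨(2 * (q + 1)).factorial * (6 * Real.exp C) + (c ^ 2 / b ^ 2) ^ (q + 1), by positivity, ?_⟩
  intro Ω _ P _ J κ hκ hJ s t
  rcases eq_zero_or_pos (a := t) with rfl | ht
  · simp
  have htR : (0 : ℝ) < t := ht
  set A : ℝ := t / κ with hA
  have hA0 : 0 < A := by positivity
  rcases le_total 1 (b ^ 2 * (κ * t)) with h1 | h1
  · set θ : ℝ := (√A)⁻¹ with hθ
    have hsA : 0 < √A := Real.sqrt_pos.2 hA0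
    have hθ2 : θ ^ 2 = A⁻¹ := by rw [hθ, inv_pow, Real.sq_sqrt hA0.le]
    have hθ0 : 0 < θ := by positivity
    have hθb : |θ| ≤ b * κ := by
      rw [abs_of_pos hθ0]
      refine abs_le_of_sq_le_sq' ?_ (by positivity) |>.2
      rw [hθ2, hA, inv_div, div_le_iff₀ htR]
      calc κ = κ * 1 := (mul_one κ).symm
        _ ≤ κ * (b ^ 2 * (κ * t)) := by gcongr
        _ = _ := by ring
    have hval : C * (θ ^ 2 / κ) * t = C := by
      rw [hθ2, hA]; field_simp
    have e1 := hexp P J κ θ hκ hθ0.ne' hθb hJ s t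
    have e2 := hexp P J κ (-θ) hκ (neg_ne_zero.2 hθ0.ne') (by rwa [abs_neg]) hJ s t
    rw [neg_sq, hval] at e2
    rw [hval] at e1
    have hm := hJ.measurable_integral f s t
    calc _ ≤ ∫⁻ ω, ENNReal.ofReal ((2 * (q + 1)).factorial * A ^ (q + 1)) *
          (ENNReal.ofReal (Real.exp (θ * ∫ x in (s : ℝ)..(s + t : ℝ), f (J x.toNNReal ω))) +
            ENNReal.ofReal (Real.exp (-θ * ∫ x in (s : ℝ)..(s + t : ℝ), f (J x.toNNReal ω)))) ∂P :=
          lintegral_mono fun ω => enorm_pow_two_mul_le hA0 (q + 1) hθ2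
      _ ≤ ENNReal.ofReal ((2 * (q + 1)).factorial * A ^ (q + 1)) *
          (ENNReal.ofReal (3 * Real.exp C) + ENNReal.ofReal (3 * Real.exp C)) := by
          rw [lintegral_const_mul' _ _ ENNReal.ofReal_ne_top,
            lintegral_add_left (hm.const_mul θ).exp.ennreal_ofReal]
          gcongr
      _ ≤ _ := by
          rw [← ENNReal.ofReal_add (by positivity) (by positivity),
            ← ENNReal.ofReal_mul (by positivity)]
          refine ENNReal.ofReal_le_ofReal ?_
          have : 0 ≤ (c ^ 2 / b ^ 2) ^ (q + 1) * A ^ (q + 1) := by positivity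
          linarith
  · have hle : ∀ ω, ‖∫ x in (s : ℝ)..(s + t : ℝ), f (J x.toNNReal ω)‖ ≤ c * t := by
      intro ω
      have := intervalIntegral.norm_integral_le_of_norm_le_const (a := (s : ℝ)) (b := s + t)
        (f := fun x : ℝ => f (J x.toNNReal ω)) (C := c) fun x _ => hc _
      simpa [abs_of_pos htR] using this
    calc _ ≤ ∫⁻ _, ENNReal.ofReal ((c * t) ^ (2 * (q + 1))) ∂P := by
          refine lintegral_mono fun ω => ?_
          rw [← ofReal_norm, ← ENNReal.ofReal_pow (norm_nonneg _)]
          exact ENNReal.ofReal_le_ofReal (by gcongr; exact hle ω)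
      _ = ENNReal.ofReal ((c * t) ^ (2 * (q + 1))) := by simp
      _ ≤ _ := by
          refine ENNReal.ofReal_le_ofReal ?_
          have h2 : (c * t) ^ 2 ≤ c ^ 2 / b ^ 2 * A := by
            rw [mul_pow, div_mul_eq_mul_div, mul_div_assoc]
            gcongr
            rw [hA, div_div, le_div_iff₀ (by positivity)]
            calc (t : ℝ) ^ 2 * (κ * b ^ 2) = (t : ℝ) * (b ^ 2 * (κ * t)) := by ring
              _ ≤ (t : ℝ) * 1 := by gcongr
              _ = (t : ℝ) := mul_one _
          calc (c * t) ^ (2 * (q + 1)) = ((c * t) ^ 2) ^ (q + 1) := pow_mul _ _ _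
            _ ≤ (c ^ 2 / b ^ 2 * A) ^ (q + 1) := by gcongr
            _ = (c ^ 2 / b ^ 2) ^ (q + 1) * A ^ (q + 1) := mul_pow _ _ _
            _ ≤ _ := by
              have : 0 ≤ ((2 * (q + 1)).factorial * (6 * Real.exp C)) * A ^ (q + 1) := by positivity
              linarith

/-- The maximal fluctuation over a time window of the environment, on a scale `ν` with `ν ^ 2` below
the speed of the environment, has bounded moments. -/
lemma exists_environment_bound {K : ℕ} {G : Matrix (Fin K) (Fin K) ℝ} {p f : Fin K → ℝ}
    (hG : IsIrreducibleGenerator G) (hsum : ∑ k, p k = 1) (hinv : ∀ l, ∑ k, p k * G k l = 0)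
    (hf : ∑ k, p k * f k = 0) (q : ℕ) (h : ℝ≥0) :
    ∃ C : ℝ≥0, ∀ {Ω : Type*} [MeasurableSpace Ω] (P : Measure Ω)
      [IsProbabilityMeasure P] (J : ℝ≥0 → Ω → Fin K) (κ ν : ℝ) (_ : 1 ≤ ν) (_ : ν ^ 2 ≤ κ)
      (_ : IsMarkovChain P (κ • G) p J) (s : ℝ≥0), ∃ W : Ω → ℝ, Measurable W ∧ (∀ ω, 0 ≤ W ω) ∧
        (∀ ω r, (s : ℝ) ≤ r → r ≤ s + h → |ν * ∫ x in (s : ℝ)..r, f (J x.toNNReal ω)| ≤ W ω) ∧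
        ∫⁻ ω, ENNReal.ofReal (W ω ^ q) ∂P ≤ C := by
  obtain ⟨C, hC, hmom⟩ := exists_lintegral_pow_le hG hsum hinv hf (q + 1)
  obtain ⟨C', hmax⟩ := lintegral_maxDev_pow_le (2 * (q + 2))
  obtain ⟨c, hc⟩ := Finite.exists_le fun k => |f k|
  rcases isEmpty_or_nonempty (Fin K) with hemp | ⟨⟨k₀⟩⟩
  · simp at hsum
  have hc0 : 0 ≤ c := (abs_nonneg _).trans (hc k₀)
  refine ⟨2 ^ (2 * (q + 2)) * (Real.toNNReal ((c * h + 1) ^ (2 * (q + 2))) +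
    C' * (Real.toNNReal (C * (2 * h) ^ (q + 2)))), ?_⟩
  intro Ω _ P _ J κ ν hν hνκ hJ s
  have hν0 : 0 < ν := by linarith
  have hκ : 0 < κ := lt_of_lt_of_le (by positivity) hνκ
  set L := ⌈ν⌉₊ with hL
  have hL1 : 1 ≤ L := Nat.one_le_ceil_iff.2 hν0
  have hνL : ν ≤ L := Nat.le_ceil ν
  have hL0 : (0 : ℝ) < L := by exact_mod_cast hL1
  set δ : ℝ≥0 := h / L with hδ
  have hδR : (δ : ℝ) = h / L := by rw [hδ]; push_cast; rfl
  have hint : ∀ ω (a b : ℝ), IntervalIntegrable (fun x : ℝ => f (J x.toNNReal ω)) volume a b := by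
    intro ω a b
    refine (intervalIntegrable_const (c := c)).mono_fun' ((measurable_of_rightContinuous
      (hJ.rightContinuous f ω)).comp measurable_real_toNNReal).aestronglyMeasurable ?_
    exact Eventually.of_forall fun x => hc _
  set ξ : ℕ → Ω → ℝ := fun j ω =>
    ν * ∫ x in (s : ℝ)..((s : ℝ) + (j * δ : ℝ≥0) : ℝ), f (J x.toNNReal ω) with hξ
  have hξm : ∀ j, Measurable (ξ j) := fun j => (hJ.measurable_integral f s _).const_mul ν
  have hinc : ∀ i j ω, ξ (i + j) ω - ξ i ω = ν * ∫ x in (((s + i * δ : ℝ≥0)) : ℝ)..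
      (((s + i * δ : ℝ≥0) : ℝ) + (j * δ : ℝ≥0) : ℝ), f (J x.toNNReal ω) := by
    intro i j ω
    simp only [hξ]
    rw [← mul_sub, intervalIntegral.integral_interval_sub_left (hint _ _ _) (hint _ _ _)]
    push_cast
    ring_nf
  have hD : ∀ i j, ∫⁻ ω, ‖ξ (i + j) ω - ξ i ω‖ₑ ^ (2 * (q + 2)) ∂P ≤
      ENNReal.ofReal (C * (h / L) ^ (q + 2)) * (j : ℝ≥0∞) ^ (q + 2) := by
    intro i j
    simp_rw [hinc, enorm_mul, mul_pow]
    rw [lintegral_const_mul' _ _ (by simp)]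
    calc _ ≤ ‖ν‖ₑ ^ (2 * (q + 2)) * ENNReal.ofReal (C * ((j * δ : ℝ≥0) / κ) ^ (q + 2)) := by
          gcongr
          exact hmom P J κ hκ hJ _ _
      _ ≤ _ := by
          rw [Real.enorm_eq_ofReal_abs, ← ENNReal.ofReal_pow (abs_nonneg _),
            ← ENNReal.ofReal_mul (by positivity), ← ENNReal.ofReal_natCast,
            ← ENNReal.ofReal_pow (by positivity), ← ENNReal.ofReal_mul (by positivity)]
          refine ENNReal.ofReal_le_ofReal ?_
          rw [pow_mul, sq_abs]
          push_cast
          rw [hδR]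
          calc (ν ^ 2) ^ (q + 2) * (C * (j * (h / L) / κ) ^ (q + 2))
              ≤ κ ^ (q + 2) * (C * (j * (h / L) / κ) ^ (q + 2)) := by gcongr
            _ = C * (κ * (j * (h / L) / κ)) ^ (q + 2) := by rw [mul_pow κ]; ring
            _ = _ := by rw [mul_div_cancel₀ _ hκ.ne', mul_pow]; ring
  have hM := hmax P ξ hξm (q + 2) (by omega) _ hD 0 L hL1
  refine ⟨fun ω => c * h + (maxDev ξ 0 L ω).toReal, ?_, fun ω => by positivity, ?_, ?_⟩
  · exact (measurable_maxDev hξm 0 L).ennreal_toReal.const_add _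
  · intro ω r hsr hrs
    -- the last grid point before `r`
    rcases eq_zero_or_pos (a := h) with hh | hh
    · have : r = s := le_antisymm (by simpa [hh] using hrs) hsr
      rw [this]; simp; positivity
    have hhR : (0 : ℝ) < h := hh
    have hδ0 : (0 : ℝ) < δ := by rw [hδR]; positivity
    set j := ⌊(r - s) / δ⌋₊ with hj
    have hj1 : (j : ℝ) * δ ≤ r - s := by
      rw [← le_div_iff₀ hδ0]
      exact Nat.floor_le (div_nonneg (by linarith) hδ0.le)
    have hj2 : r - s < (j + 1) * δ := by
      rw [← div_lt_iff₀ hδ0]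
      exact Nat.lt_floor_add_one _
    have hjL : j ≤ L := by
      have : (r - s) / δ ≤ L := by
        rw [div_le_iff₀ hδ0, hδR, mul_div_cancel₀ _ hL0.ne']; linarith
      exact Nat.floor_le_of_le this
    have h1 := le_maxDev ξ 0 hjL ω
    have hξ0 : ξ 0 ω = 0 := by simp [hξ]
    rw [zero_add, hξ0, sub_zero, ← ENNReal.toReal_le_toReal enorm_ne_top (maxDev_ne_top _ _ _ _),
      toReal_enorm] at h1
    have h2 : ν * ∫ x in (s : ℝ)..r, f (J x.toNNReal ω) =
        ν * (∫ x in ((s : ℝ) + (j * δ : ℝ≥0) : ℝ)..r, f (J x.toNNReal ω)) + ξ j ω := by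
      simp only [hξ]
      rw [← mul_add, add_comm, intervalIntegral.integral_add_adjacent_intervals (hint _ _ _) (hint _ _ _)]
    have h3 : |∫ x in ((s : ℝ) + (j * δ : ℝ≥0) : ℝ)..r, f (J x.toNNReal ω)| ≤ c * δ := by
      refine (intervalIntegral.norm_integral_le_of_norm_le_const
        (f := fun x : ℝ => f (J x.toNNReal ω)) (C := c) fun x _ => hc _).trans ?_
      gcongr
      push_cast
      rw [abs_of_nonneg (by linarith)]
      linarith
    rw [h2]
    refine (abs_add_le _ _).trans ?_
    refine add_le_add ?_ h1
    rw [abs_mul, abs_of_pos hν0]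
    calc ν * _ ≤ L * (c * δ) := by gcongr
      _ = c * h := by rw [hδR]; field_simp
  · have hpt : ∀ ω, ENNReal.ofReal ((c * h + (maxDev ξ 0 L ω).toReal) ^ q) ≤
        2 ^ (2 * (q + 2)) * (ENNReal.ofReal ((c * h + 1) ^ (2 * (q + 2))) +
          maxDev ξ 0 L ω ^ (2 * (q + 2))) := by
      intro ω
      set y := (maxDev ξ 0 L ω).toReal with hy
      have hy0 : 0 ≤ y := ENNReal.toReal_nonneg
      have e2 : (2 : ℝ≥0∞) = ENNReal.ofReal 2 := by simp
      rw [← ENNReal.ofReal_toReal (maxDev_ne_top ξ 0 L ω), ← hy, ← ENNReal.ofReal_pow hy0, e2,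
        ← ENNReal.ofReal_pow (by norm_num), ← ENNReal.ofReal_add (by positivity) (by positivity),
        ← ENNReal.ofReal_mul (by positivity)]
      refine ENNReal.ofReal_le_ofReal ?_
      have hch : 0 ≤ c * h := by positivity
      calc (c * h + y) ^ q ≤ ((c * h + 1) + y) ^ q := by gcongr; linarith
        _ ≤ ((c * h + 1) + y) ^ (2 * (q + 2)) := pow_le_pow_right₀ (by linarith) (by omega)
        _ ≤ (2 * max (c * h + 1) y) ^ (2 * (q + 2)) := by
            gcongr
            linarith [le_max_left (c * h + 1) y, le_max_right (c * h + 1) y]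
        _ = 2 ^ (2 * (q + 2)) * max (c * h + 1) y ^ (2 * (q + 2)) := mul_pow _ _ _
        _ ≤ _ := by
            gcongr
            have e3 : 0 ≤ (c * h + 1) ^ (2 * (q + 2)) := by positivity
            have e4 : 0 ≤ y ^ (2 * (q + 2)) := by positivity
            rcases max_choice (c * h + 1) y with e | e <;> rw [e] <;> linarith
    refine (lintegral_mono hpt).trans ?_
    rw [lintegral_const_mul' _ _ (by simp), lintegral_add_left (by fun_prop), lintegral_const,
      measure_univ, mul_one]
    push_cast
    refine mul_le_mul_right (add_le_add_right (hM.trans (le_of_eq ?_)) _) _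
    congr 1
    rw [← ENNReal.ofReal_natCast, ← ENNReal.ofReal_pow (by positivity),
      ← ENNReal.ofReal_mul (by positivity), ← ENNReal.ofReal]
    congr 1
    push_cast
    rw [mul_assoc, ← mul_pow]
    congr 2
    field_simp

/-! ### Scaled sample paths on one window -/

lemma intervalIntegrable_of_abs_le {f : ℝ → ℝ} (hf : Measurable f) {a b B : ℝ} (hab : a ≤ b)
    (hB : ∀ t ∈ Set.Icc a b, |f t| ≤ B) : IntervalIntegrable f volume a b := by
  rw [intervalIntegrable_iff_integrableOn_Ioc_of_le hab]
  refine Measure.integrableOn_of_bounded (M := B) (by simp) hf.aestronglyMeasurable ?_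
  refine (ae_restrict_iff' measurableSet_Ioc).2 (Eventually.of_forall fun t ht => ?_)
  exact hB t ⟨ht.1.le, ht.2⟩

/-- A sample path of the queueing system in diffusion scaling, as deterministic data. For each class
`i`, `x i` is the centred number in system, `q i` the queue, `μ i` the service rate in the current
environment, and `a i`, `s i`, `r i` the cumulative arrivals, services and abandonments; `N` is the
ratio between the size of the system and the diffusion scale, so that `ρ i * N + x i - q i` is the
scaled number in service. -/
structure IsScaledPath {d : ℕ} (N l u : ℝ) (ρ : Fin d → ℝ) (μ x q a s r : Fin d → ℝ → ℝ) :
    Prop where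
  one_le_N : 1 ≤ N
  l_pos : 0 < l
  l_le : l ≤ 1
  one_le_u : 1 ≤ u
  le_ρ : ∀ i, l ≤ ρ i
  le_μ : ∀ i t, l ≤ μ i t
  μ_le : ∀ i t, μ i t ≤ u
  q_nonneg : ∀ i t, 0 ≤ q i t
  z_nonneg : ∀ i t, 0 ≤ ρ i * N + x i t - q i t
  measurable_μ : ∀ i, Measurable (μ i)
  measurable_x : ∀ i, Measurable (x i)
  measurable_q : ∀ i, Measurable (q i)
  bounded : ∀ T, ∃ B, ∀ i, ∀ t ∈ Set.Icc 0 T, |x i t| ≤ B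
  mono_a : ∀ i, Monotone (a i)
  mono_s : ∀ i, Monotone (s i)
  mono_r : ∀ i, Monotone (r i)
  balance : ∀ i t t', 0 ≤ t → t ≤ t' → x i t' =
    x i t + (a i t' - a i t) - (s i t' - s i t) - (r i t' - r i t)
  idle : ∀ t, 0 ≤ t → ∑ i, x i t < 0 → ∀ i, q i t = 0
  r_const : ∀ i t t', 0 ≤ t → t ≤ t' → (∀ y ∈ Set.Ioc t t', q i y = 0) → r i t' = r i t
  r_jump : ∀ i t, 0 ≤ t → ∃ δ > 0, ∀ y, 0 ≤ y → y ≤ t → t - δ < y → r i t ≤ r i y + 1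

namespace IsScaledPath

variable {d : ℕ} {N l u : ℝ} {ρ : Fin d → ℝ} {μ x q a s r : Fin d → ℝ → ℝ}

lemma neg_le_x (H : IsScaledPath N l u ρ μ x q a s r) (i : Fin d) (t : ℝ) :
    -(ρ i * N) ≤ x i t := by
  linarith [H.z_nonneg i t, H.q_nonneg i t]

lemma abs_μ_mul_le (H : IsScaledPath N l u ρ μ x q a s r) (i : Fin d) (t : ℝ) {y B : ℝ}
    (hy : |y| ≤ B) : |μ i t * y| ≤ u * B := by
  have h1 := H.le_μ i t
  have h2 := H.μ_le i t
  have h3 := H.l_pos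
  have h4 : 0 ≤ u := by linarith [H.one_le_u]
  rw [abs_mul, abs_of_nonneg (by linarith)]
  gcongr

lemma exists_bounds (H : IsScaledPath N l u ρ μ x q a s r) (T : ℝ) : ∃ B, ∀ i, ∀ t ∈ Set.Icc 0 T,
    |x i t| ≤ B ∧ |q i t| ≤ B := by
  obtain ⟨B, hB⟩ := H.bounded T
  obtain ⟨D, hD⟩ := Finite.exists_le ρ
  have hN := H.one_le_N
  refine ⟨max B 0 + |D| * N, fun i t ht => ?_⟩
  have h1 := hB i t ht
  have h2 := H.z_nonneg i t
  have h3 := H.q_nonneg i t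
  have h4 : ρ i * N ≤ |D| * N := by gcongr; exact (hD i).trans (le_abs_self _)
  have h5 : 0 ≤ |D| * N := by positivity
  have h6 := le_max_left B 0
  rw [abs_of_nonneg h3]
  exact ⟨by linarith, by linarith [(abs_le.1 h1).2]⟩

lemma int_μ (H : IsScaledPath N l u ρ μ x q a s r) (i : Fin d) {t t' : ℝ} (h : t ≤ t') :
    IntervalIntegrable (μ i) volume t t' :=
  intervalIntegrable_of_abs_le (B := u) (H.measurable_μ i) h fun y _ => by
    simpa using H.abs_μ_mul_le i y (y := 1) (B := 1) (by simp)

lemma int_μx (H : IsScaledPath N l u ρ μ x q a s r) (i : Fin d) {t t' : ℝ} (h0 : 0 ≤ t)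
    (h : t ≤ t') : IntervalIntegrable (fun y => μ i y * x i y) volume t t' := by
  obtain ⟨B, hB⟩ := H.exists_bounds t'
  exact intervalIntegrable_of_abs_le (B := u * B) ((H.measurable_μ i).mul (H.measurable_x i)) h
    fun y hy => H.abs_μ_mul_le i y (hB i y ⟨h0.trans hy.1, hy.2⟩).1

lemma int_q (H : IsScaledPath N l u ρ μ x q a s r) (i : Fin d) {t t' : ℝ} (h0 : 0 ≤ t)
    (h : t ≤ t') : IntervalIntegrable (q i) volume t t' := by
  obtain ⟨B, hB⟩ := H.exists_bounds t'
  exact intervalIntegrable_of_abs_le (B := B) (H.measurable_q i) h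
    fun y hy => (hB i y ⟨h0.trans hy.1, hy.2⟩).2

lemma int_μq (H : IsScaledPath N l u ρ μ x q a s r) (i : Fin d) {t t' : ℝ} (h0 : 0 ≤ t)
    (h : t ≤ t') : IntervalIntegrable (fun y => μ i y * q i y) volume t t' := by
  obtain ⟨B, hB⟩ := H.exists_bounds t'
  exact intervalIntegrable_of_abs_le (B := u * B) ((H.measurable_μ i).mul (H.measurable_q i)) h
    fun y hy => H.abs_μ_mul_le i y (hB i y ⟨h0.trans hy.1, hy.2⟩).2

lemma integral_service (H : IsScaledPath N l u ρ μ x q a s r) (i : Fin d) {t t' : ℝ} (h0 : 0 ≤ t)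
    (h : t ≤ t') : ∫ y in t..t', μ i y * (ρ i * N + x i y - q i y) =
      ρ i * N * (∫ y in t..t', μ i y) + (∫ y in t..t', μ i y * x i y) -
        ∫ y in t..t', μ i y * q i y := by
  rw [← intervalIntegral.integral_const_mul, ← intervalIntegral.integral_add
    ((H.int_μ i h).const_mul _) (H.int_μx i h0 h), ← intervalIntegral.integral_sub
    (((H.int_μ i h).const_mul _).add (H.int_μx i h0 h)) (H.int_μq i h0 h)]
  refine intervalIntegral.integral_congr fun y _ => ?_
  ring

lemma int_service (H : IsScaledPath N l u ρ μ x q a s r) (i : Fin d) {t t' : ℝ} (h0 : 0 ≤ t)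
    (h : t ≤ t') :
    IntervalIntegrable (fun y => μ i y * (ρ i * N + x i y - q i y)) volume t t' := by
  refine ((((H.int_μ i h).const_mul (ρ i * N)).add (H.int_μx i h0 h)).sub
    (H.int_μq i h0 h)).congr fun y _ => ?_
  ring

lemma service_nonneg (H : IsScaledPath N l u ρ μ x q a s r) (i : Fin d) (y : ℝ) :
    0 ≤ μ i y * (ρ i * N + x i y - q i y) :=
  mul_nonneg (H.l_pos.le.trans (H.le_μ i y)) (H.z_nonneg i y)

lemma integral_μ_le (H : IsScaledPath N l u ρ μ x q a s r) (i : Fin d) {t t' : ℝ} (h : t ≤ t') :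
    ∫ y in t..t', μ i y ≤ u * (t' - t) := by
  have := intervalIntegral.integral_mono_on h (H.int_μ i h) (by simp : IntervalIntegrable
    (fun _ => u) volume t t') fun y _ => H.μ_le i y
  simpa [mul_comm] using this

lemma le_integral_μ (H : IsScaledPath N l u ρ μ x q a s r) (i : Fin d) {t t' : ℝ} (h : t ≤ t') :
    l * (t' - t) ≤ ∫ y in t..t', μ i y := by
  have := intervalIntegral.integral_mono_on h (by simp : IntervalIntegrable
    (fun _ => l) volume t t') (H.int_μ i h) fun y _ => H.le_μ i y
  simpa [mul_comm] using this

lemma integral_μq_nonneg (H : IsScaledPath N l u ρ μ x q a s r) (i : Fin d) {t t' : ℝ} (h : t ≤ t') :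
    0 ≤ ∫ y in t..t', μ i y * q i y :=
  intervalIntegral.integral_nonneg h fun y _ =>
    mul_nonneg (H.l_pos.le.trans (H.le_μ i y)) (H.q_nonneg i y)

lemma integral_μq_le (H : IsScaledPath N l u ρ μ x q a s r) (i : Fin d) {t t' : ℝ} (h0 : 0 ≤ t)
    (h : t ≤ t') : ∫ y in t..t', μ i y * q i y ≤ u * ∫ y in t..t', q i y := by
  rw [← intervalIntegral.integral_const_mul]
  exact intervalIntegral.integral_mono_on h (H.int_μq i h0 h) ((H.int_q i h0 h).const_mul _)
    fun y _ => mul_le_mul_of_nonneg_right (H.μ_le i y) (H.q_nonneg i y)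

lemma integral_q_mono (H : IsScaledPath N l u ρ μ x q a s r) (i : Fin d) {b t t' b' : ℝ}
    (h0 : 0 ≤ b) (h1 : b ≤ t) (h2 : t ≤ t') (h3 : t' ≤ b') :
    ∫ y in t..t', q i y ≤ ∫ y in b..b', q i y :=
  intervalIntegral.integral_mono_interval h1 h2 h3 (Eventually.of_forall fun y => H.q_nonneg i y)
    (H.int_q i h0 (h1.trans (h2.trans h3)))

lemma integral_service_mono (H : IsScaledPath N l u ρ μ x q a s r) (i : Fin d) {b t t' b' : ℝ}
    (h0 : 0 ≤ b) (h1 : b ≤ t) (h2 : t ≤ t') (h3 : t' ≤ b') :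
    ∫ y in t..t', μ i y * (ρ i * N + x i y - q i y) ≤
      ∫ y in b..b', μ i y * (ρ i * N + x i y - q i y) :=
  intervalIntegral.integral_mono_interval h1 h2 h3
    (Eventually.of_forall fun y => H.service_nonneg i y) (H.int_service i h0 (h1.trans (h2.trans h3)))

end IsScaledPath

/-- Control of a path on the window `[w, w + h]`, which follows the window `[b, w]`: arrivals and
queues are under control over both, and each class is either under control or nearly inactive, in the
sense that both the number of services and their compensator are small. -/
structure IsControlledWindow {d : ℕ} (N l u : ℝ) (ρ : Fin d → ℝ) (μ x q a s : Fin d → ℝ → ℝ)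
    (h b w ε : ℝ) : Prop where
  h_pos : 0 < h
  h_le : u * h ≤ 1 / 8
  b_nonneg : 0 ≤ b
  b_le : b ≤ w
  arrivals : ∀ i t t', b ≤ t → t ≤ t' → t' ≤ w + h →
    |a i t' - a i t - ρ i * N * ∫ y in t..t', μ i y| ≤ ε
  queues : ∀ i, ∫ y in b..(w + h), q i y ≤ ε
  services : ∀ i, (∀ t t', w ≤ t → t ≤ t' → t' ≤ w + h →
      |s i t' - s i t - ∫ y in t..t', μ i y * (ρ i * N + x i y - q i y)| ≤ ε) ∨
    (b = w - h ∧ s i (w + h) - s i b ≤ l ^ 2 * h / 8 * N ∧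
      ∫ y in b..(w + h), μ i y * (ρ i * N + x i y - q i y) ≤ l ^ 2 * h / 8 * N)

namespace IsControlledWindow

variable {d : ℕ} {N l u : ℝ} {ρ : Fin d → ℝ} {μ x q a s r : Fin d → ℝ → ℝ} {h b w ε : ℝ}

lemma ε_nonneg (W : IsControlledWindow N l u ρ μ x q a s h b w ε) (i : Fin d) : 0 ≤ ε :=
  (abs_nonneg _).trans (W.arrivals i w w W.b_le le_rfl (by linarith [W.h_pos]))

lemma h_le_one (W : IsControlledWindow N l u ρ μ x q a s h b w ε)
    (H : IsScaledPath N l u ρ μ x q a s r) : h ≤ 1 / 8 := by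
  have := W.h_pos; have := H.one_le_u; have := W.h_le
  nlinarith

/-- A class without control of its services has few customers: otherwise a number of them of order
`N` would be in service during the preceding time `h`, which the near inactivity of the class
excludes. -/
lemma services_or (W : IsControlledWindow N l u ρ μ x q a s h b w ε)
    (H : IsScaledPath N l u ρ μ x q a s r) (i : Fin d) :
    (∀ t t', w ≤ t → t ≤ t' → t' ≤ w + h →
      |s i t' - s i t - ∫ y in t..t', μ i y * (ρ i * N + x i y - q i y)| ≤ u * ε) ∨
    ((∀ t, w ≤ t → t ≤ w + h → x i t ≤ -(ρ i * N / 4)) ∧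
      s i (w + h) - s i w ≤ l ^ 2 * h / 8 * N) := by
  have hε := W.ε_nonneg i
  have hh := W.h_pos
  have hu := H.one_le_u
  have hl := H.l_pos
  have hN := H.one_le_N
  have hρ := H.le_ρ i
  rcases W.services i with h1 | ⟨hb, hs, hT⟩
  · left
    intro t t' ht htt ht'
    exact (h1 t t' ht htt ht').trans (le_mul_of_one_le_left hε hu)
  set c := l ^ 2 * h / 8 with hc
  by_cases hch : c * N ≤ u * ε
  · left
    intro t t' ht htt ht'
    have e1 : 0 ≤ s i t' - s i t := sub_nonneg.2 (H.mono_s i htt)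
    have e2 : s i t' - s i t ≤ c * N := by
      linarith [H.mono_s i ht', H.mono_s i (W.b_le.trans ht)]
    have e3 : 0 ≤ ∫ y in t..t', μ i y * (ρ i * N + x i y - q i y) :=
      intervalIntegral.integral_nonneg htt fun y _ => H.service_nonneg i y
    have e4 := (H.integral_service_mono i W.b_nonneg (W.b_le.trans ht) htt ht').trans hT
    rw [abs_le]
    constructor <;> linarith
  · right
    refine ⟨fun t ht ht' => ?_, by linarith [H.mono_s i W.b_le]⟩
    by_contra! hx
    push Not at hch
    have hbt : b ≤ t - h := by linarith
    have hcl : c ≤ l / 8 := by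
      have := W.h_le_one H
      have := H.l_le
      rw [hc]; gcongr
      calc l ^ 2 * h ≤ l * 1 * 1 := by rw [sq]; gcongr; linarith
        _ = l := by ring
    have hεN : ε ≤ l / 8 * N := by
      have e1 : ε ≤ u * ε := le_mul_of_one_le_left hε hu
      have : c * N ≤ l / 8 * N := by gcongr
      linarith
    have hlow : ∀ y ∈ Set.Icc (t - h) t, -(ρ i * N / 2) ≤ x i y := by
      intro y hy
      have hy0 : 0 ≤ y := W.b_nonneg.trans (hbt.trans hy.1)
      have e1 := H.balance i y t hy0 hy.2
      have e2 := (abs_le.1 (W.arrivals i y t (hbt.trans hy.1) hy.2 ht')).2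
      have e3 := H.mono_s i hy.2
      have e4 := H.mono_r i hy.2
      have e5 := H.integral_μ_le i hy.2
      have e6 : ρ i * N * ∫ y in y..t, μ i y ≤ ρ i * N * (1 / 8) := by
        have : 0 ≤ ρ i := hl.le.trans hρ
        gcongr
        refine e5.trans (le_trans ?_ W.h_le)
        gcongr
        linarith [hy.1]
      have e7 : l / 8 * N ≤ ρ i / 8 * N := by gcongr
      linarith
    have e1 : ∫ y in (t - h)..t, (l * (ρ i * N / 2) - u * q i y) ≤
        ∫ y in (t - h)..t, μ i y * (ρ i * N + x i y - q i y) := by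
      have h0 : 0 ≤ t - h := W.b_nonneg.trans hbt
      refine intervalIntegral.integral_mono_on (by linarith)
        ((by simp : IntervalIntegrable (fun _ => l * (ρ i * N / 2)) volume (t - h) t).sub
          ((H.int_q i h0 (by linarith)).const_mul _)) (H.int_service i h0 (by linarith)) ?_
      intro y hy
      have e2 := hlow y hy
      have e3 := H.le_μ i y
      have e4 := H.μ_le i y
      have e5 := H.q_nonneg i y
      have e6 : 0 ≤ ρ i * N / 2 := by
        have : 0 ≤ ρ i := hl.le.trans hρ
        positivity
      have e7 : l * (ρ i * N / 2) ≤ μ i y * (ρ i * N + x i y) := by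
        have : 0 ≤ μ i y := hl.le.trans e3
        gcongr
        linarith
      have e8 : μ i y * q i y ≤ u * q i y := by gcongr
      nlinarith
    have h0 : 0 ≤ t - h := W.b_nonneg.trans hbt
    rw [intervalIntegral.integral_sub (by simp) ((H.int_q i h0 (by linarith)).const_mul _),
      intervalIntegral.integral_const, intervalIntegral.integral_const_mul, smul_eq_mul] at e1
    have e2 := (H.integral_service_mono i W.b_nonneg hbt (by linarith) ht').trans hT
    have e3 := (H.integral_q_mono i W.b_nonneg hbt (by linarith) ht').trans (W.queues i)
    have e4 : u * ∫ y in (t - h)..t, q i y ≤ u * ε := by gcongr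
    have e5 : h * (l * (l * N / 2)) ≤ h * (l * (ρ i * N / 2)) := by gcongr
    have e6 : h * (l * (l * N / 2)) = 4 * (c * N) := by rw [hc]; ring
    have e7 : 0 < c * N := by
      have : 0 < c := by rw [hc]; positivity
      positivity
    have e8 : t - (t - h) = h := by ring
    rw [e8] at e1
    linarith

/-- Upper bound: dropping the abandonments, `x i` is pulled towards zero. -/
lemma x_le (W : IsControlledWindow N l u ρ μ x q a s h b w ε)
    (H : IsScaledPath N l u ρ μ x q a s r) (i : Fin d) :
    (∀ t, w ≤ t → t ≤ w + h → x i t ≤ max (x i w) 0 + 3 * u * ε) ∧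
      x i (w + h) ≤ (1 - l * h / 2) * max (x i w) 0 + 3 * u * ε := by
  have hε := W.ε_nonneg i
  have hh := W.h_pos
  have hh1 := W.h_le_one H
  have hu := H.one_le_u
  have hl := H.l_pos
  have hl1 := H.l_le
  have hN := H.one_le_N
  have hρ := H.le_ρ i
  have hw0 : 0 ≤ w := W.b_nonneg.trans W.b_le
  have hlh : l * h ≤ 1 := by nlinarith
  have huε : 0 ≤ 3 * u * ε := by positivity
  have hm := le_max_right (x i w) 0
  rcases W.services_or H i with h1 | ⟨h1, -⟩
  · have hv : ∀ t t', w ≤ t → t ≤ t' → t' ≤ w + h →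
        x i t' ≤ x i t + 3 * u * ε - ∫ y in t..t', μ i y * x i y := by
      intro t t' ht htt ht'
      have h0 : 0 ≤ t := hw0.trans ht
      have e1 := H.balance i t t' h0 htt
      have e2 := (abs_le.1 (W.arrivals i t t' (W.b_le.trans ht) htt ht')).2
      have e3 := (abs_le.1 (h1 t t' ht htt ht')).1
      rw [H.integral_service i h0 htt] at e3
      have e4 := H.mono_r i htt
      have e5 := (H.integral_μq_le i h0 htt).trans (mul_le_mul_of_nonneg_left
        ((H.integral_q_mono i W.b_nonneg (W.b_le.trans ht) htt ht').trans (W.queues i))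
        (by linarith : 0 ≤ u))
      nlinarith
    obtain ⟨B, hB⟩ := H.exists_bounds (w + h)
    have hB' : ∀ y ∈ Set.Icc w (w + h), |μ i y * x i y| ≤ u * B := fun y hy =>
      H.abs_μ_mul_le i y (hB i y ⟨hw0.trans hy.1, hy.2⟩).1
    have hint := H.int_μx i hw0 (show w ≤ w + h by linarith)
    exact ⟨fun t ht ht' => le_posPart_add_of_le_sub_integral hint hl.le (fun y _ => H.le_μ i y) hB'
      hv ht ht', le_mul_posPart_add_of_le_sub_integral hint hl.le (by linarith)
      (fun y _ => H.le_μ i y) hB' hv (by linarith) (le_of_eq (by ring))⟩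
  · have hneg : ∀ t, w ≤ t → t ≤ w + h → x i t ≤ 0 := by
      intro t ht ht'
      have : 0 ≤ ρ i * N / 4 := by
        have : 0 ≤ ρ i := hl.le.trans hρ
        positivity
      linarith [h1 t ht ht']
    refine ⟨fun t ht ht' => by linarith [hneg t ht ht'], ?_⟩
    have := hneg (w + h) (by linarith) le_rfl
    have : 0 ≤ (1 - l * h / 2) * max (x i w) 0 := mul_nonneg (by linarith) hm
    linarith

/-- After the last time at which the system was full, at most one abandonment per class can have been
recorded (at that very time). -/
lemma exists_full_or_idle (H : IsScaledPath N l u ρ μ x q a s r) {w t : ℝ} (hw : 0 ≤ w) (hwt : w ≤ t) :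
    (∃ y, w ≤ y ∧ y ≤ t ∧ 0 ≤ ∑ i, x i y ∧ ∀ i, r i t ≤ r i y + 1) ∨ ∀ i, r i t = r i w := by
  set A : Set ℝ := {y | w ≤ y ∧ y ≤ t ∧ 0 ≤ ∑ i, x i y} with hA
  by_cases hne : A.Nonempty
  · left
    have hbdd : BddAbove A := ⟨t, fun y hy => hy.2.1⟩
    set σ := sSup A with hσ
    have hσt : σ ≤ t := csSup_le hne fun y hy => hy.2.1
    have hwσ : w ≤ σ := by
      obtain ⟨y, hy⟩ := hne
      exact hy.1.trans (le_csSup hbdd hy)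
    choose δ hδ hδ' using fun i => H.r_jump i σ (hw.trans hwσ)
    obtain ⟨δ₀, hδ₀, hδ₀'⟩ : ∃ δ₀ > 0, ∀ i, δ₀ ≤ δ i := by
      rcases isEmpty_or_nonempty (Fin d) with hd | hd
      · exact ⟨1, one_pos, fun i => isEmptyElim i⟩
      · obtain ⟨j, hj⟩ := Finite.exists_min δ
        exact ⟨δ j, hδ j, hj⟩
    obtain ⟨y, hy, hyσ⟩ := exists_lt_of_lt_csSup hne (show σ - δ₀ < sSup A by linarith)
    have hyσ' : y ≤ σ := le_csSup hbdd hy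
    refine ⟨y, hy.1, hy.2.1, hy.2.2, fun i => ?_⟩
    have e1 := hδ' i y (hw.trans hy.1) hyσ' (by linarith [hδ₀' i])
    have e2 := H.r_const i σ t (hw.trans hwσ) hσt fun z hz => by
      have hz0 : 0 ≤ z := (hw.trans hwσ).trans hz.1.le
      refine H.idle z hz0 ?_ i
      by_contra! hcon
      exact absurd (le_csSup hbdd (show z ∈ A from ⟨hwσ.trans hz.1.le, hz.2, hcon⟩)) (not_le.2 hz.1)
    rw [e2]; exact e1
  · right
    intro i
    refine H.r_const i w t hw hwt fun z hz => H.idle z (hw.trans hz.1.le) ?_ i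
    by_contra! hcon
    exact hne ⟨z, hz.1.le, hz.2, hcon⟩

/-- Lower bound. While the system is not full nobody abandons, and each class is pulled towards zero;
at the last time at which it was full, the negative parts were dominated by the positive ones. -/
lemma neg_x_le (W : IsControlledWindow N l u ρ μ x q a s h b w ε)
    (H : IsScaledPath N l u ρ μ x q a s r) (i : Fin d) :
    (∀ t, w ≤ t → t ≤ w + h → -x i t ≤ 4 * max (-x i w) 0 +
      (4 * (∑ j, max (x j w) 0 + d * (3 * u * ε)) + 2 * u * ε + 1)) ∧
    -x i (w + h) ≤ (1 - l * h / 2) * max (-x i w) 0 +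
      (4 * (∑ j, max (x j w) 0 + d * (3 * u * ε)) + 2 * u * ε + 1) := by
  have hε := W.ε_nonneg i
  have hh := W.h_pos
  have hh1 := W.h_le_one H
  have hu := H.one_le_u
  have hl := H.l_pos
  have hl1 := H.l_le
  have hN := H.one_le_N
  have hρ := H.le_ρ i
  have hρ0 : 0 ≤ ρ i := hl.le.trans hρ
  have hw0 : 0 ≤ w := W.b_nonneg.trans W.b_le
  have hlh : l * h ≤ 1 := by nlinarith
  set Y := ∑ j, max (x j w) 0 + d * (3 * u * ε) with hY
  have hY0 : 0 ≤ Y := add_nonneg (Finset.sum_nonneg fun j _ => le_max_right _ _) (by positivity)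
  set p := max (-x i w) 0 with hp
  have hp0 : 0 ≤ p := le_max_right _ _
  have huε : 0 ≤ 2 * u * ε := by positivity
  -- bound at a time when the system is full
  have hfull : ∀ y, w ≤ y → y ≤ w + h → 0 ≤ ∑ j, x j y → max (-x i y) 0 ≤ Y := by
    intro y hy hy' hsum
    have e1 : ∀ j, max (x j y) 0 ≤ max (x j w) 0 + 3 * u * ε := fun j =>
      max_le ((W.x_le H j).1 y hy hy') (add_nonneg (le_max_right _ _) (by positivity))
    have e2 : ∑ j, max (x j y) 0 ≤ Y := by
      refine (Finset.sum_le_sum fun j _ => e1 j).trans (le_of_eq ?_)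
      rw [Finset.sum_add_distrib, Finset.sum_const, Finset.card_univ, Fintype.card_fin, nsmul_eq_mul]
    refine max_le ?_ hY0
    have e3 : ∑ j, x j y ≤ x i y + ∑ j, max (x j y) 0 := by
      have : ∀ j ∈ Finset.univ, x j y ≤ (if j = i then x i y else 0) + max (x j y) 0 := by
        intro j _
        split_ifs with hj
        · subst hj; linarith [le_max_right (x j y) 0]
        · linarith [le_max_left (x j y) 0]
      refine (Finset.sum_le_sum this).trans (le_of_eq ?_)
      rw [Finset.sum_add_distrib]; simp
    linarith
  rcases W.services_or H i with h1 | ⟨h1, h2⟩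
  · -- the comparison principle on an interval where at most one abandonment is recorded
    have hcomp : ∀ y T κ, w ≤ y → y ≤ T → T ≤ w + h → r i T ≤ r i y + κ →
        ∀ t t', y ≤ t → t ≤ t' → t' ≤ T →
        -x i t' ≤ -x i t + (2 * u * ε + κ) - ∫ z in t..t', μ i z * (-x i z) := by
      intro y T κ hy hyT hT hr t t' ht htt ht'
      have h0 : 0 ≤ t := hw0.trans (hy.trans ht)
      have e1 := H.balance i t t' h0 htt
      have e2 := (abs_le.1 (W.arrivals i t t' (W.b_le.trans (hy.trans ht)) htt (ht'.trans hT))).1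
      have e3 := (abs_le.1 (h1 t t' (hy.trans ht) htt (ht'.trans hT))).2
      rw [H.integral_service i h0 htt] at e3
      have e4 := H.mono_r i ht
      have e5 := H.mono_r i ht'
      have e6 := H.integral_μq_nonneg i htt
      have e7 : ∫ z in t..t', μ i z * (-x i z) = -∫ z in t..t', μ i z * x i z := by
        rw [← intervalIntegral.integral_neg]; simp only [mul_neg]
      have e8 : ε ≤ u * ε := le_mul_of_one_le_left hε hu
      rw [e7]
      linarith
    obtain ⟨B, hB⟩ := H.exists_bounds (w + h)
    have hB' : ∀ y ∈ Set.Icc w (w + h), |μ i y * (-x i y)| ≤ u * B := fun y hy =>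
      H.abs_μ_mul_le i y (by rw [abs_neg]; exact (hB i y ⟨hw0.trans hy.1, hy.2⟩).1)
    have hint : ∀ y T, w ≤ y → y ≤ T →
        IntervalIntegrable (fun z => μ i z * (-x i z)) volume y T := by
      intro y T hy hyT
      simp only [mul_neg]
      exact (H.int_μx i (hw0.trans hy) hyT).neg
    have hle : ∀ y T κ, w ≤ y → y ≤ T → T ≤ w + h → r i T ≤ r i y + κ →
        -x i T ≤ max (-x i y) 0 + (2 * u * ε + κ) := by
      intro y T κ hy hyT hT hr
      exact le_posPart_add_of_le_sub_integral (v := fun z => -x i z) (hint y T hy hyT) hl.le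
        (fun z _ => H.le_μ i z) (fun z hz => hB' z ⟨hy.trans hz.1, hz.2.trans hT⟩)
        (hcomp y T κ hy hyT hT hr) hyT le_rfl
    constructor
    · intro t ht ht'
      rcases exists_full_or_idle H hw0 ht with ⟨y, hy, hyt, hsum, hr⟩ | hr
      · have e1 := hle y t 1 hy hyt ht' (hr i)
        have e2 := hfull y hy (hyt.trans ht') hsum
        linarith
      · have e1 := hle w t 0 le_rfl ht ht' (by rw [hr i]; simp)
        linarith
    · rcases exists_full_or_idle H hw0 (show w ≤ w + h by linarith) with ⟨y, hy, hyt, hsum, hr⟩ | hr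
      · have e1 := hle y (w + h) 1 hy hyt le_rfl (hr i)
        have e2 := hfull y hy hyt hsum
        have e3 : 0 ≤ (1 - l * h / 2) * p := mul_nonneg (by linarith) hp0
        linarith
      · have e1 := le_mul_posPart_add_of_le_sub_integral (v := fun z => -x i z) (e := 2 * u * ε + 0)
          (hint w (w + h) le_rfl (by linarith)) hl.le (by linarith) (fun z _ => H.le_μ i z) hB'
          (hcomp w (w + h) 0 le_rfl (by linarith) le_rfl (by rw [hr i]; simp))
          (η := l * h / 2) (by linarith) (le_of_eq (by ring))
        linarith
  · have hρN : 0 ≤ ρ i * N := by positivity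
    have hwx := h1 w le_rfl (by linarith)
    have hp1 : -x i w ≤ p := le_max_left _ _
    constructor
    · intro t ht ht'
      linarith [H.neg_le_x i t]
    · rcases exists_full_or_idle H hw0 (show w ≤ w + h by linarith) with ⟨y, hy, hyt, hsum, hr⟩ | hr
      · have e1 := hfull y hy hyt hsum
        have e2 := h1 y hy hyt
        have e3 := le_max_left (-x i y) 0
        have e4 : 0 ≤ (1 - l * h / 2) * p := mul_nonneg (by linarith) hp0
        linarith [H.neg_le_x i (w + h)]
      · have e1 := H.balance i w (w + h) hw0 (by linarith)
        rw [hr i] at e1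
        have e2 := (abs_le.1 (W.arrivals i w (w + h) W.b_le (by linarith) le_rfl)).1
        have e3 : ρ i * N * (l * h) ≤ ρ i * N * ∫ y in w..(w + h), μ i y := by
          gcongr
          refine le_trans (le_of_eq (by ring)) (H.le_integral_μ i (by linarith))
        have e4 : l ^ 2 * h / 8 * N ≤ ρ i * N * (l * h) / 8 := by
          have : l * (N * (l * h)) ≤ ρ i * (N * (l * h)) := by gcongr
          linarith
        have e5 : p ≤ ρ i * N := max_le (by linarith [H.neg_le_x i w]) hρN
        have e6 : l * h / 2 * p ≤ l * h / 2 * (ρ i * N) := by gcongr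
        have e7 : ε ≤ u * ε := le_mul_of_one_le_left hε hu
        have e8 : 0 ≤ ρ i * N * (l * h) := by positivity
        linarith

end IsControlledWindow

/-! ### Summation over windows -/

lemma add_rpow_le {x y m : ℝ} (hx : 0 ≤ x) (hy : 0 ≤ y) (hm : 0 ≤ m) :
    (x + y) ^ m ≤ 2 ^ m * (x ^ m + y ^ m) := by
  calc (x + y) ^ m ≤ (2 * max x y) ^ m := by
        gcongr; linarith [le_max_left x y, le_max_right x y]
    _ = 2 ^ m * max x y ^ m := Real.mul_rpow (by norm_num) (hx.trans (le_max_left _ _))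
    _ ≤ _ := by
        gcongr
        have := Real.rpow_nonneg hx m
        have := Real.rpow_nonneg hy m
        rcases max_choice x y with h | h <;> rw [h] <;> linarith

/-- Sums of powers along a contraction with perturbations. -/
lemma sum_rpow_le_of_contraction {w e : ℕ → ℝ} {η c m : ℝ} (hw : ∀ k, 0 ≤ w k) (he : ∀ k, 0 ≤ e k)
    (hη : 0 < η) (hη1 : η ≤ 1) (hc : 0 ≤ c) (hm : 1 ≤ m)
    (h : ∀ k, w (k + 1) ≤ (1 - η) * w k + c * e k) (K : ℕ) :
    η * ∑ k ∈ Finset.range K, w k ^ m + w K ^ m ≤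
      w 0 ^ m + η * (c / η) ^ m * ∑ k ∈ Finset.range K, e k ^ m := by
  induction K with
  | zero => simp
  | succ K ih =>
    have h1 : w (K + 1) ^ m ≤ (1 - η) * w K ^ m + η * (c / η * e K) ^ m := by
      have hy : 0 ≤ c / η * e K := mul_nonneg (by positivity) (he K)
      have hconv := (convexOn_rpow hm).2 (show w K ∈ Set.Ici 0 from hw K)
        (show c / η * e K ∈ Set.Ici 0 from hy) (show 0 ≤ 1 - η by linarith) hη.le (by ring)
      simp only [smul_eq_mul] at hconv
      refine le_trans ?_ hconv
      have := h K
      gcongr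
      · exact hw _
      · refine this.trans (le_of_eq ?_)
        field_simp
    rw [Real.mul_rpow (by positivity) (he K)] at h1
    rw [Finset.sum_range_succ, Finset.sum_range_succ]
    linarith

/-- Under control of all windows with errors `ε k`, the sums of powers of the path are bounded by those
of the errors. -/
lemma exists_bound_of_controlled (d : ℕ) {l u h m : ℝ} (hl : 0 < l) (hl1 : l ≤ 1) (hu : 1 ≤ u)
    (hh : 0 < h) (hh1 : h ≤ 1) (hm : 1 ≤ m) : ∃ C : ℝ, 0 ≤ C ∧ ∀ {N : ℝ} {ρ : Fin d → ℝ}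
      {μ x q a s r : Fin d → ℝ → ℝ} {ε : ℕ → ℝ} (_ : IsScaledPath N l u ρ μ x q a s r)
      (_ : ∀ k, 0 ≤ ε k) (_ : ∀ k : ℕ, IsControlledWindow N l u ρ μ x q a s h
        ((k - 1 : ℕ) * h) (k * h) (ε k)),
      ∃ D : ℕ → ℝ, (∀ k, 0 ≤ D k) ∧
        (∀ (k : ℕ) t, k * h ≤ t → t ≤ (k + 1) * h → ∑ i, |x i t| ≤ D k) ∧
        ∀ K, ∑ k ∈ Finset.range K, D k ^ m ≤
          C * ((∑ i, |x i 0|) ^ m + ∑ k ∈ Finset.range K, (ε k + 1) ^ m) := by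
  set η := l * h / 2 with hη
  have hη0 : 0 < η := by positivity
  have hη1 : η ≤ 1 / 2 := by rw [hη]; nlinarith
  set B : ℝ := 8 * d / η + 1 with hB
  have hB1 : 1 ≤ B := by rw [hB]; linarith [show 0 ≤ 8 * (d : ℝ) / η by positivity]
  have hBη : 4 * (d : ℝ) ≤ B * (η / 2) := by
    rw [hB]
    have : (8 * (d : ℝ) / η + 1) * (η / 2) = 4 * d + η / 2 := by field_simp; ring
    linarith
  set c2 : ℝ := 12 * d * u + 2 * u + 1 with hc2
  set c3 : ℝ := d * c2 + B * (3 * d * u) with hc3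
  have hc2' : 0 ≤ c2 := by positivity
  have hc3' : 0 ≤ c3 := by positivity
  refine ⟨(d : ℝ) ^ m * 2 ^ m * (8 ^ m * (((1 + B) ^ m + η / 2 * (c3 / (η / 2)) ^ m) / (η / 2)) +
    (c2 + 3 * u) ^ m), by positivity, ?_⟩
  intro N ρ μ x q a s r ε H hε W
  set p : ℕ → ℝ := fun k => ∑ i, max (x i (k * h)) 0 with hp
  set v : ℕ → ℝ := fun k => ∑ i, max (-x i (k * h)) 0 with hv
  have hp0 : ∀ k, 0 ≤ p k := fun k => Finset.sum_nonneg fun i _ => le_max_right _ _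
  have hv0 : ∀ k, 0 ≤ v k := fun k => Finset.sum_nonneg fun i _ => le_max_right _ _
  have hk : ∀ k : ℕ, (k : ℝ) * h + h = (k + 1 : ℕ) * h := fun k => by push_cast; ring
  have hpk : ∀ k, p (k + 1) ≤ (1 - η) * p k + 3 * d * u * (ε k + 1) := by
    intro k
    have h1 : ∀ i, max (x i ((k + 1 : ℕ) * h)) 0 ≤ (1 - η) * max (x i (k * h)) 0 + 3 * u * ε k := by
      intro i
      have h2 := ((W k).x_le H i).2
      rw [hk] at h2
      refine max_le h2 (add_nonneg (mul_nonneg (by linarith) (le_max_right _ _)) ?_)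
      have := hε k; positivity
    calc p (k + 1) ≤ ∑ i, ((1 - η) * max (x i (k * h)) 0 + 3 * u * ε k) :=
          Finset.sum_le_sum fun i _ => h1 i
      _ = (1 - η) * p k + d * (3 * u * ε k) := by
          rw [Finset.sum_add_distrib, ← Finset.mul_sum, Finset.sum_const, Finset.card_univ,
            Fintype.card_fin, nsmul_eq_mul]
      _ ≤ _ := by
          have : (0 : ℝ) ≤ 3 * d * u := by positivity
          nlinarith
  have herr : ∀ k, 4 * (p k + d * (3 * u * ε k)) + 2 * u * ε k + 1 ≤ 4 * p k + c2 * (ε k + 1) := by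
    intro k
    have h1 := hε k
    have h2 : (0 : ℝ) ≤ 12 * d * u + 2 * u := by positivity
    rw [hc2]
    nlinarith
  have hvk : ∀ k, v (k + 1) ≤ (1 - η) * v k + d * (4 * p k + c2 * (ε k + 1)) := by
    intro k
    have h1 : ∀ i, max (-x i ((k + 1 : ℕ) * h)) 0 ≤ (1 - η) * max (-x i (k * h)) 0 +
        (4 * p k + c2 * (ε k + 1)) := by
      intro i
      have h2 := ((W k).neg_x_le H i).2
      rw [hk] at h2
      refine max_le (h2.trans (add_le_add_right (herr k) _)) (add_nonneg (mul_nonneg (by linarith)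
        (le_max_right _ _)) ?_)
      have := hε k; have := hp0 k; positivity
    calc v (k + 1) ≤ ∑ i, ((1 - η) * max (-x i (k * h)) 0 + (4 * p k + c2 * (ε k + 1))) :=
          Finset.sum_le_sum fun i _ => h1 i
      _ = _ := by
          rw [Finset.sum_add_distrib, ← Finset.mul_sum, Finset.sum_const, Finset.card_univ,
            Fintype.card_fin, nsmul_eq_mul]
  -- the weight `B` makes the coupled recursion a contraction
  set w : ℕ → ℝ := fun k => v k + B * p k with hw
  have hw0 : ∀ k, 0 ≤ w k := fun k => add_nonneg (hv0 k) (mul_nonneg (by linarith) (hp0 k))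
  have hwk : ∀ k, w (k + 1) ≤ (1 - η / 2) * w k + c3 * (ε k + 1) := by
    intro k
    have h1 := hpk k
    have h2 := hvk k
    have h3 : B * p (k + 1) ≤ B * ((1 - η) * p k + 3 * d * u * (ε k + 1)) := by gcongr
    have h4 : 4 * (d : ℝ) * p k ≤ B * (η / 2) * p k := mul_le_mul_of_nonneg_right hBη (hp0 k)
    have h5 : 0 ≤ η / 2 * v k := mul_nonneg (by linarith) (hv0 k)
    simp only [hw, hc3]
    linarith
  have hsum := sum_rpow_le_of_contraction hw0 (fun k => by linarith [hε k] : ∀ k, 0 ≤ ε k + 1)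
    (by linarith : 0 < η / 2) (by linarith) hc3' hm hwk
  refine ⟨fun k => d * (8 * w k + (c2 + 3 * u) * (ε k + 1)), fun k => ?_, ?_, ?_⟩
  · have := hw0 k; have := hε k; positivity
  · intro k t ht ht'
    have ht'' : t ≤ k * h + h := by linarith
    have h1 : ∀ i, |x i t| ≤ 8 * w k + (c2 + 3 * u) * (ε k + 1) := by
      intro i
      have e1 := ((W k).x_le H i).1 t ht ht''
      have e2 := ((W k).neg_x_le H i).1 t ht ht''
      have e3 := herr k
      have e4 : max (x i (k * h)) 0 ≤ p k :=
        Finset.single_le_sum (f := fun i => max (x i (k * h)) 0) (fun i _ => le_max_right _ _)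
          (Finset.mem_univ i)
      have e5 : max (-x i (k * h)) 0 ≤ v k :=
        Finset.single_le_sum (f := fun i => max (-x i (k * h)) 0) (fun i _ => le_max_right _ _)
          (Finset.mem_univ i)
      have e6 : p k ≤ B * p k := le_mul_of_one_le_left (hp0 k) hB1
      have e7 := hp0 k
      have e8 := hv0 k
      have e9 := hε k
      have e10 : 0 ≤ u * ε k := by positivity
      have e11 : 0 ≤ c2 * (ε k + 1) := by positivity
      simp only [hw]
      rw [abs_le]
      constructor <;> nlinarith
    calc ∑ i, |x i t| ≤ ∑ _i : Fin d, (8 * w k + (c2 + 3 * u) * (ε k + 1)) :=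
          Finset.sum_le_sum fun i _ => h1 i
      _ = _ := by rw [Finset.sum_const, Finset.card_univ, Fintype.card_fin, nsmul_eq_mul]
  · intro K
    have hw00 : w 0 ≤ (1 + B) * ∑ i, |x i 0| := by
      have e1 : v 0 ≤ ∑ i, |x i 0| := by
        refine Finset.sum_le_sum fun i _ => max_le ?_ (abs_nonneg _)
        simpa using neg_le_abs (x i 0)
      have e2 : p 0 ≤ ∑ i, |x i 0| := by
        refine Finset.sum_le_sum fun i _ => max_le ?_ (abs_nonneg _)
        simpa using le_abs_self (x i 0)
      have e3 : B * p 0 ≤ B * ∑ i, |x i 0| := by gcongr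
      simp only [hw]
      linarith
    set X0 := ∑ i, |x i 0| with hX0
    have hX00 : 0 ≤ X0 := Finset.sum_nonneg fun i _ => abs_nonneg _
    set E := ∑ k ∈ Finset.range K, (ε k + 1) ^ m with hE
    have hE0 : 0 ≤ E := Finset.sum_nonneg fun k _ => Real.rpow_nonneg (by linarith [hε k]) _
    have hX0m : 0 ≤ X0 ^ m := Real.rpow_nonneg hX00 _
    have hS : ∑ k ∈ Finset.range K, w k ^ m ≤
        ((1 + B) ^ m + η / 2 * (c3 / (η / 2)) ^ m) / (η / 2) * (X0 ^ m + E) := by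
      have e1 := hsum K
      have e2 : w 0 ^ m ≤ (1 + B) ^ m * X0 ^ m := by
        rw [← Real.mul_rpow (by linarith) hX00]
        exact Real.rpow_le_rpow (hw0 0) hw00 (by linarith)
      have e3 : 0 ≤ w K ^ m := Real.rpow_nonneg (hw0 K) _
      have e4 : 0 ≤ η / 2 * (c3 / (η / 2)) ^ m := by positivity
      have e5 : (0 : ℝ) ≤ (1 + B) ^ m := by positivity
      rw [div_mul_eq_mul_div, le_div_iff₀ (by linarith)]
      nlinarith [mul_nonneg e4 hX0m, mul_nonneg e5 hE0]
    calc ∑ k ∈ Finset.range K, ((d : ℝ) * (8 * w k + (c2 + 3 * u) * (ε k + 1))) ^ m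
        ≤ ∑ k ∈ Finset.range K, (d : ℝ) ^ m * (2 ^ m * (8 ^ m * w k ^ m +
            (c2 + 3 * u) ^ m * (ε k + 1) ^ m)) := by
          refine Finset.sum_le_sum fun k _ => ?_
          have := hw0 k; have := hε k
          rw [Real.mul_rpow (by positivity) (by positivity)]
          gcongr
          refine (add_rpow_le (by positivity) (by positivity) (by linarith)).trans (le_of_eq ?_)
          rw [Real.mul_rpow (by norm_num) (hw0 k), Real.mul_rpow (by positivity) (by positivity)]
      _ = (d : ℝ) ^ m * 2 ^ m * (8 ^ m * ∑ k ∈ Finset.range K, w k ^ m + (c2 + 3 * u) ^ m * E) := by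
          rw [hE, ← Finset.mul_sum, ← Finset.mul_sum, Finset.sum_add_distrib, ← Finset.mul_sum,
            ← Finset.mul_sum]
          ring
      _ ≤ (d : ℝ) ^ m * 2 ^ m * (8 ^ m * (((1 + B) ^ m + η / 2 * (c3 / (η / 2)) ^ m) / (η / 2) *
            (X0 ^ m + E)) + (c2 + 3 * u) ^ m * (X0 ^ m + E)) := by
          gcongr
          linarith
      _ = _ := by ring

/-! ### Noise of a time-changed counting process on the windows of a time grid -/

/-- A counting path run at a clock `Θ`, where `g j` bounds its fluctuation on the scale `√n` in the
cell `[j n, (j + 1) n]` of the clock, and the clock advances by at most `n` in a window of length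
`h`. -/
structure IsClockedPath (n : ℕ) (h : ℝ) (A : ℝ≥0 → ℕ) (Θ : ℝ → ℝ≥0) (g : ℕ → ℝ) : Prop where
  one_le_n : 1 ≤ n
  h_nonneg : 0 ≤ h
  mono_A : Monotone A
  mono_Θ : Monotone Θ
  zero_Θ : Θ 0 = 0
  step : ∀ k : ℕ, Θ ((k + 1 : ℕ) * h) ≤ Θ (k * h) + n
  one_le_g : ∀ j, 1 ≤ g j
  cell : ∀ (j : ℕ) (v : ℝ≥0), ((j * n : ℕ) : ℝ≥0) ≤ v → v ≤ (j * n + n : ℕ) →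
    |((A v : ℝ) - v) - ((A (j * n : ℕ) : ℝ) - (j * n : ℕ))| ≤ √n * g j

namespace IsClockedPath

/-- The cell which the clock has reached at the start of window `k`. -/
noncomputable def cellAt (n : ℕ) (h : ℝ) (Θ : ℝ → ℝ≥0) (k : ℕ) : ℕ := ⌊Θ (k * h) / n⌋₊

/-- The sum of the clock and of the count at the start of window `k`. -/
noncomputable def progress (h : ℝ) (A : ℝ≥0 → ℕ) (Θ : ℝ → ℝ≥0) (k : ℕ) : ℝ :=
  (A (Θ (k * h)) : ℝ) + Θ (k * h)

/-- The window `k` is active if the clock and the count together advance noticeably in it or in the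
window before it. -/
def IsActive (n : ℕ) (h c : ℝ) (A : ℝ≥0 → ℕ) (Θ : ℝ → ℝ≥0) (k : ℕ) : Prop :=
  k = 0 ∨ progress h A Θ (k - 1) + c * n ≤ progress h A Θ k ∨
    progress h A Θ k + c * n ≤ progress h A Θ (k + 1)

open Classical in
/-- The noise in window `k`, counted only if the window is active. -/
noncomputable def noise (n : ℕ) (h c : ℝ) (A : ℝ≥0 → ℕ) (Θ : ℝ → ℝ≥0) (g : ℕ → ℝ) (k : ℕ) : ℝ :=
  if IsActive n h c A Θ k then 2 * (g (cellAt n h Θ k) + g (cellAt n h Θ k + 1)) else 0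

variable {n : ℕ} {h : ℝ} {A : ℝ≥0 → ℕ} {Θ : ℝ → ℝ≥0} {g : ℕ → ℝ}

lemma noise_nonneg (H : IsClockedPath n h A Θ g) (c : ℝ) (k : ℕ) : 0 ≤ noise n h c A Θ g k := by
  unfold noise
  split_ifs
  · linarith [H.one_le_g (cellAt n h Θ k), H.one_le_g (cellAt n h Θ k + 1)]
  · exact le_rfl

lemma monotone_progress (H : IsClockedPath n h A Θ g) : Monotone (progress h A Θ) := by
  intro k l hkl
  have h0 := H.h_nonneg
  have h1 : Θ (k * h) ≤ Θ (l * h) := H.mono_Θ (by gcongr)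
  have h2 : (A (Θ (k * h)) : ℝ) ≤ A (Θ (l * h)) := by exact_mod_cast H.mono_A h1
  have h3 : (Θ (k * h) : ℝ) ≤ Θ (l * h) := by exact_mod_cast h1
  unfold progress
  linarith

lemma cellAt_mul_le (H : IsClockedPath n h A Θ g) (k : ℕ) :
    ((cellAt n h Θ k * n : ℕ) : ℝ≥0) ≤ Θ (k * h) := by
  have hn : (0 : ℝ≥0) < n := by exact_mod_cast H.one_le_n
  have : ((cellAt n h Θ k : ℕ) : ℝ≥0) ≤ Θ (k * h) / n := Nat.floor_le zero_le
  rw [le_div_iff₀ hn] at this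
  exact_mod_cast this

lemma le_cellAt_mul_add (H : IsClockedPath n h A Θ g) (k : ℕ) :
    Θ (k * h) ≤ ((cellAt n h Θ k * n + n : ℕ) : ℝ≥0) := by
  have hn : (0 : ℝ≥0) < n := by exact_mod_cast H.one_le_n
  have : Θ (k * h) / n < (cellAt n h Θ k : ℕ) + 1 := Nat.lt_floor_add_one _
  rw [div_lt_iff₀ hn] at this
  push_cast
  calc Θ (k * h) ≤ (cellAt n h Θ k + 1) * n := this.le
    _ = _ := by ring

lemma clock_le (H : IsClockedPath n h A Θ g) (k : ℕ) : Θ (k * h) ≤ ((k * n : ℕ) : ℝ≥0) := by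
  induction k with
  | zero => simp [H.zero_Θ]
  | succ k ih =>
    refine (H.step k).trans ?_
    calc Θ (k * h) + n ≤ ((k * n : ℕ) : ℝ≥0) + n := by gcongr
      _ = _ := by push_cast; ring

lemma cellAt_le (H : IsClockedPath n h A Θ g) (k : ℕ) : cellAt n h Θ k ≤ k := by
  have h1 := (H.cellAt_mul_le k).trans (H.clock_le k)
  have h2 : cellAt n h Θ k * n ≤ k * n := by exact_mod_cast h1
  exact Nat.le_of_mul_le_mul_right h2 H.one_le_n

lemma cellAt_succ (H : IsClockedPath n h A Θ g) (k : ℕ) :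
    cellAt n h Θ (k + 1) = cellAt n h Θ k ∨ cellAt n h Θ (k + 1) = cellAt n h Θ k + 1 := by
  have hn : (0 : ℝ≥0) < n := by exact_mod_cast H.one_le_n
  have h0 := H.h_nonneg
  have h1 : cellAt n h Θ k ≤ cellAt n h Θ (k + 1) := by
    refine Nat.floor_mono ?_
    gcongr
    refine H.mono_Θ ?_
    gcongr
    omega
  have h2 : cellAt n h Θ (k + 1) ≤ cellAt n h Θ k + 1 := by
    unfold cellAt
    rw [← Nat.floor_add_one zero_le]
    refine Nat.floor_mono ?_
    rw [div_add_one hn.ne']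
    gcongr
    exact H.step k
  omega

/-- Within a window the compensated count moves by at most the fluctuations of two cells. -/
lemma abs_sub_le (H : IsClockedPath n h A Θ g) (k : ℕ) {t t' : ℝ} (ht : k * h ≤ t) (htt : t ≤ t')
    (ht' : t' ≤ (k + 1 : ℕ) * h) :
    |((A (Θ t') : ℝ) - A (Θ t)) - ((Θ t' : ℝ) - Θ t)| ≤
      √n * (2 * (g (cellAt n h Θ k) + g (cellAt n h Θ k + 1))) := by
  set j := cellAt n h Θ k with hj
  have hs : 0 ≤ √(n : ℝ) := Real.sqrt_nonneg _
  have key : ∀ y, k * h ≤ y → y ≤ (k + 1 : ℕ) * h →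
      |((A (Θ y) : ℝ) - Θ y) - ((A (j * n : ℕ) : ℝ) - (j * n : ℕ))| ≤ √n * (g j + g (j + 1)) := by
    intro y hy hy'
    have e1 : ((j * n : ℕ) : ℝ≥0) ≤ Θ y := (H.cellAt_mul_le k).trans (H.mono_Θ hy)
    have e2 : Θ y ≤ ((j * n + n + n : ℕ) : ℝ≥0) := by
      refine (H.mono_Θ hy').trans ((H.step k).trans ?_)
      rw [Nat.cast_add _ n]
      gcongr
      exact H.le_cellAt_mul_add k
    rcases le_total (Θ y) ((j * n + n : ℕ) : ℝ≥0) with e3 | e3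
    · refine (H.cell j _ e1 e3).trans ?_
      gcongr
      linarith [H.one_le_g (j + 1)]
    · have e4 := H.cell (j + 1) (Θ y) (by rwa [add_mul, one_mul]) (by rwa [add_mul, one_mul])
      have e5 := H.cell j ((j * n + n : ℕ) : ℝ≥0) (by exact_mod_cast Nat.le_add_right _ _) le_rfl
      rw [add_mul, one_mul] at e4
      rw [NNReal.coe_natCast] at e5
      rw [abs_le] at e4 e5 ⊢
      constructor <;> linarith [e4.1, e4.2, e5.1, e5.2]
  have e1 := key t ht (htt.trans ht')
  have e2 := key t' (ht.trans htt) ht'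
  rw [abs_le] at e1 e2 ⊢
  constructor <;> linarith [e1.1, e1.2, e2.1, e2.2]

lemma progress_sub_le (H : IsClockedPath n h A Θ g) (k : ℕ) :
    (A (cellAt n h Θ k * n : ℕ) : ℝ) + (cellAt n h Θ k * n : ℕ) ≤ progress h A Θ k ∧
    progress h A Θ k ≤
      (A (cellAt n h Θ k * n + n : ℕ) : ℝ) + (cellAt n h Θ k * n + n : ℕ) := by
  have h1 := H.cellAt_mul_le k
  have h2 := H.le_cellAt_mul_add k
  have h3 : (A (cellAt n h Θ k * n : ℕ) : ℝ) ≤ A (Θ (k * h)) := by exact_mod_cast H.mono_A h1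
  have h4 : (A (Θ (k * h)) : ℝ) ≤ A (cellAt n h Θ k * n + n : ℕ) := by
    exact_mod_cast H.mono_A h2
  have h5 : ((cellAt n h Θ k * n : ℕ) : ℝ) ≤ Θ (k * h) := by exact_mod_cast h1
  have h6 : (Θ (k * h) : ℝ) ≤ ((cellAt n h Θ k * n + n : ℕ) : ℝ) := by exact_mod_cast h2
  unfold progress
  constructor <;> linarith

/-- The number of windows starting in the cell `j` in which clock and count advance noticeably. -/
lemma card_advancing_le (H : IsClockedPath n h A Θ g) {c : ℝ} (hc : 0 < c) (j K : ℕ) :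
    (((Finset.range K).filter fun k => progress h A Θ k + c * n ≤ progress h A Θ (k + 1) ∧
      cellAt n h Θ k = j).card : ℝ) ≤ (3 / c + 1) * g j := by
  have hn : (0 : ℝ) < n := by exact_mod_cast H.one_le_n
  have hg := H.one_le_g j
  have hcell := H.cell j ((j * n + n : ℕ) : ℝ≥0) (by exact_mod_cast Nat.le_add_right _ _) le_rfl
  rw [NNReal.coe_natCast] at hcell
  have hb := (abs_le.1 hcell).2
  set a := (A (j * n : ℕ) : ℝ) + (j * n : ℕ) with ha
  set b := (A (j * n + n : ℕ) : ℝ) + (j * n + n : ℕ) with hb'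
  have hab : a ≤ b := by
    have : (A (j * n : ℕ) : ℝ) ≤ A (j * n + n : ℕ) := by
      exact_mod_cast H.mono_A (by exact_mod_cast Nat.le_add_right _ _)
    have : ((j * n : ℕ) : ℝ) ≤ ((j * n + n : ℕ) : ℝ) := by exact_mod_cast Nat.le_add_right _ _
    linarith
  have hba : b - a ≤ 3 * n * g j := by
    have h1 : √(n : ℝ) ≤ n := by
      rw [Real.sqrt_le_left hn.le]
      have : (1 : ℝ) ≤ n := by exact_mod_cast H.one_le_n
      nlinarith
    have h2 : √(n : ℝ) * g j ≤ n * g j := by gcongr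
    have h3 : (n : ℝ) ≤ n * g j := le_mul_of_one_le_right hn.le hg
    rw [ha, hb']
    push_cast at hb ⊢
    linarith
  have hcard := card_le_of_increments H.monotone_progress (δ := c * n) (by positivity) hab
    ((Finset.range K).filter fun k => progress h A Θ k + c * n ≤ progress h A Θ (k + 1) ∧
      cellAt n h Θ k = j) (fun k hk => by
        obtain ⟨-, h1, h2⟩ := Finset.mem_filter.1 hk
        have h3 := H.progress_sub_le k
        rw [h2] at h3
        exact ⟨h3.1, h3.2, h1⟩)
  refine hcard.trans ?_
  have h4 : (b - a) / (c * n) ≤ 3 / c * g j := by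
    rw [div_le_iff₀ (by positivity)]
    calc b - a ≤ 3 * n * g j := hba
      _ = _ := by field_simp
  linarith

lemma add_add_pow_le {x y z : ℝ} (hx : 0 ≤ x) (hy : 0 ≤ y) (hz : 0 ≤ z) (q : ℕ) :
    (x + y + z) ^ q ≤ 3 ^ q * (x ^ q + y ^ q + z ^ q) := by
  have h0 : 0 ≤ x ^ q := by positivity
  have h1 : 0 ≤ y ^ q := by positivity
  have h2 : 0 ≤ z ^ q := by positivity
  set w := max x (max y z) with hw
  have hx' : x ≤ w := le_max_left _ _
  have hy' : y ≤ w := (le_max_left _ _).trans (le_max_right _ _)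
  have hz' : z ≤ w := (le_max_right _ _).trans (le_max_right _ _)
  calc (x + y + z) ^ q ≤ (3 * w) ^ q := by gcongr; linarith
    _ = 3 ^ q * w ^ q := mul_pow _ _ _
    _ ≤ _ := by
      gcongr
      rcases max_choice x (max y z) with h | h
      · rw [hw, h]; linarith
      · rcases max_choice y z with h' | h' <;> rw [hw, h, h'] <;> linarith

lemma sum_shift_le {y : ℕ → ℝ} (hy : ∀ j, 0 ≤ y j) (K : ℕ) :
    ∑ j ∈ Finset.range K, (y j + y (j + 1) + y (j + 2)) ≤ 3 * ∑ j ∈ Finset.range (K + 2), y j := by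
  have h0 : ∑ j ∈ Finset.range K, y j ≤ ∑ j ∈ Finset.range (K + 2), y j :=
    Finset.sum_le_sum_of_subset_of_nonneg (Finset.range_mono (by omega)) fun j _ _ => hy j
  have h1 : ∑ j ∈ Finset.range K, y (j + 1) ≤ ∑ j ∈ Finset.range (K + 2), y j := by
    calc _ ≤ ∑ j ∈ Finset.range (K + 1), y j := by
          rw [Finset.sum_range_succ' y]; linarith [hy 0]
      _ ≤ _ := Finset.sum_le_sum_of_subset_of_nonneg (Finset.range_mono (by omega)) fun j _ _ => hy j
  have h2 : ∑ j ∈ Finset.range K, y (j + 2) ≤ ∑ j ∈ Finset.range (K + 2), y j := by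
    rw [Finset.sum_range_succ' y, Finset.sum_range_succ' fun j => y (j + 1)]
    linarith [hy 0, hy (0 + 1)]
  rw [Finset.sum_add_distrib, Finset.sum_add_distrib]
  linarith

/-- Since few active windows start in the same cell, the noise of the active windows is controlled by
the cell fluctuations, whatever the clock. -/
lemma sum_noise_rpow_le (H : IsClockedPath n h A Θ g) {c m : ℝ} (hc : 0 < c) (hm : 0 < m) {q : ℕ}
    (hq : m + 1 ≤ q) (K : ℕ) :
    ∑ k ∈ Finset.range K, noise n h c A Θ g k ^ m ≤
      2 ^ m * ((6 / c + 3) * (3 ^ (q + 1) * ∑ j ∈ Finset.range (K + 2), g j ^ q)) := by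
  classical
  rcases Nat.eq_zero_or_pos K with rfl | hK
  · simp only [Finset.range_zero, Finset.sum_empty]
    have : 0 ≤ ∑ j ∈ Finset.range (0 + 2), g j ^ q := Finset.sum_nonneg fun j _ =>
      pow_nonneg (by linarith [H.one_le_g j]) _
    positivity
  set S : ℕ → ℝ := fun j => g j + g (j + 1) + g (j + 2) with hS
  have hS1 : ∀ j, 1 ≤ S j := fun j => by
    simp only [hS]; linarith [H.one_le_g j, H.one_le_g (j + 1), H.one_le_g (j + 2)]
  have hSm0 : ∀ j, 0 ≤ S j ^ m := fun j => Real.rpow_nonneg (by linarith [hS1 j]) _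
  set y : ℕ → ℝ := fun k => S (cellAt n h Θ k) ^ m with hy
  have hy0 : ∀ k, 0 ≤ y k := fun k => hSm0 _
  set adv : ℕ → Prop := fun k => progress h A Θ k + c * n ≤ progress h A Θ (k + 1) with hadv
  -- the noise of an active window is paid for by the window that makes it active
  have hpay : ∀ k, noise n h c A Θ g k ^ m ≤ 2 ^ m * ((if k = 0 then y 0 else 0) +
      (if 1 ≤ k ∧ adv (k - 1) then y (k - 1) else 0) + (if adv k then y k else 0)) := by
    intro k
    have n0 : 0 ≤ (if k = 0 then y 0 else 0) := by split_ifs <;> simp [hy0]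
    have n1 : 0 ≤ (if 1 ≤ k ∧ adv (k - 1) then y (k - 1) else 0) := by split_ifs <;> simp [hy0]
    have n2 : 0 ≤ (if adv k then y k else 0) := by split_ifs <;> simp [hy0]
    have g0 := H.one_le_g (cellAt n h Θ k)
    have g1 := H.one_le_g (cellAt n h Θ k + 1)
    have g2 := H.one_le_g (cellAt n h Θ k + 2)
    by_cases hact : IsActive n h c A Θ k
    · rw [noise, if_pos hact, Real.mul_rpow (by norm_num) (by linarith)]
      refine mul_le_mul_of_nonneg_left ?_ (by positivity)
      have hself : (g (cellAt n h Θ k) + g (cellAt n h Θ k + 1)) ^ m ≤ y k := by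
        simp only [hy, hS]
        refine Real.rpow_le_rpow (by linarith) (by linarith) hm.le
      rcases hact with h1 | h1 | h1
      · subst h1
        simp only [if_true] at n0 ⊢
        linarith
      · rcases Nat.eq_zero_or_pos k with rfl | hk
        · simp only [if_true] at n0 ⊢
          linarith
        · obtain ⟨i, rfl⟩ : ∃ i, k = i + 1 := ⟨k - 1, by omega⟩
          simp only [Nat.add_sub_cancel] at h1 n1 ⊢
          have h2 : (g (cellAt n h Θ (i + 1)) + g (cellAt n h Θ (i + 1) + 1)) ^ m ≤ y i := by
            simp only [hy, hS]
            have e0 := H.one_le_g (cellAt n h Θ i)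
            have e2 := H.one_le_g (cellAt n h Θ i + 2)
            refine Real.rpow_le_rpow (by linarith) ?_ hm.le
            rcases H.cellAt_succ i with h3 | h3 <;> rw [h3]
            · linarith
            · rw [show cellAt n h Θ i + 1 + 1 = cellAt n h Θ i + 2 from rfl]
              linarith
          rw [if_pos (show 1 ≤ i + 1 ∧ adv i from ⟨by omega, h1⟩)]
          linarith
      · rw [if_pos (show adv k from h1)]
        linarith
    · rw [noise, if_neg hact, Real.zero_rpow hm.ne']
      positivity
  set Y := ∑ k ∈ Finset.range K, if adv k then y k else 0 with hY
  set G := ∑ j ∈ Finset.range (K + 2), g j ^ q with hG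
  have s0 : ∑ k ∈ Finset.range K, (if k = 0 then y 0 else 0) = y 0 := by
    rw [Finset.sum_ite_eq' (Finset.range K) 0 fun _ => y 0, if_pos (Finset.mem_range.2 hK)]
  have s1 : ∑ k ∈ Finset.range K, (if 1 ≤ k ∧ adv (k - 1) then y (k - 1) else 0) ≤ Y := by
    obtain ⟨L, rfl⟩ : ∃ L, K = L + 1 := ⟨K - 1, by omega⟩
    rw [Finset.sum_range_succ', hY, Finset.sum_range_succ]
    have n2 : 0 ≤ (if adv L then y L else 0) := by split_ifs <;> simp [hy0]
    simpa using n2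
  have hpow : ∀ j, S j ^ m * S j ≤ S j ^ q := fun j => by
    rw [← Real.rpow_add_one (by linarith [hS1 j]), ← Real.rpow_natCast]
    exact Real.rpow_le_rpow_of_exponent_le (hS1 j) hq
  have hSG : ∑ j ∈ Finset.range K, S j ^ q ≤ 3 ^ (q + 1) * G := by
    have h0 : ∀ j, 0 ≤ g j := fun j => by linarith [H.one_le_g j]
    calc ∑ j ∈ Finset.range K, S j ^ q
        ≤ ∑ j ∈ Finset.range K, 3 ^ q * (g j ^ q + g (j + 1) ^ q + g (j + 2) ^ q) :=
          Finset.sum_le_sum fun j _ => add_add_pow_le (h0 _) (h0 _) (h0 _) q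
      _ ≤ 3 ^ q * (3 * G) := by
          rw [← Finset.mul_sum]
          gcongr
          exact sum_shift_le (y := fun j => g j ^ q) (fun j => pow_nonneg (h0 j) _) K
      _ = _ := by ring
  have s2 : Y ≤ (3 / c + 1) * ∑ j ∈ Finset.range K, S j ^ q := by
    rw [hY, ← Finset.sum_filter, ← Finset.sum_fiberwise_of_maps_to (t := Finset.range K)
      (g := cellAt n h Θ) fun k hk => Finset.mem_range.2 <|
        (H.cellAt_le k).trans_lt (Finset.mem_range.1 (Finset.mem_filter.1 hk).1), Finset.mul_sum]
    refine Finset.sum_le_sum fun j _ => ?_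
    rw [Finset.filter_filter, Finset.sum_congr rfl (g := fun _ => S j ^ m) fun k hk => by
      simp only [hy, (Finset.mem_filter.1 hk).2.2], Finset.sum_const, nsmul_eq_mul]
    calc _ ≤ (3 / c + 1) * g j * S j ^ m := by
          refine mul_le_mul_of_nonneg_right (H.card_advancing_le hc j K) (hSm0 j)
      _ ≤ (3 / c + 1) * S j * S j ^ m := by
          have : g j ≤ S j := by
            simp only [hS]; linarith [H.one_le_g (j + 1), H.one_le_g (j + 2)]
          have := hSm0 j
          gcongr
      _ ≤ _ := by
          rw [mul_assoc, mul_comm (S j)]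
          gcongr
          exact hpow j
  have s3 : y 0 ≤ ∑ j ∈ Finset.range K, S j ^ q := by
    have e0 : cellAt n h Θ 0 = 0 := Nat.le_zero.1 (H.cellAt_le 0)
    have e1 : y 0 ≤ S 0 ^ q := by
      simp only [hy, e0]
      exact (le_mul_of_one_le_right (hSm0 0) (hS1 0)).trans (hpow 0)
    exact e1.trans (Finset.single_le_sum (f := fun j => S j ^ q)
      (fun j _ => pow_nonneg (by linarith [hS1 j]) _) (Finset.mem_range.2 hK))
  calc ∑ k ∈ Finset.range K, noise n h c A Θ g k ^ m
      ≤ 2 ^ m * (y 0 + Y + Y) := by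
        refine (Finset.sum_le_sum fun k _ => hpay k).trans ?_
        rw [← Finset.mul_sum, Finset.sum_add_distrib, Finset.sum_add_distrib, s0]
        gcongr
    _ ≤ 2 ^ m * ((6 / c + 3) * ∑ j ∈ Finset.range K, S j ^ q) := by
        gcongr
        calc y 0 + Y + Y ≤ _ := add_le_add (add_le_add s3 s2) s2
          _ = _ := by ring
    _ ≤ _ := by gcongr

end IsClockedPath

/-! ### Uniform bounds on the rates -/

namespace ModelParams

variable {d K : ℕ}

lemma half_le_β (M : ModelParams d K) : 1 / 2 ≤ M.β := le_max_left _ _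

lemma IsAveragedHW.β_le_one {M : ModelParams d K} (hM : M.IsAveragedHW) : M.β ≤ 1 :=
  max_le (by norm_num) (by linarith [hM.α_pos])

/-- Bounds on the rates of the `n`-th system, relative to its size. The last one says that the rates
are balanced on the diffusion scale up to the fluctuations of the environment. -/
structure RateBounds (M : ModelParams d K) (n : ℕ) (l u D : ℝ) : Prop where
  l_pos : 0 < l
  l_le : l ≤ 1
  one_le_u : 1 ≤ u
  D_nonneg : 0 ≤ D
  le_lamn : ∀ i k, l * n ≤ M.lamn n i k
  lamn_le : ∀ i k, M.lamn n i k ≤ u * n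
  le_mun : ∀ i k, l ≤ M.mun n i k
  mun_le : ∀ i k, M.mun n i k ≤ u
  le_ρ : ∀ i, l ≤ M.ρ i
  drift : ∀ i k, |(n : ℝ) ^ (-M.β) * (M.lamn n i k - n * M.lam i k) -
    M.ρ i * ((n : ℝ) ^ (1 - M.β) * (M.mun n i k - M.mu i k))| ≤ D

lemma IsAveragedHW.sum_stat_mul_pos {M : ModelParams d K} (hM : M.IsAveragedHW) {f : Fin K → ℝ}
    (hf : ∀ k, 0 < f k) : 0 < ∑ k, M.stat k * f k := by
  have h0 : ∀ k ∈ Finset.univ, 0 ≤ M.stat k * f k :=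
    fun k _ => mul_nonneg (hM.stat_nonneg k) (hf k).le
  refine (Finset.sum_nonneg h0).lt_of_ne' fun h => ?_
  have h1 := (Finset.sum_eq_zero_iff_of_nonneg h0).1 h
  have h2 : ∑ k, M.stat k = 0 := Finset.sum_eq_zero fun k hk =>
    (mul_eq_zero.1 (h1 k hk)).resolve_right (hf k).ne'
  rw [hM.stat_sum] at h2
  exact one_ne_zero h2

lemma IsAveragedHW.muPi_pos {M : ModelParams d K} (hM : M.IsAveragedHW) (i : Fin d) :
    0 < M.muPi i := hM.sum_stat_mul_pos (hM.mu_pos i)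

lemma IsAveragedHW.ρ_pos {M : ModelParams d K} (hM : M.IsAveragedHW) (i : Fin d) : 0 < M.ρ i :=
  div_pos (hM.sum_stat_mul_pos (hM.lam_pos i)) (hM.muPi_pos i)

/-- The stationary mean of the modulation of the balance between arrivals and services vanishes. -/
lemma IsAveragedHW.sum_stat_mul_eq_zero {M : ModelParams d K} (hM : M.IsAveragedHW) (i : Fin d) :
    ∑ k, M.stat k * (M.lam i k - M.ρ i * M.mu i k) = 0 := by
  have h1 : M.ρ i * M.muPi i = M.lamPi i := div_mul_cancel₀ _ (hM.muPi_pos i).ne'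
  calc _ = M.lamPi i - M.ρ i * M.muPi i := by
        rw [lamPi, muPi, Finset.mul_sum, ← Finset.sum_sub_distrib]
        exact Finset.sum_congr rfl fun k _ => by ring
    _ = 0 := by rw [h1, sub_self]

lemma IsAveragedHW.exists_rateBounds {M : ModelParams d K} (hM : M.IsAveragedHW) :
    ∃ l u D : ℝ, ∃ n₀ : ℕ, ∀ n, n₀ ≤ n → M.RateBounds n l u D := by
  -- a common positive lower bound and common upper bounds for the limits
  obtain ⟨L, hL⟩ := Finite.exists_le fun x : Fin d × Fin K =>
    (M.lam x.1 x.2)⁻¹ + (M.mu x.1 x.2)⁻¹ + (M.ρ x.1)⁻¹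
  obtain ⟨U, hU⟩ := Finite.exists_le fun x : Fin d × Fin K => M.lam x.1 x.2 + M.mu x.1 x.2
  obtain ⟨D, hD⟩ := Finite.exists_le fun x : Fin d × Fin K =>
    |M.lamHat x.1 x.2 - M.ρ x.1 * M.muHat x.1 x.2|
  obtain ⟨R, hR⟩ := Finite.exists_le fun i : Fin d => (M.ρ i)⁻¹
  set B := max (max L R) 1 with hB
  have hB1 : 1 ≤ B := le_max_right _ _
  have hB0 : 0 < B := by linarith
  have hlow : ∀ {y : ℝ}, 0 < y → y⁻¹ ≤ B → B⁻¹ ≤ y := fun hy h => inv_le_of_inv_le₀ hy h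
  have hlam : ∀ i k, B⁻¹ ≤ M.lam i k := fun i k => hlow (hM.lam_pos i k) <| by
    have h1 := hL (i, k)
    have h2 := inv_pos.2 (hM.mu_pos i k)
    have h3 := inv_pos.2 (hM.ρ_pos i)
    have h4 : L ≤ B := (le_max_left _ _).trans (le_max_left _ _)
    simp only at h1
    linarith
  have hmu : ∀ i k, B⁻¹ ≤ M.mu i k := fun i k => hlow (hM.mu_pos i k) <| by
    have h1 := hL (i, k)
    have h2 := inv_pos.2 (hM.lam_pos i k)
    have h3 := inv_pos.2 (hM.ρ_pos i)
    have h4 : L ≤ B := (le_max_left _ _).trans (le_max_left _ _)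
    simp only at h1
    linarith
  have hρ : ∀ i, B⁻¹ ≤ M.ρ i := fun i =>
    hlow (hM.ρ_pos i) ((hR i).trans ((le_max_right _ _).trans (le_max_left _ _)))
  have hBp : 0 < B⁻¹ := inv_pos.2 hB0
  have hBl : B⁻¹ ≤ 1 := inv_le_one_of_one_le₀ hB1
  have hD' : ∀ i k, Tendsto (fun n : ℕ => |(n : ℝ) ^ (-M.β) * (M.lamn n i k - n * M.lam i k) -
      M.ρ i * ((n : ℝ) ^ (1 - M.β) * (M.mun n i k - M.mu i k))|) atTop
      (𝓝 |M.lamHat i k - M.ρ i * M.muHat i k|) := fun i k =>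
    ((hM.tendsto_lamHat i k).sub ((hM.tendsto_muHat i k).const_mul _)).abs
  have key : ∀ᶠ n : ℕ in atTop, 1 ≤ n ∧ ∀ i k,
      B⁻¹ / 2 < (n : ℝ)⁻¹ * M.lamn n i k ∧ (n : ℝ)⁻¹ * M.lamn n i k < max U 0 + 1 ∧
      B⁻¹ / 2 < M.mun n i k ∧ M.mun n i k < max U 0 + 1 ∧
      |(n : ℝ) ^ (-M.β) * (M.lamn n i k - n * M.lam i k) -
      M.ρ i * ((n : ℝ) ^ (1 - M.β) * (M.mun n i k - M.mu i k))| < max D 0 + 1 := by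
    refine (eventually_ge_atTop 1).and ?_
    rw [eventually_all]
    intro i
    rw [eventually_all]
    intro k
    have h1 := hU (i, k)
    have h2 := hM.lam_pos i k
    have h3 := hM.mu_pos i k
    have h4 := le_max_left U 0
    have h5 := hD (i, k)
    have h6 := le_max_left D 0
    simp only at h1 h5
    have h7 := hlam i k
    have h8 := hmu i k
    exact ((hM.tendsto_lam i k).eventually_const_lt (by linarith)).and
      (((hM.tendsto_lam i k).eventually_lt_const (by linarith)).and
      (((hM.tendsto_mu i k).eventually_const_lt (by linarith)).and
      (((hM.tendsto_mu i k).eventually_lt_const (by linarith)).and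
      ((hD' i k).eventually_lt_const (by linarith)))))
  obtain ⟨n₀, hn₀⟩ := eventually_atTop.1 key
  refine ⟨B⁻¹ / 2, max U 0 + 1, max D 0 + 1, n₀, fun n hn => ?_⟩
  obtain ⟨hn1, h⟩ := hn₀ n hn
  have hn0 : (0 : ℝ) < n := by exact_mod_cast hn1
  have hdiv : ∀ y : ℝ, (n : ℝ)⁻¹ * y * n = y := fun y => by field_simp
  exact
    { l_pos := by linarith
      l_le := by linarith
      one_le_u := by linarith [le_max_right U 0]
      D_nonneg := by linarith [le_max_right D 0]
      le_lamn := fun i k => by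
        have := mul_le_mul_of_nonneg_right (h i k).1.le hn0.le
        rwa [hdiv] at this
      lamn_le := fun i k => by
        have := mul_le_mul_of_nonneg_right (h i k).2.1.le hn0.le
        rwa [hdiv] at this
      le_mun := fun i k => (h i k).2.2.1.le
      mun_le := fun i k => (h i k).2.2.2.1.le
      le_ρ := fun i => by linarith [hρ i]
      drift := fun i k => (h i k).2.2.2.2.le }

end ModelParams

/-! ### Clocks -/

/-- The integral of a rate, as a clock on the whole real line (frozen before time `0`). -/
lemma coe_toNNReal_timeIntegral_sub {f : ℝ≥0 → ℝ} (hf : Measurable fun t : ℝ => f t.toNNReal)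
    (h0 : ∀ t, 0 ≤ f t) (hb : ∀ T : ℝ≥0, ∃ B, ∀ t ≤ T, f t ≤ B) {t t' : ℝ} (ht : 0 ≤ t)
    (htt : t ≤ t') :
    ((timeIntegral f t'.toNNReal).toNNReal : ℝ) - (timeIntegral f t.toNNReal).toNNReal =
      ∫ y in t..t', f y.toNNReal := by
  have hpos : ∀ y : ℝ≥0, 0 ≤ timeIntegral f y := fun y =>
    intervalIntegral.integral_nonneg y.2 fun s _ => h0 _
  have hint : ∀ a b : ℝ, 0 ≤ a → a ≤ b →
      IntervalIntegrable (fun y : ℝ => f y.toNNReal) volume a b := by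
    intro a b ha hab
    obtain ⟨B, hB⟩ := hb b.toNNReal
    refine intervalIntegrable_of_abs_le (B := B) hf hab fun y hy => ?_
    rw [abs_of_nonneg (h0 _)]
    exact hB _ (Real.toNNReal_mono hy.2)
  rw [Real.coe_toNNReal _ (hpos _), Real.coe_toNNReal _ (hpos _), timeIntegral, timeIntegral,
    Real.coe_toNNReal _ (ht.trans htt), Real.coe_toNNReal _ ht,
    intervalIntegral.integral_interval_sub_left (hint 0 t' le_rfl (ht.trans htt))
      (hint 0 t le_rfl ht)]

lemma monotone_toNNReal_timeIntegral {f : ℝ≥0 → ℝ} (hf : Measurable fun t : ℝ => f t.toNNReal)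
    (h0 : ∀ t, 0 ≤ f t) (hb : ∀ T : ℝ≥0, ∃ B, ∀ t ≤ T, f t ≤ B) :
    Monotone fun t : ℝ => (timeIntegral f t.toNNReal).toNNReal := by
  intro t t' htt
  have h1 := coe_toNNReal_timeIntegral_sub hf h0 hb (t := max t 0) (t' := max t' 0)
    (le_max_right _ _) (max_le_max_right _ htt)
  have h2 : 0 ≤ ∫ y in (max t 0)..(max t' 0), f y.toNNReal :=
    intervalIntegral.integral_nonneg (max_le_max_right _ htt) fun s _ => h0 _
  have h3 : ∀ y : ℝ, (max y 0).toNNReal = y.toNNReal := fun y => by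
    rcases le_total y 0 with h | h
    · rw [max_eq_right h, Real.toNNReal_zero, Real.toNNReal_of_nonpos h]
    · rw [max_eq_left h]
  rw [h3, h3] at h1
  show (timeIntegral f t.toNNReal).toNNReal ≤ (timeIntegral f t'.toNNReal).toNNReal
  rw [← NNReal.coe_le_coe]
  linarith

lemma toNNReal_timeIntegral_zero (f : ℝ≥0 → ℝ) :
    (timeIntegral f (0 : ℝ).toNNReal).toNNReal = 0 := by
  simp [timeIntegral]

/-! ### The sample paths of the model -/

namespace QueueProcesses

variable {Ω : Type*} {d K : ℕ} (S : QueueProcesses Ω d K) (M : ModelParams d K) (n : ℕ)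

/-- The centred and scaled numbers of customers. As the other paths below, it is a function of a real
time, frozen before time `0`, so that interval integrals apply to it. -/
noncomputable def xPath (ω : Ω) (i : Fin d) (t : ℝ) : ℝ :=
  (n : ℝ) ^ (-M.β) * ((S.X t.toNNReal ω i : ℝ) - M.ρ i * n)

/-- The scaled queue lengths. -/
noncomputable def qPath (ω : Ω) (i : Fin d) (t : ℝ) : ℝ :=
  (n : ℝ) ^ (-M.β) * (S.Q t.toNNReal ω i : ℝ)

/-- The service rates in the current environment. -/
noncomputable def muPath (ω : Ω) (i : Fin d) (t : ℝ) : ℝ := M.mun n i (S.J t.toNNReal ω)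

/-- The scaled arrivals. -/
noncomputable def arrPath (ω : Ω) (i : Fin d) (t : ℝ) : ℝ :=
  (n : ℝ) ^ (-M.β) * (S.arr M n i t.toNNReal ω : ℝ)

/-- The scaled service completions. -/
noncomputable def srvPath (ω : Ω) (i : Fin d) (t : ℝ) : ℝ :=
  (n : ℝ) ^ (-M.β) * (S.srv M n i t.toNNReal ω : ℝ)

/-- The scaled abandonments. -/
noncomputable def abnPath (ω : Ω) (i : Fin d) (t : ℝ) : ℝ :=
  (n : ℝ) ^ (-M.β) * (S.abn M n i t.toNNReal ω : ℝ)

/-- The almost sure properties of a sample path. The last one says that the Poisson processes which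
drive the abandonments have no double jumps. -/
structure IsRegularPath (ω : Ω) : Prop where
  capacity : ∀ t, ∑ i, S.Z t ω i ≤ n
  dynamics : ∀ t i, (S.X t ω i : ℤ) =
    S.X 0 ω i + S.arr M n i t ω - S.srv M n i t ω - S.abn M n i t ω
  workConserving : ∀ t, ∑ i, S.Z t ω i = min (∑ i, S.X t ω i) n
  simple_R : ∀ i (U : ℕ), ∃ δ : ℝ≥0, 0 < δ ∧ ∀ u v : ℝ≥0, u ≤ v → v ≤ U → v ≤ u + δ →
    S.Rstar i v ω ≤ S.Rstar i u ω + 1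

variable {S M n}

lemma ae_isRegularPath [NeZero K] [MeasurableSpace Ω] {P : Measure Ω} [IsProbabilityMeasure P]
    (hS : S.IsModel M n P) (hZ : S.IsAdmissible M n P) : ∀ᵐ ω ∂P, S.IsRegularPath M n ω := by
  filter_upwards [hS.capacity, hS.dynamics, hZ.workConserving,
    ae_all_iff.2 fun i => (hS.poisson_R i).ae_exists_le_add_one] with ω h1 h2 h3 h4
  exact ⟨h1, h2, h3, h4⟩

lemma IsRegularPath.Z_le {ω : Ω} (H : S.IsRegularPath M n ω) (t : ℝ≥0) (i : Fin d) :
    S.Z t ω i ≤ n :=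
  (Finset.single_le_sum (f := fun i => S.Z t ω i) (fun _ _ => Nat.zero_le _)
    (Finset.mem_univ i)).trans (H.capacity t)

section Measurability

variable [MeasurableSpace Ω] {P : Measure Ω}

lemma IsModel.measurable_J_path (hS : S.IsModel M n P) (f : Fin K → ℝ) (ω : Ω) :
    Measurable fun t : ℝ => f (S.J t.toNNReal ω) :=
  (measurable_of_rightContinuous (hS.chain.rightContinuous f ω)).comp measurable_real_toNNReal

lemma measurable_natCast_path {f : ℝ≥0 → Fin d → ℕ} (hf : IsCadlagPath f) (i : Fin d) :
    Measurable fun t : ℝ => (f t.toNNReal i : ℝ) := by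
  have h0 : Continuous fun y : Fin d → ℕ => (y i : ℝ) :=
    (continuous_of_discreteTopology (f := fun k : ℕ => (k : ℝ))).comp (continuous_apply i)
  have h1 : ∀ t, ContinuousWithinAt (fun s => (f s i : ℝ)) (Set.Ici t) t := fun t =>
    h0.continuousAt.comp_continuousWithinAt (hf t).1
  exact (measurable_of_rightContinuous h1).comp measurable_real_toNNReal

lemma IsModel.measurable_Q_path (hS : S.IsModel M n P) (ω : Ω) (i : Fin d) :
    Measurable fun t : ℝ => (S.Q t.toNNReal ω i : ℝ) := measurable_natCast_path (hS.cadlag_Q ω) i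

lemma IsModel.measurable_Z_path (hS : S.IsModel M n P) (ω : Ω) (i : Fin d) :
    Measurable fun t : ℝ => (S.Z t.toNNReal ω i : ℝ) := measurable_natCast_path (hS.cadlag_Z ω) i

lemma IsModel.measurable_xPath (hS : S.IsModel M n P) (ω : Ω) (i : Fin d) :
    Measurable (S.xPath M n ω i) := by
  have : S.xPath M n ω i = fun t : ℝ => (n : ℝ) ^ (-M.β) *
      (((S.Q t.toNNReal ω i : ℝ) + (S.Z t.toNNReal ω i : ℝ)) - M.ρ i * n) := by
    funext t
    simp [xPath, X]
  rw [this]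
  exact (((hS.measurable_Q_path ω i).add (hS.measurable_Z_path ω i)).sub_const _).const_mul _

lemma IsModel.measurable_qPath (hS : S.IsModel M n P) (ω : Ω) (i : Fin d) :
    Measurable (S.qPath M n ω i) := (hS.measurable_Q_path ω i).const_mul _

end Measurability

section Clocks

variable [MeasurableSpace Ω] {P : Measure Ω} {ω : Ω}

lemma IsModel.clockA_rate (hS : S.IsModel M n P) (hM : M.IsAveragedHW) (hn : 1 ≤ n) (ω : Ω)
    (i : Fin d) : (Measurable fun t : ℝ => M.lamn n i (S.J t.toNNReal ω)) ∧
      (∀ t, 0 ≤ M.lamn n i (S.J t ω)) ∧ ∀ T : ℝ≥0, ∃ B, ∀ t ≤ T, M.lamn n i (S.J t ω) ≤ B := by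
  obtain ⟨B, hB⟩ := Finite.exists_le (M.lamn n i)
  exact ⟨hS.measurable_J_path _ ω, fun t => hM.lamn_nonneg n hn _ _, fun T => ⟨B, fun t _ => hB _⟩⟩

lemma IsModel.clockS_rate (hS : S.IsModel M n P) (hM : M.IsAveragedHW) (hn : 1 ≤ n)
    (H : S.IsRegularPath M n ω) (i : Fin d) :
    (Measurable fun t : ℝ => M.mun n i (S.J t.toNNReal ω) * S.Z t.toNNReal ω i) ∧
      (∀ t, 0 ≤ M.mun n i (S.J t ω) * S.Z t ω i) ∧
      ∀ T : ℝ≥0, ∃ B, ∀ t ≤ T, M.mun n i (S.J t ω) * S.Z t ω i ≤ B := by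
  obtain ⟨B, hB⟩ := Finite.exists_le (M.mun n i)
  have h0 : ∀ k, 0 ≤ M.mun n i k := fun k => (hM.mun_pos n hn i k).le
  refine ⟨(hS.measurable_J_path _ ω).mul (hS.measurable_Z_path ω i),
    fun t => mul_nonneg (h0 _) (Nat.cast_nonneg _), fun T => ⟨B * n, fun t _ => ?_⟩⟩
  have h1 : (S.Z t ω i : ℝ) ≤ n := by exact_mod_cast H.Z_le t i
  exact mul_le_mul (hB _) h1 (Nat.cast_nonneg _) ((h0 _).trans (hB (S.J t ω)))

lemma IsModel.exists_X_le (hS : S.IsModel M n P) (hM : M.IsAveragedHW) (hn : 1 ≤ n)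
    (H : S.IsRegularPath M n ω) (T : ℝ≥0) : ∃ B : ℕ, ∀ i, ∀ t ≤ T, S.X t ω i ≤ B := by
  obtain ⟨B, hB⟩ := Finite.exists_le fun i => S.X 0 ω i + S.arr M n i T ω
  refine ⟨B, fun i t ht => le_trans ?_ (hB i)⟩
  obtain ⟨h1, h2, h3⟩ := hS.clockA_rate hM hn ω i
  have h4 := monotone_toNNReal_timeIntegral h1 h2 h3 (show (t : ℝ) ≤ T from ht)
  simp only [Real.toNNReal_coe] at h4
  have h5 : S.arr M n i t ω ≤ S.arr M n i T ω := (hS.poisson_A i).mono ω h4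
  have h6 := H.dynamics t i
  omega

lemma IsModel.clockR_rate (hS : S.IsModel M n P) (hM : M.IsAveragedHW) (hn : 1 ≤ n)
    (H : S.IsRegularPath M n ω) (i : Fin d) :
    (Measurable fun t : ℝ => M.gamn n i (S.J t.toNNReal ω) * S.Q t.toNNReal ω i) ∧
      (∀ t, 0 ≤ M.gamn n i (S.J t ω) * S.Q t ω i) ∧
      ∀ T : ℝ≥0, ∃ B, ∀ t ≤ T, M.gamn n i (S.J t ω) * S.Q t ω i ≤ B := by
  obtain ⟨B, hB⟩ := Finite.exists_le (M.gamn n i)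
  have h0 : ∀ k, 0 ≤ M.gamn n i k := fun k => (hM.gamn_pos n hn i k).le
  refine ⟨(hS.measurable_J_path _ ω).mul (hS.measurable_Q_path ω i),
    fun t => mul_nonneg (h0 _) (Nat.cast_nonneg _), fun T => ?_⟩
  obtain ⟨D, hD⟩ := hS.exists_X_le hM hn H T
  refine ⟨B * D, fun t ht => ?_⟩
  have h1 : (S.Q t ω i : ℝ) ≤ D := by
    exact_mod_cast (Nat.le_add_right _ (S.Z t ω i)).trans (hD i t ht)
  exact mul_le_mul (hB _) h1 (Nat.cast_nonneg _) ((h0 _).trans (hB (S.J t ω)))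

end Clocks

lemma rpow_one_sub_β (M : ModelParams d K) (hn : 1 ≤ n) :
    (n : ℝ) ^ (-M.β) * n = (n : ℝ) ^ (1 - M.β) := by
  have hn0 : (0 : ℝ) < n := by exact_mod_cast hn
  rw [← Real.rpow_add_one hn0.ne']
  congr 1
  ring

lemma z_eq (M : ModelParams d K) (hn : 1 ≤ n) (ω : Ω) (i : Fin d) (t : ℝ) :
    M.ρ i * (n : ℝ) ^ (1 - M.β) + S.xPath M n ω i t - S.qPath M n ω i t =
      (n : ℝ) ^ (-M.β) * (S.Z t.toNNReal ω i : ℝ) := by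
  rw [← rpow_one_sub_β M hn, xPath, qPath, X]
  push_cast
  ring

lemma sum_xPath (hM : M.IsAveragedHW) (ω : Ω) (t : ℝ) : ∑ i, S.xPath M n ω i t =
    (n : ℝ) ^ (-M.β) * ((∑ i, (S.X t.toNNReal ω i : ℝ)) - n) := by
  simp only [xPath]
  rw [← Finset.mul_sum, Finset.sum_sub_distrib, ← Finset.sum_mul, hM.critical, one_mul]

lemma IsRegularPath.Q_eq_zero {ω : Ω} (H : S.IsRegularPath M n ω) {t : ℝ≥0}
    (h : ∑ i, S.X t ω i ≤ n) (i : Fin d) : S.Q t ω i = 0 := by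
  have h1 := H.workConserving t
  rw [min_eq_left h] at h1
  simp only [X, Finset.sum_add_distrib] at h1
  have h2 : ∑ i, S.Q t ω i = 0 := by omega
  exact Finset.sum_eq_zero_iff.1 h2 i (Finset.mem_univ i)

/-- A clock with a rate bounded on compacts is continuous, hence the driven process jumps by at most
one if the driving one does. -/
lemma exists_jump_le_one {f : ℝ≥0 → ℝ} (hf : Measurable fun t : ℝ => f t.toNNReal)
    (h0 : ∀ t, 0 ≤ f t) (hb : ∀ T : ℝ≥0, ∃ B, ∀ t ≤ T, f t ≤ B) {R : ℝ≥0 → ℕ}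
    (hR : ∀ U : ℕ, ∃ δ : ℝ≥0, 0 < δ ∧ ∀ u v : ℝ≥0, u ≤ v → v ≤ U → v ≤ u + δ → R v ≤ R u + 1)
    (t : ℝ) : ∃ δ > 0, ∀ y, 0 ≤ y → y ≤ t → t - δ < y →
      R (timeIntegral f t.toNNReal).toNNReal ≤ R (timeIntegral f y.toNNReal).toNNReal + 1 := by
  obtain ⟨B, hB⟩ := hb t.toNNReal
  obtain ⟨U, hU⟩ := exists_nat_ge (timeIntegral f t.toNNReal).toNNReal
  obtain ⟨δ, hδ, hj⟩ := hR U
  have hB0 : 0 ≤ B := (h0 _).trans (hB t.toNNReal le_rfl)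
  refine ⟨δ / (B + 1), div_pos (by exact_mod_cast hδ) (by linarith), fun y hy hyt hyδ => ?_⟩
  refine hj _ _ (monotone_toNNReal_timeIntegral hf h0 hb hyt) hU ?_
  have h1 := coe_toNNReal_timeIntegral_sub hf h0 hb hy hyt
  have h2 : ∫ s in y..t, f s.toNNReal ≤ B * (t - y) := by
    have hint := intervalIntegrable_of_abs_le (B := B) hf hyt fun s hs => by
      rw [abs_of_nonneg (h0 _)]
      exact hB _ (Real.toNNReal_mono hs.2)
    have := intervalIntegral.integral_mono_on hyt hint
      (by simp : IntervalIntegrable (fun _ => B) volume y t)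
      fun s hs => hB _ (Real.toNNReal_mono hs.2)
    simpa [mul_comm] using this
  have h3 : (B + 1) * (t - y) ≤ δ := by
    rw [mul_comm, ← le_div_iff₀ (by linarith)]
    linarith
  rw [← NNReal.coe_le_coe, NNReal.coe_add]
  nlinarith

lemma IsModel.isScaledPath [MeasurableSpace Ω] {P : Measure Ω} (hS : S.IsModel M n P)
    (hM : M.IsAveragedHW) (hn : 1 ≤ n) {l u D : ℝ} (hB : M.RateBounds n l u D) {ω : Ω}
    (H : S.IsRegularPath M n ω) :
    IsScaledPath ((n : ℝ) ^ (1 - M.β)) l u M.ρ (S.muPath M n ω) (S.xPath M n ω) (S.qPath M n ω)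
      (S.arrPath M n ω) (S.srvPath M n ω) (S.abnPath M n ω) := by
  have hn1 : (1 : ℝ) ≤ n := by exact_mod_cast hn
  have hn0 : (0 : ℝ) < n := by linarith
  have hp : 0 < (n : ℝ) ^ (-M.β) := Real.rpow_pos_of_pos hn0 _
  have hp1 : (n : ℝ) ^ (-M.β) ≤ 1 :=
    Real.rpow_le_one_of_one_le_of_nonpos hn1 (by linarith [M.half_le_β])
  exact
    { one_le_N := Real.one_le_rpow hn1 (by linarith [hM.β_le_one])
      l_pos := hB.l_pos
      l_le := hB.l_le
      one_le_u := hB.one_le_u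
      le_ρ := hB.le_ρ
      le_μ := fun i t => hB.le_mun _ _
      μ_le := fun i t => hB.mun_le _ _
      q_nonneg := fun i t => mul_nonneg hp.le (Nat.cast_nonneg _)
      z_nonneg := fun i t => by
        rw [z_eq M hn]
        exact mul_nonneg hp.le (Nat.cast_nonneg _)
      measurable_μ := fun i => hS.measurable_J_path _ ω
      measurable_x := hS.measurable_xPath ω
      measurable_q := hS.measurable_qPath ω
      bounded := fun T => by
        obtain ⟨B, hB'⟩ := hS.exists_X_le hM hn H T.toNNReal
        obtain ⟨R, hR⟩ := Finite.exists_le M.ρ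
        refine ⟨(n : ℝ) ^ (-M.β) * (B + |R| * n), fun i t ht => ?_⟩
        rw [xPath, abs_mul, abs_of_pos hp]
        gcongr
        have h1 : (S.X t.toNNReal ω i : ℝ) ≤ B := by
          exact_mod_cast hB' i _ (Real.toNNReal_mono ht.2)
        have h2 : M.ρ i * n ≤ |R| * n := by gcongr; exact (hR i).trans (le_abs_self _)
        have h3 : 0 ≤ M.ρ i * n := mul_nonneg (hM.ρ_pos i).le hn0.le
        have h4 : (0 : ℝ) ≤ S.X t.toNNReal ω i := Nat.cast_nonneg _
        rw [abs_le]
        constructor <;> linarith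
      mono_a := fun i t t' htt => by
        obtain ⟨h1, h2, h3⟩ := hS.clockA_rate hM hn ω i
        have h4 := (hS.poisson_A i).mono ω (monotone_toNNReal_timeIntegral h1 h2 h3 htt)
        exact mul_le_mul_of_nonneg_left (by exact_mod_cast h4) hp.le
      mono_s := fun i t t' htt => by
        obtain ⟨h1, h2, h3⟩ := hS.clockS_rate hM hn H i
        have h4 := (hS.poisson_S i).mono ω (monotone_toNNReal_timeIntegral h1 h2 h3 htt)
        exact mul_le_mul_of_nonneg_left (by exact_mod_cast h4) hp.le
      mono_r := fun i t t' htt => by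
        obtain ⟨h1, h2, h3⟩ := hS.clockR_rate hM hn H i
        have h4 := (hS.poisson_R i).mono ω (monotone_toNNReal_timeIntegral h1 h2 h3 htt)
        exact mul_le_mul_of_nonneg_left (by exact_mod_cast h4) hp.le
      balance := fun i t t' ht htt => by
        have h1 : (S.X t.toNNReal ω i : ℝ) = S.X 0 ω i + S.arr M n i t.toNNReal ω
          - S.srv M n i t.toNNReal ω - S.abn M n i t.toNNReal ω := by
          exact_mod_cast H.dynamics t.toNNReal i
        have h2 : (S.X t'.toNNReal ω i : ℝ) = S.X 0 ω i + S.arr M n i t'.toNNReal ω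
          - S.srv M n i t'.toNNReal ω - S.abn M n i t'.toNNReal ω := by
          exact_mod_cast H.dynamics t'.toNNReal i
        rw [xPath, xPath, h1, h2, arrPath, arrPath, srvPath, srvPath, abnPath, abnPath]
        ring
      idle := fun t ht hsum i => by
        rw [sum_xPath hM] at hsum
        have h1 : (∑ i, (S.X t.toNNReal ω i : ℝ)) - n < 0 := by
          by_contra hcon
          exact absurd hsum (not_lt.2 (mul_nonneg hp.le (not_lt.1 hcon)))
        have h2 : ∑ i, S.X t.toNNReal ω i ≤ n := by
          have : ((∑ i, S.X t.toNNReal ω i : ℕ) : ℝ) < n := by push_cast; linarith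
          exact_mod_cast this.le
        rw [qPath, H.Q_eq_zero h2, Nat.cast_zero, mul_zero]
      r_const := fun i t t' ht htt hq => by
        obtain ⟨h1, h2, h3⟩ := hS.clockR_rate hM hn H i
        have h4 := coe_toNNReal_timeIntegral_sub h1 h2 h3 ht htt
        have h5 : ∫ y in t..t', M.gamn n i (S.J y.toNNReal ω) * S.Q y.toNNReal ω i = 0 := by
          rw [intervalIntegral.integral_of_le htt]
          refine (setIntegral_congr_fun (g := fun _ => 0) measurableSet_Ioc fun y hy => ?_).trans
            (by simp)
          have h6 : (S.Q y.toNNReal ω i : ℝ) = 0 := by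
            have := hq y hy
            rw [qPath, mul_eq_zero] at this
            exact this.resolve_left hp.ne'
          simp only [h6, mul_zero]
        rw [h5, sub_eq_zero, NNReal.coe_inj] at h4
        rw [abnPath, abnPath, abn, abn, clockR, clockR, h4]
      r_jump := fun i t _ => by
        obtain ⟨h1, h2, h3⟩ := hS.clockR_rate hM hn H i
        obtain ⟨δ, hδ, hj⟩ := exists_jump_le_one h1 h2 h3 (H.simple_R i) t
        refine ⟨δ, hδ, fun y h0 hyt hyδ => ?_⟩
        have h4 : (S.abn M n i t.toNNReal ω : ℝ) ≤ S.abn M n i y.toNNReal ω + 1 := by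
          exact_mod_cast hj y h0 hyt hyδ
        calc S.abnPath M n ω i t ≤ (n : ℝ) ^ (-M.β) * (S.abn M n i y.toNNReal ω + 1) :=
              mul_le_mul_of_nonneg_left h4 hp.le
          _ = S.abnPath M n ω i y + (n : ℝ) ^ (-M.β) := by rw [abnPath]; ring
          _ ≤ _ := by gcongr }

end QueueProcesses

/-! ### Control of the windows by the noise -/

namespace QueueProcesses

variable {Ω : Type*} {d K : ℕ} {S : QueueProcesses Ω d K} {M : ModelParams d K} {n : ℕ}

/-- A Poisson path run at a clock whose rate is at most `u n`, on windows of length at most `1 / u`. -/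
lemma isClockedPath [MeasurableSpace Ω] {P : Measure Ω} {A : ℝ≥0 → Ω → ℕ} (hA : IsUnitPoisson P A)
    (hn : 1 ≤ n) {f : ℝ≥0 → ℝ} (hf : Measurable fun t : ℝ => f t.toNNReal)
    (h0 : ∀ t, 0 ≤ f t) {h u : ℝ} (hh : 0 ≤ h) (hu : ∀ t, f t ≤ u * n) (huh : u * h ≤ 1) (ω : Ω) :
    IsClockedPath n h (fun v => A v ω) (fun t => (timeIntegral f t.toNNReal).toNNReal)
      (fun j => IsUnitPoisson.cellDev A n j ω) := by
  have hb : ∀ T : ℝ≥0, ∃ B, ∀ t ≤ T, f t ≤ B := fun T => ⟨u * n, fun t _ => hu t⟩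
  exact
    { one_le_n := hn
      h_nonneg := hh
      mono_A := hA.mono ω
      mono_Θ := monotone_toNNReal_timeIntegral hf h0 hb
      zero_Θ := toNNReal_timeIntegral_zero f
      step := fun k => by
        have hk : (k : ℝ) * h ≤ (k + 1 : ℕ) * h := by gcongr; omega
        have h1 := coe_toNNReal_timeIntegral_sub hf h0 hb (by positivity : 0 ≤ (k : ℝ) * h) hk
        have h2 : ∫ s in ((k : ℝ) * h)..((k + 1 : ℕ) * h), f s.toNNReal ≤ n := by
          have hint := intervalIntegrable_of_abs_le (B := u * n) hf hk fun s _ => by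
            rw [abs_of_nonneg (h0 _)]
            exact hu _
          have := intervalIntegral.integral_mono_on hk hint
            (by simp : IntervalIntegrable (fun _ => u * (n : ℝ)) volume _ _) fun s _ => hu _
          refine this.trans ?_
          rw [intervalIntegral.integral_const, smul_eq_mul]
          push_cast
          calc (((k : ℝ) + 1) * h - k * h) * (u * n) = (u * h) * n := by ring
            _ ≤ 1 * n := by gcongr
            _ = n := one_mul _
        rw [← NNReal.coe_le_coe, NNReal.coe_add, NNReal.coe_natCast]
        linarith
      one_le_g := fun j => IsUnitPoisson.one_le_cellDev A n j ω
      cell := fun j v hv hv' => hA.abs_sub_sub_le hn ω hv hv' }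

/-- The noise of the arrivals of class `i` in window `k`. -/
noncomputable def noiseA (S : QueueProcesses Ω d K) (M : ModelParams d K) (n : ℕ) (h c : ℝ) (ω : Ω)
    (i : Fin d) (k : ℕ) : ℝ :=
  IsClockedPath.noise n h c (fun v => S.Astar i v ω) (fun t => S.clockA M n i t.toNNReal ω)
    (fun j => IsUnitPoisson.cellDev (S.Astar i) n j ω) k

/-- The noise of the services of class `i` in window `k`. -/
noncomputable def noiseS (S : QueueProcesses Ω d K) (M : ModelParams d K) (n : ℕ) (h c : ℝ) (ω : Ω)
    (i : Fin d) (k : ℕ) : ℝ :=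
  IsClockedPath.noise n h c (fun v => S.Sstar i v ω) (fun t => S.clockS M n i t.toNNReal ω)
    (fun j => IsUnitPoisson.cellDev (S.Sstar i) n j ω) k

lemma IsModel.isClockedPath_A [MeasurableSpace Ω] {P : Measure Ω} (hS : S.IsModel M n P)
    (hM : M.IsAveragedHW) (hn : 1 ≤ n) {l u D h : ℝ} (hB : M.RateBounds n l u D) (hh : 0 ≤ h)
    (huh : u * h ≤ 1) (ω : Ω) (i : Fin d) :
    IsClockedPath n h (fun v => S.Astar i v ω) (fun t => S.clockA M n i t.toNNReal ω)
      (fun j => IsUnitPoisson.cellDev (S.Astar i) n j ω) := by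
  obtain ⟨h1, h2, -⟩ := hS.clockA_rate hM hn ω i
  exact isClockedPath (hS.poisson_A i) hn h1 h2 hh (fun t => hB.lamn_le _ _) huh ω

lemma IsModel.isClockedPath_S [MeasurableSpace Ω] {P : Measure Ω} (hS : S.IsModel M n P)
    (hM : M.IsAveragedHW) (hn : 1 ≤ n) {l u D h : ℝ} (hB : M.RateBounds n l u D) (hh : 0 ≤ h)
    (huh : u * h ≤ 1) {ω : Ω} (H : S.IsRegularPath M n ω) (i : Fin d) :
    IsClockedPath n h (fun v => S.Sstar i v ω) (fun t => S.clockS M n i t.toNNReal ω)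
      (fun j => IsUnitPoisson.cellDev (S.Sstar i) n j ω) := by
  obtain ⟨h1, h2, -⟩ := hS.clockS_rate hM hn H i
  refine isClockedPath (hS.poisson_S i) hn h1 h2 hh (fun t => ?_) huh ω
  have h3 : (S.Z t ω i : ℝ) ≤ n := by exact_mod_cast H.Z_le t i
  exact mul_le_mul (hB.mun_le _ _) h3 (Nat.cast_nonneg _) (by linarith [hB.one_le_u])

/-- Arrivals follow the balancing service capacity up to Poisson noise, drift and environment. -/
lemma IsModel.abs_arr_sub_le [MeasurableSpace Ω] {P : Measure Ω} (hS : S.IsModel M n P)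
    (hM : M.IsAveragedHW) (hn : 1 ≤ n) {l u D h : ℝ} (hB : M.RateBounds n l u D) (hh : 0 < h)
    (huh : u * h ≤ 1) (hh1 : h ≤ 1) {ω : Ω} (i : Fin d) (k : ℕ) {W : ℝ}
    (hW : ∀ r : ℝ, k * h ≤ r → r ≤ k * h + h →
      |(n : ℝ) ^ (1 - M.β) * ∫ y in (k * h : ℝ)..r, (M.lam i (S.J y.toNNReal ω) -
        M.ρ i * M.mu i (S.J y.toNNReal ω))| ≤ W) {t t' : ℝ} (ht : k * h ≤ t) (htt : t ≤ t')
    (ht' : t' ≤ (k + 1 : ℕ) * h) :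
    |S.arrPath M n ω i t' - S.arrPath M n ω i t -
      M.ρ i * (n : ℝ) ^ (1 - M.β) * ∫ y in t..t', S.muPath M n ω i y| ≤
      S.noiseA M n h (l ^ 2 * h / 16) ω i k + D + 2 * W := by
  have hn1 : (1 : ℝ) ≤ n := by exact_mod_cast hn
  have hn0 : (0 : ℝ) < n := by linarith
  have hp : 0 < (n : ℝ) ^ (-M.β) := Real.rpow_pos_of_pos hn0 _
  have hk0 : 0 ≤ (k : ℝ) * h := by positivity
  have ht0 : 0 ≤ t := hk0.trans ht
  have hkk : ((k + 1 : ℕ) : ℝ) * h = k * h + h := by push_cast; ring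
  obtain ⟨h1, h2, h3⟩ := hS.clockA_rate hM hn ω i
  have hc := hS.isClockedPath_A hM hn hB hh.le huh ω i
  have hl := hB.l_pos
  have hl1 := hB.l_le
  have hint : ∀ (f : Fin K → ℝ) (a b : ℝ), a ≤ b →
      IntervalIntegrable (fun y : ℝ => f (S.J y.toNNReal ω)) volume a b := by
    intro f a b hab
    obtain ⟨B, hB⟩ := Finite.exists_le fun k => |f k|
    exact intervalIntegrable_of_abs_le (B := B) (hS.measurable_J_path f ω) hab fun y _ => hB _
  -- the windows are all active since the arrival clock keeps running
  have hact : IsClockedPath.IsActive n h (l ^ 2 * h / 16) (fun v => S.Astar i v ω)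
      (fun t => S.clockA M n i t.toNNReal ω) k := by
    refine Or.inr (Or.inr ?_)
    have e1 : (k : ℝ) * h ≤ (k + 1 : ℕ) * h := by rw [hkk]; linarith
    have e2 := hc.mono_A (hc.mono_Θ e1)
    have e3 := coe_toNNReal_timeIntegral_sub h1 h2 h3 hk0 e1
    have e4 : l * n * h ≤ ∫ y in ((k : ℝ) * h)..((k + 1 : ℕ) * h), M.lamn n i (S.J y.toNNReal ω) := by
      have := intervalIntegral.integral_mono_on e1
        (by simp : IntervalIntegrable (fun _ => l * (n : ℝ)) volume _ _) (hint _ _ _ e1)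
        fun y _ => hB.le_lamn i (S.J y.toNNReal ω)
      rw [intervalIntegral.integral_const, smul_eq_mul] at this
      calc l * n * h = ((k + 1 : ℕ) * h - k * h) * (l * n) := by rw [hkk]; ring
        _ ≤ _ := this
    have e5 : (S.Astar i (S.clockA M n i (k * h : ℝ).toNNReal ω) ω : ℝ) ≤
        S.Astar i (S.clockA M n i (((k + 1 : ℕ) : ℝ) * h).toNNReal ω) ω := by exact_mod_cast e2
    have e6 : l ^ 2 * h / 16 * n ≤ l * n * h := by
      have : 0 < l * n * h := by positivity
      nlinarith
    simp only [IsClockedPath.progress]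
    simp only [clockA] at e5 ⊢
    linarith
  have hnoise := hc.abs_sub_le k ht htt ht'
  have hnoise_eq : S.noiseA M n h (l ^ 2 * h / 16) ω i k = 2 *
      (IsUnitPoisson.cellDev (S.Astar i) n (IsClockedPath.cellAt n h
        (fun t => S.clockA M n i t.toNNReal ω) k) ω + IsUnitPoisson.cellDev (S.Astar i) n
        (IsClockedPath.cellAt n h (fun t => S.clockA M n i t.toNNReal ω) k + 1) ω) := by
    rw [noiseA, IsClockedPath.noise, if_pos hact]
  rw [← hnoise_eq] at hnoise
  have hnoise0 : 0 ≤ S.noiseA M n h (l ^ 2 * h / 16) ω i k := hc.noise_nonneg _ k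
  have hclock : (S.clockA M n i t'.toNNReal ω : ℝ) - S.clockA M n i t.toNNReal ω =
      ∫ y in t..t', M.lamn n i (S.J y.toNNReal ω) :=
    coe_toNNReal_timeIntegral_sub h1 h2 h3 ht0 htt
  rw [hclock] at hnoise
  have hsqrt : (n : ℝ) ^ (-M.β) * √n ≤ 1 := by
    rw [Real.sqrt_eq_rpow, ← Real.rpow_add hn0]
    exact Real.rpow_le_one_of_one_le_of_nonpos hn1 (by linarith [M.half_le_β])
  have hN1 : |(n : ℝ) ^ (-M.β) * ((S.arr M n i t'.toNNReal ω : ℝ) - S.arr M n i t.toNNReal ω -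
      ∫ y in t..t', M.lamn n i (S.J y.toNNReal ω))| ≤ S.noiseA M n h (l ^ 2 * h / 16) ω i k := by
    rw [abs_mul, abs_of_pos hp]
    calc _ ≤ (n : ℝ) ^ (-M.β) * (√n * S.noiseA M n h (l ^ 2 * h / 16) ω i k) := by
          gcongr
          exact hnoise
      _ = ((n : ℝ) ^ (-M.β) * √n) * S.noiseA M n h (l ^ 2 * h / 16) ω i k := by ring
      _ ≤ _ := mul_le_of_le_one_left hnoise0 hsqrt
  -- the compensator, split into drift and environment
  set δ : Fin K → ℝ := fun k => (n : ℝ) ^ (-M.β) * (M.lamn n i k - n * M.lam i k) -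
    M.ρ i * ((n : ℝ) ^ (1 - M.β) * (M.mun n i k - M.mu i k)) with hδ
  have hN2 : |∫ y in t..t', δ (S.J y.toNNReal ω)| ≤ D := by
    have := intervalIntegral.norm_integral_le_of_norm_le_const
      (f := fun y : ℝ => δ (S.J y.toNNReal ω)) (a := t) (b := t') (C := D)
      fun y _ => hB.drift i (S.J y.toNNReal ω)
    rw [Real.norm_eq_abs, abs_of_nonneg (sub_nonneg.2 htt)] at this
    refine this.trans (mul_le_of_le_one_right hB.D_nonneg ?_)
    linarith
  set e : Fin K → ℝ := fun k => M.lam i k - M.ρ i * M.mu i k with he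
  have hN3 : |(n : ℝ) ^ (1 - M.β) * ∫ y in t..t', e (S.J y.toNNReal ω)| ≤ 2 * W := by
    have e1 := hW t ht (by linarith)
    have e2 := hW t' (ht.trans htt) (by linarith)
    have e3 := intervalIntegral.integral_add_adjacent_intervals (hint e _ _ ht) (hint e _ _ htt)
    have e4 : (n : ℝ) ^ (1 - M.β) * ∫ y in t..t', e (S.J y.toNNReal ω) =
        (n : ℝ) ^ (1 - M.β) * (∫ y in (k * h : ℝ)..t', e (S.J y.toNNReal ω)) -
        (n : ℝ) ^ (1 - M.β) * (∫ y in (k * h : ℝ)..t, e (S.J y.toNNReal ω)) := by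
      rw [← e3]; ring
    rw [e4]
    have := abs_sub ((n : ℝ) ^ (1 - M.β) * (∫ y in (k * h : ℝ)..t', e (S.J y.toNNReal ω)))
      ((n : ℝ) ^ (1 - M.β) * (∫ y in (k * h : ℝ)..t, e (S.J y.toNNReal ω)))
    linarith
  have hsplit : S.arrPath M n ω i t' - S.arrPath M n ω i t -
      M.ρ i * (n : ℝ) ^ (1 - M.β) * ∫ y in t..t', S.muPath M n ω i y =
      (n : ℝ) ^ (-M.β) * ((S.arr M n i t'.toNNReal ω : ℝ) - S.arr M n i t.toNNReal ω -
        ∫ y in t..t', M.lamn n i (S.J y.toNNReal ω)) +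
      (∫ y in t..t', δ (S.J y.toNNReal ω)) +
      (n : ℝ) ^ (1 - M.β) * ∫ y in t..t', e (S.J y.toNNReal ω) := by
    have e1 : (n : ℝ) ^ (-M.β) * (∫ y in t..t', M.lamn n i (S.J y.toNNReal ω)) -
        M.ρ i * (n : ℝ) ^ (1 - M.β) * ∫ y in t..t', S.muPath M n ω i y =
        (∫ y in t..t', δ (S.J y.toNNReal ω)) +
        (n : ℝ) ^ (1 - M.β) * ∫ y in t..t', e (S.J y.toNNReal ω) := by
      simp only [muPath]
      rw [← intervalIntegral.integral_const_mul, ← intervalIntegral.integral_const_mul,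
        ← intervalIntegral.integral_const_mul, ← intervalIntegral.integral_sub
          ((hint (M.lamn n i) _ _ htt).const_mul _)
          (((hint (M.mun n i) _ _ htt).const_mul _)),
        ← intervalIntegral.integral_add (hint δ _ _ htt) ((hint e _ _ htt).const_mul _)]
      refine intervalIntegral.integral_congr fun y _ => ?_
      simp only [hδ, he, ← rpow_one_sub_β M hn]
      ring
    rw [arrPath, arrPath]
    linarith
  rw [hsplit]
  have a1 := abs_add_le ((n : ℝ) ^ (-M.β) * ((S.arr M n i t'.toNNReal ω : ℝ) -
    S.arr M n i t.toNNReal ω - ∫ y in t..t', M.lamn n i (S.J y.toNNReal ω)) +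
      ∫ y in t..t', δ (S.J y.toNNReal ω))
      ((n : ℝ) ^ (1 - M.β) * ∫ y in t..t', e (S.J y.toNNReal ω))
  have a2 := abs_add_le ((n : ℝ) ^ (-M.β) * ((S.arr M n i t'.toNNReal ω : ℝ) -
    S.arr M n i t.toNNReal ω - ∫ y in t..t', M.lamn n i (S.J y.toNNReal ω)))
      (∫ y in t..t', δ (S.J y.toNNReal ω))
  linarith

/-- In every window either the services follow their compensator up to the noise, or both are small
in the window and the one before. -/
lemma IsModel.abs_srv_sub_le_or [MeasurableSpace Ω] {P : Measure Ω} (hS : S.IsModel M n P)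
    (hM : M.IsAveragedHW) (hn : 1 ≤ n) {l u D h : ℝ} (hB : M.RateBounds n l u D) (hh : 0 < h)
    (huh : u * h ≤ 1) {ω : Ω} (H : S.IsRegularPath M n ω) (i : Fin d) (k : ℕ) :
    (∀ t t', k * h ≤ t → t ≤ t' → t' ≤ (k + 1 : ℕ) * h →
      |S.srvPath M n ω i t' - S.srvPath M n ω i t - ∫ y in t..t', S.muPath M n ω i y *
        (M.ρ i * (n : ℝ) ^ (1 - M.β) + S.xPath M n ω i y - S.qPath M n ω i y)| ≤
      S.noiseS M n h (l ^ 2 * h / 16) ω i k) ∨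
    (1 ≤ k ∧ S.srvPath M n ω i ((k + 1 : ℕ) * h) - S.srvPath M n ω i ((k - 1 : ℕ) * h) ≤
        l ^ 2 * h / 8 * (n : ℝ) ^ (1 - M.β) ∧
      ∫ y in ((k - 1 : ℕ) * h : ℝ)..((k + 1 : ℕ) * h), S.muPath M n ω i y *
        (M.ρ i * (n : ℝ) ^ (1 - M.β) + S.xPath M n ω i y - S.qPath M n ω i y) ≤
        l ^ 2 * h / 8 * (n : ℝ) ^ (1 - M.β)) := by
  have hn1 : (1 : ℝ) ≤ n := by exact_mod_cast hn
  have hn0 : (0 : ℝ) < n := by linarith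
  have hp : 0 < (n : ℝ) ^ (-M.β) := Real.rpow_pos_of_pos hn0 _
  obtain ⟨h1, h2, h3⟩ := hS.clockS_rate hM hn H i
  have hc := hS.isClockedPath_S hM hn hB hh.le huh H i
  have hcomp : ∀ t t' : ℝ, 0 ≤ t → t ≤ t' → ∫ y in t..t', S.muPath M n ω i y *
        (M.ρ i * (n : ℝ) ^ (1 - M.β) + S.xPath M n ω i y - S.qPath M n ω i y) =
      (n : ℝ) ^ (-M.β) * ((S.clockS M n i t'.toNNReal ω : ℝ) - S.clockS M n i t.toNNReal ω) := by
    intro t t' ht htt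
    have e1 : (S.clockS M n i t'.toNNReal ω : ℝ) - S.clockS M n i t.toNNReal ω =
        ∫ y in t..t', M.mun n i (S.J y.toNNReal ω) * S.Z y.toNNReal ω i :=
      coe_toNNReal_timeIntegral_sub h1 h2 h3 ht htt
    rw [e1, ← intervalIntegral.integral_const_mul]
    refine intervalIntegral.integral_congr fun y _ => ?_
    simp only [z_eq M hn, muPath]
    ring
  have hk0 : 0 ≤ (k : ℝ) * h := by positivity
  by_cases hact : IsClockedPath.IsActive n h (l ^ 2 * h / 16) (fun v => S.Sstar i v ω)
      (fun t => S.clockS M n i t.toNNReal ω) k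
  · left
    intro t t' ht htt ht'
    have hnoise := hc.abs_sub_le k ht htt ht'
    have hnoise_eq : S.noiseS M n h (l ^ 2 * h / 16) ω i k = 2 *
        (IsUnitPoisson.cellDev (S.Sstar i) n (IsClockedPath.cellAt n h
          (fun t => S.clockS M n i t.toNNReal ω) k) ω + IsUnitPoisson.cellDev (S.Sstar i) n
          (IsClockedPath.cellAt n h (fun t => S.clockS M n i t.toNNReal ω) k + 1) ω) := by
      rw [noiseS, IsClockedPath.noise, if_pos hact]
    rw [← hnoise_eq] at hnoise
    have hnoise0 : 0 ≤ S.noiseS M n h (l ^ 2 * h / 16) ω i k := hc.noise_nonneg _ k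
    have hsqrt : (n : ℝ) ^ (-M.β) * √n ≤ 1 := by
      rw [Real.sqrt_eq_rpow, ← Real.rpow_add hn0]
      exact Real.rpow_le_one_of_one_le_of_nonpos hn1 (by linarith [M.half_le_β])
    rw [hcomp t t' (hk0.trans ht) htt, srvPath, srvPath, ← mul_sub, ← mul_sub, abs_mul,
      abs_of_pos hp]
    calc _ ≤ (n : ℝ) ^ (-M.β) * (√n * S.noiseS M n h (l ^ 2 * h / 16) ω i k) := by
          gcongr
          exact hnoise
      _ = ((n : ℝ) ^ (-M.β) * √n) * S.noiseS M n h (l ^ 2 * h / 16) ω i k := by ring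
      _ ≤ _ := mul_le_of_le_one_left hnoise0 hsqrt
  · right
    simp only [IsClockedPath.IsActive, not_or, not_le, IsClockedPath.progress] at hact
    obtain ⟨a1, a2, a3⟩ := hact
    have hk1 : 1 ≤ k := by omega
    have e1 : ((k - 1 : ℕ) : ℝ) * h ≤ (k + 1 : ℕ) * h := by gcongr; omega
    have hk2 : 0 ≤ ((k - 1 : ℕ) : ℝ) * h := by positivity
    have e2 : (S.Sstar i (S.clockS M n i (((k - 1 : ℕ) : ℝ) * h).toNNReal ω) ω : ℝ) ≤
        S.Sstar i (S.clockS M n i (((k + 1 : ℕ) : ℝ) * h).toNNReal ω) ω := by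
      exact_mod_cast hc.mono_A (hc.mono_Θ e1)
    have e3 : (S.clockS M n i (((k - 1 : ℕ) : ℝ) * h).toNNReal ω : ℝ) ≤
        S.clockS M n i (((k + 1 : ℕ) : ℝ) * h).toNNReal ω := by
      exact_mod_cast hc.mono_Θ e1
    have e4 : l ^ 2 * h / 8 * (n : ℝ) ^ (1 - M.β) = (n : ℝ) ^ (-M.β) * (l ^ 2 * h / 8 * n) := by
      rw [← rpow_one_sub_β M hn]; ring
    refine ⟨hk1, ?_, ?_⟩
    · rw [e4, srvPath, srvPath, ← mul_sub, srv, srv]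
      gcongr
      linarith
    · rw [e4, hcomp _ _ hk2 e1]
      gcongr
      linarith

end QueueProcesses

/-! ### The pathwise estimate -/

lemma sum_pred_le {y : ℕ → ℝ} (hy : ∀ k, 0 ≤ y k) (K : ℕ) :
    ∑ k ∈ Finset.range K, y (k - 1) ≤ 2 * ∑ k ∈ Finset.range K, y k := by
  rcases Nat.eq_zero_or_pos K with rfl | hK
  · simp
  obtain ⟨L, rfl⟩ : ∃ L, K = L + 1 := ⟨K - 1, by omega⟩
  have h0 : y 0 ≤ ∑ k ∈ Finset.range (L + 1), y k :=
    Finset.single_le_sum (fun k _ => hy k) (Finset.mem_range.2 (by omega))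
  rw [Finset.sum_range_succ' fun k => y (k - 1)]
  simp only [Nat.add_sub_cancel, Nat.zero_sub]
  have h1 : ∑ k ∈ Finset.range (L + 1), y k = ∑ k ∈ Finset.range L, y k + y L :=
    Finset.sum_range_succ _ _
  linarith [hy L]

lemma add_four_rpow_le {a b c e m : ℝ} (ha : 0 ≤ a) (hb : 0 ≤ b) (hc : 0 ≤ c) (he : 0 ≤ e)
    (hm : 0 ≤ m) : (a + b + (2 * c + e)) ^ m ≤
      2 ^ m * (2 ^ m * (2 ^ m * (a ^ m + b ^ m + c ^ m + e ^ m))) := by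
  have h2 : (1 : ℝ) ≤ 2 ^ m := Real.one_le_rpow (by norm_num) hm
  have hc2 : 0 ≤ 2 * c := by linarith
  refine (add_rpow_le (add_nonneg ha hb) (add_nonneg hc2 he) hm).trans ?_
  gcongr
  calc (a + b) ^ m + (2 * c + e) ^ m ≤ 2 ^ m * (a ^ m + b ^ m) + 2 ^ m * ((2 * c) ^ m + e ^ m) :=
        add_le_add (add_rpow_le ha hb hm) (add_rpow_le hc2 he hm)
    _ = 2 ^ m * (a ^ m + b ^ m + (2 * c) ^ m + e ^ m) := by ring
    _ ≤ _ := by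
        rw [Real.mul_rpow (by norm_num) hc]
        have h3 := Real.rpow_nonneg ha m
        have h4 := Real.rpow_nonneg hb m
        have h5 := Real.rpow_nonneg he m
        gcongr
        nlinarith

/-- Sums of powers of errors which combine, for two consecutive windows, several classes of four
terms each. -/
lemma exists_sum_error_rpow_le (d : ℕ) {D m : ℝ} (hD : 0 ≤ D) (hm : 1 ≤ m) : ∃ C : ℝ, 0 ≤ C ∧
    ∀ a b c e : Fin d → ℕ → ℝ, (∀ i k, 0 ≤ a i k) → (∀ i k, 0 ≤ b i k) → (∀ i k, 0 ≤ c i k) →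
      (∀ i k, 0 ≤ e i k) → ∀ v : ℕ → ℝ, (∀ k, v k = ∑ i, (a i k + b i k + (2 * c i k + e i k)) + D) →
      ∀ K : ℕ, ∑ k ∈ Finset.range K, (v (k - 1) + v k + 1) ^ m ≤ C * (K + ∑ i,
        ∑ k ∈ Finset.range K, (a i k ^ m + b i k ^ m + c i k ^ m + e i k ^ m)) := by
  have hm0 : 0 ≤ m := by linarith
  set B : ℝ := (d : ℝ) ^ (m - 1) * (2 ^ m * (2 ^ m * 2 ^ m)) with hB
  have hB0 : 0 ≤ B := by positivity
  refine ⟨2 ^ m * (2 ^ m * (3 * B)) + 2 ^ m * (2 * D + 1) ^ m, by positivity, ?_⟩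
  intro a b c e ha hb hc he v hv K
  set y : ℕ → Fin d → ℝ := fun k i => a i k + b i k + (2 * c i k + e i k) with hy
  have hy0 : ∀ k i, 0 ≤ y k i := fun k i => by
    simp only [hy]; linarith [ha i k, hb i k, hc i k, he i k]
  set z : ℕ → ℝ := fun k => ∑ i, (a i k ^ m + b i k ^ m + c i k ^ m + e i k ^ m) with hz
  have hz0 : ∀ k, 0 ≤ z k := fun k => Finset.sum_nonneg fun i _ => by
    linarith [Real.rpow_nonneg (ha i k) m, Real.rpow_nonneg (hb i k) m,
      Real.rpow_nonneg (hc i k) m, Real.rpow_nonneg (he i k) m]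
  have hs0 : ∀ k, 0 ≤ ∑ i, y k i := fun k => Finset.sum_nonneg fun i _ => hy0 k i
  have hyz : ∀ k, (∑ i, y k i) ^ m ≤ B * z k := by
    intro k
    have h1 := Real.rpow_sum_le_const_mul_sum_rpow_of_nonneg Finset.univ hm
      (f := y k) fun i _ => hy0 k i
    rw [Finset.card_univ, Fintype.card_fin] at h1
    refine h1.trans ?_
    rw [hB, mul_assoc]
    gcongr
    rw [hz, Finset.mul_sum]
    refine Finset.sum_le_sum fun i _ => ?_
    refine (add_four_rpow_le (ha i k) (hb i k) (hc i k) (he i k) hm0).trans (le_of_eq ?_)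
    ring
  have hterm : ∀ k, (v (k - 1) + v k + 1) ^ m ≤
      2 ^ m * (2 ^ m * (B * z (k - 1) + B * z k)) + 2 ^ m * (2 * D + 1) ^ m := by
    intro k
    have h1 : v (k - 1) + v k + 1 = (∑ i, y (k - 1) i + ∑ i, y k i) + (2 * D + 1) := by
      rw [hv, hv]; ring
    rw [h1]
    refine (add_rpow_le (add_nonneg (hs0 _) (hs0 _)) (by linarith) hm0).trans ?_
    rw [mul_add]
    gcongr
    refine (add_rpow_le (hs0 _) (hs0 _) hm0).trans ?_
    gcongr
    · exact hyz _
    · exact hyz _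
  refine (Finset.sum_le_sum fun k _ => hterm k).trans ?_
  rw [Finset.sum_add_distrib, ← Finset.mul_sum, ← Finset.mul_sum, Finset.sum_add_distrib,
    ← Finset.mul_sum, ← Finset.mul_sum, Finset.sum_const, Finset.card_range, nsmul_eq_mul,
    show ∑ i, ∑ k ∈ Finset.range K, (a i k ^ m + b i k ^ m + c i k ^ m + e i k ^ m) =
      ∑ k ∈ Finset.range K, z k from Finset.sum_comm]
  have h1 := sum_pred_le hz0 K
  have h2 : 0 ≤ ∑ k ∈ Finset.range K, z k := Finset.sum_nonneg fun k _ => hz0 k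
  have h3 : (2 : ℝ) ^ m * (2 ^ m * (B * ∑ k ∈ Finset.range K, z (k - 1) +
      B * ∑ k ∈ Finset.range K, z k)) ≤ 2 ^ m * (2 ^ m * (3 * B)) * ∑ k ∈ Finset.range K, z k := by
    calc _ ≤ (2 : ℝ) ^ m * (2 ^ m * (B * (2 * ∑ k ∈ Finset.range K, z k) +
          B * ∑ k ∈ Finset.range K, z k)) := by gcongr
      _ = _ := by ring
  have h4 : 0 ≤ (2 : ℝ) ^ m * (2 * D + 1) ^ m := by positivity
  have h5 : 0 ≤ (2 : ℝ) ^ m * (2 ^ m * (3 * B)) := by positivity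
  have h6 : (0 : ℝ) ≤ K := Nat.cast_nonneg _
  have h7 := mul_nonneg h4 h2
  have h8 := mul_nonneg h5 h6
  nlinarith

/-- Jensen's inequality on an interval of length at most one. -/
lemma ofReal_integral_rpow_le {f : ℝ → ℝ} {a b m : ℝ} (hf : Measurable f) (h0 : ∀ y, 0 ≤ f y)
    (hab : a ≤ b) (hb1 : b ≤ a + 1) (hint : IntervalIntegrable f volume a b) (hm : 1 ≤ m) :
    ENNReal.ofReal ((∫ y in a..b, f y) ^ m) ≤ ∫⁻ y in Set.Ioc a b, ENNReal.ofReal (f y ^ m) := by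
  have hm0 : 0 < m := by linarith
  set μ := volume.restrict (Set.Ioc a b) with hμ
  have h1 : ENNReal.ofReal (∫ y in a..b, f y) = ∫⁻ y, ENNReal.ofReal (f y) ∂μ := by
    rw [intervalIntegral.integral_of_le hab]
    exact ofReal_integral_eq_lintegral_ofReal
      ((intervalIntegrable_iff_integrableOn_Ioc_of_le hab).1 hint) (Eventually.of_forall h0)
  have h2 := eLpNorm'_le_eLpNorm'_mul_rpow_measure_univ (f := f) (μ := μ) one_pos hm
    hf.aestronglyMeasurable
  have h3 : μ Set.univ ^ (1 / (1 : ℝ) - 1 / m) ≤ 1 := by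
    refine ENNReal.rpow_le_one ?_ ?_
    · rw [hμ, Measure.restrict_apply_univ, Real.volume_Ioc]
      exact ENNReal.ofReal_le_one.2 (by linarith)
    · rw [sub_nonneg, one_div_one, div_le_one hm0]; exact hm
  have hnorm : ∀ y, ‖f y‖ₑ = ENNReal.ofReal (f y) := fun y => by
    rw [Real.enorm_eq_ofReal (h0 y)]
  have h4 : ∫⁻ y, ENNReal.ofReal (f y) ∂μ ≤ (∫⁻ y, ENNReal.ofReal (f y) ^ m ∂μ) ^ (1 / m) := by
    have := h2.trans (mul_le_of_le_one_right' h3)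
    simpa [eLpNorm', hnorm] using this
  rw [← ENNReal.ofReal_rpow_of_nonneg (intervalIntegral.integral_nonneg hab fun y _ => h0 y) hm0.le,
    h1]
  calc _ ≤ ((∫⁻ y, ENNReal.ofReal (f y) ^ m ∂μ) ^ (1 / m)) ^ m := by gcongr
    _ = ∫⁻ y, ENNReal.ofReal (f y) ^ m ∂μ := by
        rw [← ENNReal.rpow_mul, one_div_mul_cancel hm0.ne', ENNReal.rpow_one]
    _ = _ := lintegral_congr fun y => ENNReal.ofReal_rpow_of_nonneg (h0 y) hm0.le

lemma setLIntegral_Ioc_succ {h : ℝ} (hh : 0 ≤ h) (F : ℝ → ℝ≥0∞) (K : ℕ) :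
    ∫⁻ s in Set.Ioc 0 ((K + 1 : ℕ) * h), F s =
      (∫⁻ s in Set.Ioc 0 (K * h), F s) + ∫⁻ s in Set.Ioc (K * h) ((K + 1 : ℕ) * h), F s := by
  have h1 : (K : ℝ) * h ≤ (K + 1 : ℕ) * h := by gcongr; omega
  have h2 : 0 ≤ (K : ℝ) * h := by positivity
  rw [← Set.Ioc_union_Ioc_eq_Ioc h2 h1, lintegral_union measurableSet_Ioc]
  exact Set.Ioc_disjoint_Ioc_of_le le_rfl

lemma setLIntegral_Ioc_eq_sum {h : ℝ} (hh : 0 ≤ h) (F : ℝ → ℝ≥0∞) (K : ℕ) :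
    ∫⁻ s in Set.Ioc 0 (K * h), F s =
      ∑ k ∈ Finset.range K, ∫⁻ s in Set.Ioc (k * h) ((k + 1 : ℕ) * h), F s := by
  induction K with
  | zero => simp
  | succ K ih => rw [setLIntegral_Ioc_succ hh, ih, Finset.sum_range_succ]

lemma euclidean_norm_le_sum_abs {d : ℕ} (x : Fin d → ℝ) :
    ‖(WithLp.toLp 2 x : EuclideanSpace ℝ (Fin d))‖ ≤ ∑ i, |x i| := by
  rw [EuclideanSpace.norm_eq]
  refine Real.sqrt_le_iff.2 ⟨Finset.sum_nonneg fun i _ => abs_nonneg _, ?_⟩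
  exact Finset.sum_sq_le_sq_sum_of_nonneg fun i _ => abs_nonneg _

namespace QueueProcesses

variable {Ω : Type*} {d K : ℕ} {S : QueueProcesses Ω d K} {M : ModelParams d K} {n : ℕ}

/-- The total error of window `k`, where `W` bounds the effect of the environment. The threshold
`l ^ 2 * h / 16` for activity makes the progress of an inactive class over two windows at most the
`l ^ 2 * h / 8 * N` of `IsControlledWindow`. -/
noncomputable def windowError (S : QueueProcesses Ω d K) (M : ModelParams d K) (n : ℕ)
    (l h D : ℝ) (W : Fin d → ℕ → ℝ) (ω : Ω) (k : ℕ) : ℝ :=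
  ∑ i, (S.noiseA M n h (l ^ 2 * h / 16) ω i k + S.noiseS M n h (l ^ 2 * h / 16) ω i k +
    (2 * W i k + ∫ y in (k * h : ℝ)..((k + 1 : ℕ) * h), S.qPath M n ω i y)) + D

lemma qPath_nonneg (ω : Ω) (i : Fin d) (t : ℝ) : 0 ≤ S.qPath M n ω i t :=
  mul_nonneg (Real.rpow_nonneg (Nat.cast_nonneg _) _) (Nat.cast_nonneg _)

lemma integral_qPath_nonneg {h : ℝ} (hh : 0 ≤ h) (ω : Ω) (i : Fin d) (k : ℕ) :
    0 ≤ ∫ y in (k * h : ℝ)..((k + 1 : ℕ) * h), S.qPath M n ω i y :=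
  intervalIntegral.integral_nonneg (by gcongr; omega) fun y _ => qPath_nonneg ω i y

variable [MeasurableSpace Ω] {P : Measure Ω} {l u D h : ℝ} {ω : Ω} {W : Fin d → ℕ → ℝ}

lemma IsModel.noiseA_nonneg (hS : S.IsModel M n P) (hM : M.IsAveragedHW) (hn : 1 ≤ n)
    (hB : M.RateBounds n l u D) (hh : 0 ≤ h) (huh : u * h ≤ 1) (c : ℝ) (ω : Ω) (i : Fin d) (k : ℕ) :
    0 ≤ S.noiseA M n h c ω i k := (hS.isClockedPath_A hM hn hB hh huh ω i).noise_nonneg _ k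

lemma IsModel.noiseS_nonneg (hS : S.IsModel M n P) (hM : M.IsAveragedHW) (hn : 1 ≤ n)
    (hB : M.RateBounds n l u D) (hh : 0 ≤ h) (huh : u * h ≤ 1) (H : S.IsRegularPath M n ω) (c : ℝ)
    (i : Fin d) (k : ℕ) :
    0 ≤ S.noiseS M n h c ω i k := (hS.isClockedPath_S hM hn hB hh huh H i).noise_nonneg _ k

lemma IsModel.le_windowError (hS : S.IsModel M n P) (hM : M.IsAveragedHW) (hn : 1 ≤ n)
    (hB : M.RateBounds n l u D) (hh : 0 ≤ h) (huh : u * h ≤ 1) (H : S.IsRegularPath M n ω)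
    (hW0 : ∀ i k, 0 ≤ W i k) (i : Fin d) (k : ℕ) :
    S.noiseA M n h (l ^ 2 * h / 16) ω i k + S.noiseS M n h (l ^ 2 * h / 16) ω i k +
    (2 * W i k + ∫ y in (k * h : ℝ)..((k + 1 : ℕ) * h), S.qPath M n ω i y) + D ≤
      S.windowError M n l h D W ω k := by
  unfold windowError
  gcongr
  refine Finset.single_le_sum (f := fun i => S.noiseA M n h (l ^ 2 * h / 16) ω i k +
    S.noiseS M n h (l ^ 2 * h / 16) ω i k +
    (2 * W i k + ∫ y in (k * h : ℝ)..((k + 1 : ℕ) * h), S.qPath M n ω i y)) (fun j _ => ?_)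
    (Finset.mem_univ i)
  have h1 := hS.noiseA_nonneg hM hn hB hh huh (l ^ 2 * h / 16) ω j k
  have h2 := hS.noiseS_nonneg hM hn hB hh huh H (l ^ 2 * h / 16) j k
  have h3 := hW0 j k
  have h4 := integral_qPath_nonneg (S := S) (M := M) (n := n) hh ω j k
  positivity

lemma IsModel.windowError_nonneg (hS : S.IsModel M n P) (hM : M.IsAveragedHW) (hn : 1 ≤ n)
    (hB : M.RateBounds n l u D) (hh : 0 ≤ h) (huh : u * h ≤ 1) (H : S.IsRegularPath M n ω)
    (hW0 : ∀ i k, 0 ≤ W i k) (k : ℕ) : 0 ≤ S.windowError M n l h D W ω k := by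
  refine add_nonneg (Finset.sum_nonneg fun i _ => ?_) hB.D_nonneg
  have h1 := hS.noiseA_nonneg hM hn hB hh huh (l ^ 2 * h / 16) ω i k
  have h2 := hS.noiseS_nonneg hM hn hB hh huh H (l ^ 2 * h / 16) i k
  have h3 := hW0 i k
  have h4 := integral_qPath_nonneg (S := S) (M := M) (n := n) hh ω i k
  positivity

lemma IsModel.isControlledWindow (hS : S.IsModel M n P) (hM : M.IsAveragedHW) (hn : 1 ≤ n)
    (hB : M.RateBounds n l u D) (hh : 0 < h) (huh : u * h ≤ 1 / 8) (hh1 : h ≤ 1)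
    (H : S.IsRegularPath M n ω) (hW0 : ∀ i k, 0 ≤ W i k)
    (hW : ∀ i (k : ℕ) (r : ℝ), k * h ≤ r → r ≤ k * h + h →
      |(n : ℝ) ^ (1 - M.β) * ∫ y in (k * h : ℝ)..r, (M.lam i (S.J y.toNNReal ω) -
        M.ρ i * M.mu i (S.J y.toNNReal ω))| ≤ W i k) (k : ℕ) :
    IsControlledWindow ((n : ℝ) ^ (1 - M.β)) l u M.ρ (S.muPath M n ω) (S.xPath M n ω)
      (S.qPath M n ω) (S.arrPath M n ω) (S.srvPath M n ω) h ((k - 1 : ℕ) * h) (k * h)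
      (S.windowError M n l h D W ω (k - 1) + S.windowError M n l h D W ω k) := by
  have huh1 : u * h ≤ 1 := by linarith
  have hP := hS.isScaledPath hM hn hB H
  have hv0 := hS.windowError_nonneg hM hn hB hh.le huh1 H hW0
  have hnA := fun i k => hS.noiseA_nonneg hM hn hB hh.le huh1 (l ^ 2 * h / 16) ω i k
  have hnS := fun i k => hS.noiseS_nonneg hM hn hB hh.le huh1 H (l ^ 2 * h / 16) i k
  have hq0 := fun i k => integral_qPath_nonneg (S := S) (M := M) (n := n) hh.le ω i k
  have hle := fun i k => hS.le_windowError hM hn hB hh.le huh1 H hW0 i k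
  have hkk : (k : ℝ) * h + h = ((k + 1 : ℕ) : ℝ) * h := by push_cast; ring
  have hb0 : 0 ≤ ((k - 1 : ℕ) : ℝ) * h := by positivity
  have hbk : ((k - 1 : ℕ) : ℝ) * h ≤ k * h := by gcongr; omega
  have hkh : (k : ℝ) * h ≤ (k + 1 : ℕ) * h := by gcongr; omega
  have hD := hB.D_nonneg
  have harr : ∀ i (j : ℕ) t t', j * h ≤ t → t ≤ t' → t' ≤ (j + 1 : ℕ) * h →
      |S.arrPath M n ω i t' - S.arrPath M n ω i t -
        M.ρ i * (n : ℝ) ^ (1 - M.β) * ∫ y in t..t', S.muPath M n ω i y| ≤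
      S.windowError M n l h D W ω j := fun i j t t' h1 h2 h3 => by
    have := hS.abs_arr_sub_le hM hn hB hh huh1 hh1 i j (hW i j) h1 h2 h3
    linarith [hle i j, hnS i j, hq0 i j]
  have hqv : ∀ i (j : ℕ), ∫ y in (j * h : ℝ)..((j + 1 : ℕ) * h), S.qPath M n ω i y ≤
      S.windowError M n l h D W ω j := fun i j => by
    linarith [hle i j, hnA i j, hnS i j, hW0 i j]
  have hpred : k ≠ 0 → k - 1 + 1 = k := fun h => Nat.succ_pred_eq_of_ne_zero h
  exact
    { h_pos := hh
      h_le := huh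
      b_nonneg := hb0
      b_le := hbk
      arrivals := fun i t t' ht htt ht' => by
        rw [hkk] at ht'
        rcases Nat.eq_zero_or_pos k with rfl | hk
        · exact (harr i 0 t t' (by simpa using ht) htt ht').trans (by linarith [hv0 (0 - 1)])
        · have h2 : ∀ t t', ((k - 1 : ℕ) : ℝ) * h ≤ t → t ≤ t' → t' ≤ k * h → _ :=
            fun t t' h1 h2 h3 => harr i (k - 1) t t' h1 h2 (by rwa [hpred hk.ne'])
          rcases le_total t' (k * h) with h3 | h3
          · exact (h2 t t' ht htt h3).trans (by linarith [hv0 k])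
          rcases le_total (k * h) t with h4 | h4
          · exact (harr i k t t' h4 htt ht').trans (by linarith [hv0 (k - 1)])
          have e1 := h2 t (k * h) ht h4 le_rfl
          have e2 := harr i k (k * h) t' le_rfl h3 ht'
          have e3 := intervalIntegral.integral_add_adjacent_intervals (hP.int_μ i h4)
            (hP.int_μ i h3)
          rw [← e3]
          rw [abs_le] at e1 e2 ⊢
          constructor <;> linarith [e1.1, e1.2, e2.1, e2.2]
      queues := fun i => by
        rw [hkk]
        rcases Nat.eq_zero_or_pos k with rfl | hk
        · exact (hqv i 0).trans (le_add_of_nonneg_left (hv0 _))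
        · have h2 := hqv i (k - 1)
          rw [hpred hk.ne'] at h2
          have e3 := intervalIntegral.integral_add_adjacent_intervals (hP.int_q i hb0 hbk)
            (hP.int_q i (hb0.trans hbk) hkh)
          rw [← e3]
          exact add_le_add h2 (hqv i k)
      services := fun i => by
        rw [hkk]
        rcases hS.abs_srv_sub_le_or hM hn hB hh huh1 H i k with h1 | ⟨hk, h2, h3⟩
        · refine Or.inl fun t t' ht htt ht' => (h1 t t' ht htt ht').trans ?_
          linarith [hle i k, hnA i k, hW0 i k, hq0 i k, hv0 (k - 1)]
        · refine Or.inr ⟨?_, h2, h3⟩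
          rw [Nat.cast_sub hk]
          push_cast
          ring }

/-- The pathwise estimate: over the first `k` windows, the centred numbers of customers are bounded by
the queues, up to the noise of the driving Poisson processes and of the environment. -/
lemma exists_pathwise_bound (d : ℕ) {l u D h m : ℝ} (hl : 0 < l) (hl1 : l ≤ 1) (hu : 1 ≤ u)
    (hD : 0 ≤ D) (hh : 0 < h) (hh1 : h ≤ 1) (huh : u * h ≤ 1 / 8) (hm : 1 ≤ m) {q : ℕ}
    (hq : m + 1 ≤ q) : ∃ C : ℝ≥0, ∀ {Ω : Type*} [MeasurableSpace Ω] {P : Measure Ω} {K n : ℕ}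
      {M : ModelParams d K} {S : QueueProcesses Ω d K} (_ : S.IsModel M n P) (_ : M.IsAveragedHW)
      (_ : 1 ≤ n) (_ : M.RateBounds n l u D) {ω : Ω} (_ : S.IsRegularPath M n ω)
      (W : Fin d → ℕ → ℝ) (_ : ∀ i k, 0 ≤ W i k)
      (_ : ∀ i (k : ℕ) (r : ℝ), k * h ≤ r → r ≤ k * h + h →
        |(n : ℝ) ^ (1 - M.β) * ∫ y in (k * h : ℝ)..r, (M.lam i (S.J y.toNNReal ω) -
          M.ρ i * M.mu i (S.J y.toNNReal ω))| ≤ W i k) (k : ℕ),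
      ∫⁻ s in Set.Ioc 0 (k * h), ENNReal.ofReal (‖S.XHat M n s.toNNReal ω‖ ^ m) ≤
        C * (ENNReal.ofReal ((∑ i, |S.xPath M n ω i 0|) ^ m) +
          (∑ i, ∫⁻ s in Set.Ioc 0 (k * h), ENNReal.ofReal (S.qPath M n ω i s ^ m)) + k +
          ∑ i, (∑ j ∈ Finset.range k, ENNReal.ofReal (W i j ^ q) +
            ∑ j ∈ Finset.range (k + 2),
              (ENNReal.ofReal (IsUnitPoisson.cellDev (S.Astar i) n j ω ^ q) +
              ENNReal.ofReal (IsUnitPoisson.cellDev (S.Sstar i) n j ω ^ q)))) := by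
  have hm0 : 0 < m := by linarith
  obtain ⟨C1, hC1, hctrl⟩ := exists_bound_of_controlled d hl hl1 hu hh hh1 hm
  obtain ⟨C2, hC2, herr⟩ := exists_sum_error_rpow_le d hD hm
  set c := l ^ 2 * h / 16 with hc
  have hc0 : 0 < c := by positivity
  set B : ℝ := 2 ^ m * ((6 / c + 3) * 3 ^ (q + 1)) with hBdef
  have hB0 : 0 ≤ B := by positivity
  set C : ℝ := C1 * (1 + C2 * (1 + d + 1 + B)) with hCdef
  have hC0 : 0 ≤ C := by positivity
  refine ⟨C.toNNReal, ?_⟩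
  intro Ω _ P K n M S hS hM hn hB ω H W hW0 hW k
  have huh1 : u * h ≤ 1 := by linarith
  have hP := hS.isScaledPath hM hn hB H
  obtain ⟨E, hE0, hE, hEsum⟩ := hctrl hP (ε := fun k => S.windowError M n l h D W ω (k - 1) +
    S.windowError M n l h D W ω k) (fun k => add_nonneg
      (hS.windowError_nonneg hM hn hB hh.le huh1 H hW0 _)
      (hS.windowError_nonneg hM hn hB hh.le huh1 H hW0 _))
    (hS.isControlledWindow hM hn hB hh huh hh1 H hW0 hW)
  set I : Fin d → ℕ → ℝ := fun i k => ∫ y in (k * h : ℝ)..((k + 1 : ℕ) * h), S.qPath M n ω i y with hI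
  have hI0 : ∀ i k, 0 ≤ I i k := fun i k => integral_qPath_nonneg hh.le ω i k
  have hsum := herr (fun i k => S.noiseA M n h c ω i k) (fun i k => S.noiseS M n h c ω i k) W I
    (hS.noiseA_nonneg hM hn hB hh.le huh1 c ω) (hS.noiseS_nonneg hM hn hB hh.le huh1 H c) hW0 hI0
    (S.windowError M n l h D W ω) (fun k => rfl) k
  set gA : Fin d → ℕ → ℝ := fun i j => IsUnitPoisson.cellDev (S.Astar i) n j ω ^ q with hgA
  set gS : Fin d → ℕ → ℝ := fun i j => IsUnitPoisson.cellDev (S.Sstar i) n j ω ^ q with hgS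
  have hgA0 : ∀ i j, 0 ≤ gA i j := fun i j =>
    pow_nonneg (by linarith [IsUnitPoisson.one_le_cellDev (S.Astar i) n j ω]) _
  have hgS0 : ∀ i j, 0 ≤ gS i j := fun i j =>
    pow_nonneg (by linarith [IsUnitPoisson.one_le_cellDev (S.Sstar i) n j ω]) _
  have hWq0 : ∀ i j, 0 ≤ W i j ^ q := fun i j => pow_nonneg (hW0 i j) _
  set X0 : ℝ := (∑ i, |S.xPath M n ω i 0|) ^ m with hX0
  have hX00 : 0 ≤ X0 := Real.rpow_nonneg (Finset.sum_nonneg fun i _ => abs_nonneg _) _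
  have hIm0 : ∀ i j, 0 ≤ I i j ^ m := fun i j => Real.rpow_nonneg (hI0 i j) _
  set Qs : ℝ := ∑ i, ∑ j ∈ Finset.range k, I i j ^ m with hQs
  set Ws : ℝ := ∑ i, ∑ j ∈ Finset.range k, W i j ^ q with hWs
  set Gs : ℝ := ∑ i, ∑ j ∈ Finset.range (k + 2), (gA i j + gS i j) with hGs
  have hQs0 : 0 ≤ Qs := Finset.sum_nonneg fun i _ => Finset.sum_nonneg fun j _ => hIm0 i j
  have hWs0 : 0 ≤ Ws := Finset.sum_nonneg fun i _ => Finset.sum_nonneg fun j _ => hWq0 i j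
  have hGs0 : 0 ≤ Gs := Finset.sum_nonneg fun i _ => Finset.sum_nonneg fun j _ =>
    add_nonneg (hgA0 i j) (hgS0 i j)
  have hk0 : (0 : ℝ) ≤ k := Nat.cast_nonneg _
  have hparts : ∑ i, ∑ j ∈ Finset.range k, (S.noiseA M n h c ω i j ^ m +
      S.noiseS M n h c ω i j ^ m + W i j ^ m + I i j ^ m) ≤ B * Gs + (d * k + Ws) + Qs := by
    have hrow : ∀ i, ∑ j ∈ Finset.range k, (S.noiseA M n h c ω i j ^ m +
        S.noiseS M n h c ω i j ^ m + W i j ^ m + I i j ^ m) ≤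
        B * ∑ j ∈ Finset.range (k + 2), (gA i j + gS i j) +
          (k + ∑ j ∈ Finset.range k, W i j ^ q) + ∑ j ∈ Finset.range k, I i j ^ m := by
      intro i
      have e1 := (hS.isClockedPath_A hM hn hB hh.le huh1 ω i).sum_noise_rpow_le hc0 hm0 hq k
      have e2 := (hS.isClockedPath_S hM hn hB hh.le huh1 H i).sum_noise_rpow_le hc0 hm0 hq k
      have e3 : ∑ j ∈ Finset.range k, W i j ^ m ≤ k + ∑ j ∈ Finset.range k, W i j ^ q := by
        have : ∀ j, W i j ^ m ≤ 1 + W i j ^ q := fun j => by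
          rcases le_total (W i j) 1 with h1 | h1
          · linarith [Real.rpow_le_one (hW0 i j) h1 hm0.le, hWq0 i j]
          · have h2 := Real.rpow_le_rpow_of_exponent_le h1 (show m ≤ q by linarith)
            rw [Real.rpow_natCast] at h2
            linarith
        calc _ ≤ ∑ j ∈ Finset.range k, (1 + W i j ^ q) := Finset.sum_le_sum fun j _ => this j
          _ = _ := by simp [Finset.sum_add_distrib]
      rw [Finset.sum_add_distrib, Finset.sum_add_distrib, Finset.sum_add_distrib,
        Finset.sum_add_distrib, mul_add]
      have e4 : ∀ y : ℝ, 2 ^ m * ((6 / c + 3) * (3 ^ (q + 1) * y)) = B * y := fun y => by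
        rw [hBdef]; ring
      rw [e4] at e1 e2
      exact add_le_add (add_le_add (add_le_add e1 e2) e3) le_rfl
    refine (Finset.sum_le_sum fun i _ => hrow i).trans (le_of_eq ?_)
    rw [Finset.sum_add_distrib, Finset.sum_add_distrib, ← Finset.mul_sum, Finset.sum_add_distrib]
    simp [hGs, hWs, hQs]
  have hreal : ∑ j ∈ Finset.range k, E j ^ m ≤ C * (X0 + Qs + k + (Ws + Gs)) := by
    refine (hEsum k).trans ?_
    rw [hCdef, mul_assoc]
    gcongr
    have h1 : C2 * (k + (B * Gs + (d * k + Ws) + Qs)) ≤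
        C2 * ((1 + d + 1 + B) * (Qs + k + (Ws + Gs))) := by
      gcongr
      have hd : (0 : ℝ) ≤ d := Nat.cast_nonneg _
      nlinarith [mul_nonneg hB0 hQs0, mul_nonneg hB0 hk0, mul_nonneg hB0 hWs0, mul_nonneg hd hQs0,
        mul_nonneg hd hWs0, mul_nonneg hd hGs0]
    have h2 : 0 ≤ C2 * (1 + d + 1 + B) * X0 := by positivity
    have h3 := mul_le_mul_of_nonneg_left (add_le_add_right hparts (k : ℝ)) hC2
    nlinarith
  have hQint : ENNReal.ofReal Qs ≤
      ∑ i, ∫⁻ s in Set.Ioc 0 (k * h), ENNReal.ofReal (S.qPath M n ω i s ^ m) := by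
    rw [hQs, ENNReal.ofReal_sum_of_nonneg fun i _ => Finset.sum_nonneg fun j _ => hIm0 i j]
    refine Finset.sum_le_sum fun i _ => ?_
    rw [ENNReal.ofReal_sum_of_nonneg fun j _ => hIm0 i j, setLIntegral_Ioc_eq_sum hh.le]
    refine Finset.sum_le_sum fun j _ => ?_
    have e1 : (j : ℝ) * h ≤ (j + 1 : ℕ) * h := by gcongr; omega
    exact ofReal_integral_rpow_le (hS.measurable_qPath ω i) (fun y => qPath_nonneg ω i y) e1
      (by push_cast; linarith) (hP.int_q i (by positivity) e1) hm
  calc ∫⁻ s in Set.Ioc 0 (k * h), ENNReal.ofReal (‖S.XHat M n s.toNNReal ω‖ ^ m)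
      ≤ ∑ j ∈ Finset.range k, ENNReal.ofReal (E j ^ m) := by
        rw [setLIntegral_Ioc_eq_sum hh.le]
        refine Finset.sum_le_sum fun j _ => ?_
        have e1 : ∀ s ∈ Set.Ioc (j * h : ℝ) ((j + 1 : ℕ) * h),
            ENNReal.ofReal (‖S.XHat M n s.toNNReal ω‖ ^ m) ≤ ENNReal.ofReal (E j ^ m) := by
          intro s hs
          have e2 := hE j s hs.1.le (by simpa using hs.2)
          have e3 := (euclidean_norm_le_sum_abs fun i => S.xPath M n ω i s).trans e2
          exact ENNReal.ofReal_le_ofReal (Real.rpow_le_rpow (norm_nonneg _) e3 hm0.le)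
        refine (setLIntegral_mono' measurableSet_Ioc e1).trans ?_
        rw [setLIntegral_const, Real.volume_Ioc]
        refine mul_le_of_le_one_right' (ENNReal.ofReal_le_one.2 ?_)
        push_cast
        linarith
    _ = ENNReal.ofReal (∑ j ∈ Finset.range k, E j ^ m) :=
        (ENNReal.ofReal_sum_of_nonneg fun j _ => Real.rpow_nonneg (hE0 j) _).symm
    _ ≤ ENNReal.ofReal (C * (X0 + Qs + k + (Ws + Gs))) := ENNReal.ofReal_le_ofReal hreal
    _ = C.toNNReal * (ENNReal.ofReal X0 + ENNReal.ofReal Qs + k +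
          (ENNReal.ofReal Ws + ENNReal.ofReal Gs)) := by
        rw [ENNReal.ofReal_mul hC0, ENNReal.ofReal_add (by positivity) (by positivity),
          ENNReal.ofReal_add (by positivity) hk0, ENNReal.ofReal_add hX00 hQs0,
          ENNReal.ofReal_add hWs0 hGs0, ENNReal.ofReal_natCast]
        rfl
    _ ≤ _ := by
        gcongr
        rw [Finset.sum_add_distrib]
        refine le_of_eq (congrArg₂ (· + ·) ?_ ?_)
        · rw [hWs, ENNReal.ofReal_sum_of_nonneg fun i _ => Finset.sum_nonneg fun j _ => hWq0 i j]
          exact Finset.sum_congr rfl fun i _ => ENNReal.ofReal_sum_of_nonneg fun j _ => hWq0 i j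
        · rw [hGs, ENNReal.ofReal_sum_of_nonneg fun i _ => Finset.sum_nonneg fun j _ =>
            add_nonneg (hgA0 i j) (hgS0 i j)]
          refine Finset.sum_congr rfl fun i _ => ?_
          rw [ENNReal.ofReal_sum_of_nonneg fun j _ => add_nonneg (hgA0 i j) (hgS0 i j)]
          exact Finset.sum_congr rfl fun j _ => ENNReal.ofReal_add (hgA0 i j) (hgS0 i j)

end QueueProcesses

/-! ### The running cost -/

namespace QueueProcesses

variable {Ω : Type*} {d K : ℕ} {S : QueueProcesses Ω d K} {M : ModelParams d K} {n : ℕ} {ω : Ω}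

/-- The running cost is a power of the norm of the scaled queue. -/
lemma IsRegularPath.runningCost_eq (H : S.IsRegularPath M n ω) (hM : M.IsAveragedHW) (c m : ℝ)
    (t : ℝ) :
    runningCost c m (S.XHat M n t.toNNReal ω) (S.UHat n t.toNNReal ω) =
      c * ‖(WithLp.toLp 2 fun i => S.qPath M n ω i t : EuclideanSpace ℝ (Fin d))‖ ^ m := by
  have hp : 0 ≤ (n : ℝ) ^ (-M.β) := Real.rpow_nonneg (Nat.cast_nonneg _) _
  have hsum : ∑ i, S.XHat M n t.toNNReal ω i =
      (n : ℝ) ^ (-M.β) * ((∑ i, (S.X t.toNNReal ω i : ℝ)) - n) := sum_xPath hM ω t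
  unfold runningCost
  rw [hsum]
  congr 3
  by_cases hX : n < ∑ j, S.X t.toNNReal ω j
  · have hX' : (n : ℝ) < ∑ j, (S.X t.toNNReal ω j : ℝ) := by exact_mod_cast hX
    have hpos : 0 < (∑ j, (S.X t.toNNReal ω j : ℝ)) - n := by linarith
    rw [max_eq_left (mul_nonneg hp hpos.le)]
    ext i
    simp only [UHat, if_pos hX, PiLp.smul_apply, smul_eq_mul, qPath]
    have h1 : (S.Z t.toNNReal ω i : ℝ) - S.X t.toNNReal ω i = -S.Q t.toNNReal ω i := by
      simp [X]
    have h2 : (n : ℝ) - ∑ j, (S.X t.toNNReal ω j : ℝ) =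
      -((∑ j, (S.X t.toNNReal ω j : ℝ)) - n) := by ring
    rw [h1, h2, neg_div_neg_eq, mul_assoc, mul_div_cancel₀ _ hpos.ne']
  · have hX' : (∑ j, (S.X t.toNNReal ω j : ℝ)) ≤ n := by exact_mod_cast not_lt.1 hX
    rw [max_eq_right (mul_nonpos_of_nonneg_of_nonpos hp (by linarith)), zero_smul]
    ext i
    simp [qPath, H.Q_eq_zero (not_lt.1 hX) i]

lemma IsRegularPath.sum_lintegral_qPath_le (H : S.IsRegularPath M n ω) (hM : M.IsAveragedHW)
    {c m : ℝ} (hc : 0 < c) (hm : 0 < m) (s : Set ℝ) :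
    ∑ i, ∫⁻ t in s, ENNReal.ofReal (S.qPath M n ω i t ^ m) ≤ ((d / c).toNNReal : ℝ≥0) *
      ∫⁻ t in s, ENNReal.ofReal
        (runningCost c m (S.XHat M n t.toNNReal ω) (S.UHat n t.toNNReal ω)) := by
  have h1 : ∀ i, ∫⁻ t in s, ENNReal.ofReal (S.qPath M n ω i t ^ m) ≤ ENNReal.ofReal c⁻¹ *
      ∫⁻ t in s, ENNReal.ofReal
        (runningCost c m (S.XHat M n t.toNNReal ω) (S.UHat n t.toNNReal ω)) := by
    intro i
    rw [← lintegral_const_mul' _ _ ENNReal.ofReal_ne_top]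
    refine lintegral_mono fun t => ?_
    rw [← ENNReal.ofReal_mul (by positivity), H.runningCost_eq hM c m t, inv_mul_cancel_left₀ hc.ne']
    refine ENNReal.ofReal_le_ofReal (Real.rpow_le_rpow (qPath_nonneg ω i t) ?_ hm.le)
    have := PiLp.norm_apply_le
      (WithLp.toLp 2 fun i => S.qPath M n ω i t : EuclideanSpace ℝ (Fin d)) i
    rwa [Real.norm_eq_abs, abs_of_nonneg (qPath_nonneg ω i t)] at this
  refine (Finset.sum_le_sum fun i _ => h1 i).trans (le_of_eq ?_)
  rw [Finset.sum_const, Finset.card_univ, Fintype.card_fin, nsmul_eq_mul, ← mul_assoc]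
  congr 1
  rw [← ENNReal.ofReal_natCast, ← ENNReal.ofReal_mul (Nat.cast_nonneg _), div_eq_mul_inv]
  rfl

/-- With a constant that depends on the size of the system, the state is bounded by the cost at the
same time, since at most `n` customers are in service. -/
lemma exists_norm_XHat_rpow_le (M : ModelParams d K) (hM : M.IsAveragedHW) {c m : ℝ} (hc : 0 < c)
    (hm : 1 ≤ m) (n : ℕ) : ∃ C : ℝ≥0, ∀ {Ω : Type*} {S : QueueProcesses Ω d K} {ω : Ω}
      (_ : S.IsRegularPath M n ω) (t : ℝ), ENNReal.ofReal (‖S.XHat M n t.toNNReal ω‖ ^ m) ≤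
        C * (ENNReal.ofReal (runningCost c m (S.XHat M n t.toNNReal ω) (S.UHat n t.toNNReal ω)) + 1)
    := by
  have hm0 : 0 < m := by linarith
  set p := (n : ℝ) ^ (-M.β) with hp
  have hp0 : 0 ≤ p := Real.rpow_nonneg (Nat.cast_nonneg _) _
  set B : ℝ := ∑ i, p * (n + |M.ρ i * n|) with hB
  have hB0 : 0 ≤ B := Finset.sum_nonneg fun i _ => by positivity
  refine ⟨(2 ^ m * (c⁻¹ + B ^ m)).toNNReal, fun {Ω S ω} H t => ?_⟩
  set Q : EuclideanSpace ℝ (Fin d) := WithLp.toLp 2 fun i => S.qPath M n ω i t with hQ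
  have hnorm : ‖S.XHat M n t.toNNReal ω‖ ≤ ‖Q‖ + B := by
    have h1 : S.XHat M n t.toNNReal ω =
        Q + WithLp.toLp 2 fun i => p * ((S.Z t.toNNReal ω i : ℝ) - M.ρ i * n) := by
      ext i
      simp only [XHat, hQ, PiLp.add_apply, qPath, X, ← hp]
      push_cast
      ring
    rw [h1]
    refine (norm_add_le _ _).trans ?_
    gcongr
    refine (euclidean_norm_le_sum_abs _).trans (Finset.sum_le_sum fun i _ => ?_)
    rw [abs_mul, abs_of_nonneg hp0]
    gcongr
    refine (abs_sub _ _).trans ?_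
    gcongr
    rw [Nat.abs_cast]
    exact_mod_cast H.Z_le _ i
  have hcost := H.runningCost_eq hM c m t
  rw [hcost, ← hQ]
  have hQm : 0 ≤ ‖Q‖ ^ m := Real.rpow_nonneg (norm_nonneg _) _
  have hBm : 0 ≤ B ^ m := Real.rpow_nonneg hB0 _
  have h2 : ‖S.XHat M n t.toNNReal ω‖ ^ m ≤ 2 ^ m * (c⁻¹ + B ^ m) * (c * ‖Q‖ ^ m + 1) := by
    calc _ ≤ (‖Q‖ + B) ^ m := Real.rpow_le_rpow (norm_nonneg _) hnorm hm0.le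
      _ ≤ 2 ^ m * (‖Q‖ ^ m + B ^ m) := add_rpow_le (norm_nonneg _) hB0 hm0.le
      _ ≤ _ := by
        rw [mul_assoc]
        gcongr
        have h3 : c⁻¹ * (c * ‖Q‖ ^ m) = ‖Q‖ ^ m := inv_mul_cancel_left₀ hc.ne' _
        have h4 : 0 ≤ B ^ m * (c * ‖Q‖ ^ m) := by positivity
        have h5 : 0 ≤ c⁻¹ := by positivity
        nlinarith
  refine (ENNReal.ofReal_le_ofReal h2).trans (le_of_eq ?_)
  rw [ENNReal.ofReal_mul (by positivity), ENNReal.ofReal_add (by positivity) zero_le_one,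
    ENNReal.ofReal_one]
  rfl

end QueueProcesses

/-! ### Long-run averages -/

/-- Comparison of long-run averages along a grid of times. -/
lemma limsup_average_le {F G : ℝ → ℝ≥0∞} (hF : Monotone F) {h : ℝ} (hh : 0 < h) {B C C' : ℝ≥0}
    (hFG : ∀ k : ℕ, F (k * h) ≤ C * (G (k * h) + k) + C')
    (hG : limsup (fun T : ℝ => (ENNReal.ofReal T)⁻¹ * G T) atTop ≤ B) :
    limsup (fun T : ℝ => (ENNReal.ofReal T)⁻¹ * F T) atTop ≤
      (C * (2 * (B + 1) + (2 / h).toNNReal) + 1 : ℝ≥0) := by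
  have h1 : ∀ᶠ T : ℝ in atTop, (ENNReal.ofReal T)⁻¹ * G T < (B + 1 : ℝ≥0) := by
    refine eventually_lt_of_limsup_lt (hG.trans_lt ?_)
    exact_mod_cast lt_add_one B
  obtain ⟨T₀, hT₀⟩ := eventually_atTop.1 h1
  refine limsup_le_of_le (h := ?_)
  filter_upwards [eventually_ge_atTop T₀, eventually_ge_atTop h, eventually_ge_atTop (C' : ℝ)]
    with T hT1 hT2 hT3
  have hT0 : 0 < T := hh.trans_le hT2
  have hT0' : ENNReal.ofReal T ≠ 0 := by simpa using hT0
  set k := ⌈T / h⌉₊ with hk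
  have hkT : T ≤ k * h := by
    have := Nat.le_ceil (T / h)
    rwa [div_le_iff₀ hh] at this
  have hkT2 : (k : ℝ) * h ≤ 2 * T := by
    have := (Nat.ceil_lt_add_one (by positivity : 0 ≤ T / h)).le
    have h2 := mul_le_mul_of_nonneg_right this hh.le
    rw [add_mul, div_mul_cancel₀ _ hh.ne', one_mul] at h2
    linarith
  have hkpos : 0 < (k : ℝ) * h := hT0.trans_le hkT
  have hGk : G (k * h) ≤ ENNReal.ofReal T * (2 * (B + 1) : ℝ≥0) := by
    have h2 := (hT₀ _ (hT1.trans hkT)).le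
    rw [ENNReal.inv_mul_le_iff (ENNReal.ofReal_pos.2 hkpos).ne' ENNReal.ofReal_ne_top] at h2
    refine h2.trans ?_
    calc _ ≤ ENNReal.ofReal (2 * T) * (B + 1 : ℝ≥0) := by gcongr
      _ = _ := by
        rw [ENNReal.ofReal_mul (by norm_num), ENNReal.ofReal_ofNat, ENNReal.coe_mul]
        push_cast
        ring
  have hkk : (k : ℝ≥0∞) ≤ ENNReal.ofReal T * (2 / h).toNNReal := by
    rw [← ENNReal.ofReal_natCast, ENNReal.ofNNReal_toNNReal, ← ENNReal.ofReal_mul hT0.le]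
    refine ENNReal.ofReal_le_ofReal ?_
    rw [mul_div_assoc', le_div_iff₀ hh]
    linarith
  have hC' : (C' : ℝ≥0∞) ≤ ENNReal.ofReal T := by
    rw [← ENNReal.ofReal_coe_nnreal]
    exact ENNReal.ofReal_le_ofReal hT3
  rw [ENNReal.inv_mul_le_iff hT0' ENNReal.ofReal_ne_top]
  calc F T ≤ F (k * h) := hF hkT
    _ ≤ C * (G (k * h) + k) + C' := hFG k
    _ ≤ C * (ENNReal.ofReal T * (2 * (B + 1) : ℝ≥0) + ENNReal.ofReal T * (2 / h).toNNReal) +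
        ENNReal.ofReal T := by gcongr
    _ = _ := by push_cast; ring

/-! ### Expectations -/

namespace QueueProcesses

variable {d K : ℕ}

/-- The expected cost up to time `T`. -/
noncomputable def expectedCost {Ω : Type*} [MeasurableSpace Ω] (M : ModelParams d K) (c m : ℝ)
    (n : ℕ) (P : Measure Ω) (S : QueueProcesses Ω d K) (T : ℝ) : ℝ≥0∞ :=
  ∫⁻ ω, ∫⁻ s in Set.Ioc (0 : ℝ) T, ENNReal.ofReal
    (runningCost c m (S.XHat M n s.toNNReal ω) (S.UHat n s.toNNReal ω)) ∂volume ∂P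

/-- The expected `m`-th moment of the scaled process, integrated up to time `T`. -/
noncomputable def expectedMoment {Ω : Type*} [MeasurableSpace Ω] (M : ModelParams d K) (m : ℝ)
    (n : ℕ) (P : Measure Ω) (S : QueueProcesses Ω d K) (T : ℝ) : ℝ≥0∞ :=
  ∫⁻ ω, ∫⁻ s in Set.Ioc (0 : ℝ) T, ENNReal.ofReal (‖S.XHat M n s.toNNReal ω‖ ^ m) ∂volume ∂P

lemma monotone_expectedMoment {Ω : Type*} [MeasurableSpace Ω] (M : ModelParams d K) (m : ℝ)
    (n : ℕ) (P : Measure Ω) (S : QueueProcesses Ω d K) : Monotone (expectedMoment M m n P S) :=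
  fun _ _ hT => lintegral_mono fun _ => lintegral_mono_set (Set.Ioc_subset_Ioc_right hT)

lemma exists_expectedMoment_le_of_fixed {Ω : Type*} [MeasurableSpace Ω] [NeZero K]
    {M : ModelParams d K} (hM : M.IsAveragedHW) {c m : ℝ} (hc : 0 < c) (hm : 1 ≤ m) {n : ℕ}
    {P : Measure Ω} [IsProbabilityMeasure P] {S : QueueProcesses Ω d K} (hS : S.IsModel M n P)
    (hZ : S.IsAdmissible M n P) : ∃ C : ℝ≥0, ∀ T, 0 ≤ T →
      expectedMoment M m n P S T ≤ C * (expectedCost M c m n P S T + ENNReal.ofReal T) := by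
  obtain ⟨C, hC⟩ := exists_norm_XHat_rpow_le M hM hc hm n
  refine ⟨C, fun T hT => ?_⟩
  have h1 : ∀ᵐ ω ∂P, ∫⁻ s in Set.Ioc (0 : ℝ) T, ENNReal.ofReal (‖S.XHat M n s.toNNReal ω‖ ^ m) ≤
      C * ((∫⁻ s in Set.Ioc (0 : ℝ) T, ENNReal.ofReal
        (runningCost c m (S.XHat M n s.toNNReal ω) (S.UHat n s.toNNReal ω))) +
        ENNReal.ofReal T) := by
    filter_upwards [ae_isRegularPath hS hZ] with ω H
    refine (lintegral_mono fun s => hC H s).trans (le_of_eq ?_)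
    rw [lintegral_const_mul' _ _ ENNReal.coe_ne_top, lintegral_add_right _ measurable_const,
      setLIntegral_one, Real.volume_Ioc, sub_zero]
  refine (lintegral_mono_ae h1).trans (le_of_eq ?_)
  rw [lintegral_const_mul' _ _ ENNReal.coe_ne_top, lintegral_add_right _ measurable_const]
  simp [expectedCost]

/-- For large systems, the integrated moments are bounded by the expected cost, with constants which do
not depend on the size of the system except for a term constant in time, which depends on the initial
condition. -/
lemma exists_expectedMoment_le {M : ModelParams d K} (hM : M.IsAveragedHW) [NeZero K] {c m : ℝ}
    (hc : 0 < c) (hm : 1 ≤ m) : ∃ n₀ : ℕ, ∃ h : ℝ, 0 < h ∧ ∃ C : ℝ≥0, ∀ {Ω : Type*}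
      [MeasurableSpace Ω] {n : ℕ} {P : Measure Ω} [IsProbabilityMeasure P]
      {S : QueueProcesses Ω d K} (_ : S.IsModel M n P) (_ : S.IsAdmissible M n P) (_ : n₀ ≤ n)
      (_ : 1 ≤ n), ∃ C' : ℝ≥0, ∀ k : ℕ, expectedMoment M m n P S (k * h) ≤
        C * (expectedCost M c m n P S (k * h) + k) + C' := by
  have hm0 : 0 < m := by linarith
  obtain ⟨l, u, D, n₀, hB⟩ := hM.exists_rateBounds
  have hB0 := hB n₀ le_rfl
  have hu := hB0.one_le_u
  -- windows so short that a customer in service completes it with probability at most `1 / 8`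
  set h : ℝ := 1 / (8 * u) with hh
  have hh0 : 0 < h := by positivity
  have huh : u * h = 1 / 8 := by rw [hh]; field_simp
  have hh1 : h ≤ 1 := by nlinarith
  -- one power more than `m` is spent on counting the active windows
  obtain ⟨q, hq⟩ := exists_nat_ge (m + 1)
  obtain ⟨C1, hpath⟩ := exists_pathwise_bound d hB0.l_pos hB0.l_le hu hB0.D_nonneg hh0 hh1 huh.le
    hm hq
  have henv := fun i : Fin d => exists_environment_bound hM.gen_irreducible hM.stat_sum
    hM.stat_invariant (hM.sum_stat_mul_eq_zero i) q h.toNNReal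
  choose Ce henv using henv
  obtain ⟨Cp, hcell⟩ := IsUnitPoisson.lintegral_cellDev_pow_le q
  set A : ℝ≥0 := ∑ i, (Ce i + 2 * Cp) with hA
  set C2 : ℝ≥0 := (d / c).toNNReal with hC2
  refine ⟨n₀, h, hh0, C1 * (C2 + 1 + A), ?_⟩
  intro Ω _ n P _ S hS hZ hn hn1
  have hn1' : (1 : ℝ) ≤ n := by exact_mod_cast hn1
  obtain ⟨x₀, hx₀⟩ := hS.initial
  set X0 : ℝ := (∑ i, |(n : ℝ) ^ (-M.β) * ((x₀ i : ℝ) - M.ρ i * n)|) ^ m with hX0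
  have hν : 1 ≤ (n : ℝ) ^ (1 - M.β) := Real.one_le_rpow hn1' (by linarith [hM.β_le_one])
  -- the environment is fast enough for the diffusion scale, as `2 - 2 β ≤ α`
  have hνκ : ((n : ℝ) ^ (1 - M.β)) ^ 2 ≤ (n : ℝ) ^ M.α := by
    rw [← Real.rpow_natCast, ← Real.rpow_mul (by linarith)]
    refine Real.rpow_le_rpow_of_exponent_le hn1' ?_
    have : 1 - M.α / 2 ≤ M.β := le_max_right _ _
    push_cast
    linarith
  have hWex := fun (i : Fin d) (j : ℕ) => henv i P S.J _ _ hν hνκ hS.chain (j * h).toNNReal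
  choose W hWm hW0 hWb hWint using hWex
  set N : ℕ → Ω → ℝ≥0∞ := fun k ω => ∑ i, (∑ j ∈ Finset.range k, ENNReal.ofReal (W i j ω ^ q) +
    ∑ j ∈ Finset.range (k + 2),
      (ENNReal.ofReal (IsUnitPoisson.cellDev (S.Astar i) n j ω ^ q) +
        ENNReal.ofReal (IsUnitPoisson.cellDev (S.Sstar i) n j ω ^ q))) with hN
  have hmW : ∀ i j, Measurable fun ω => ENNReal.ofReal (W i j ω ^ q) := fun i j =>
    ((hWm i j).pow_const q).ennreal_ofReal
  have hmA : ∀ i j, Measurable fun ω =>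
      ENNReal.ofReal (IsUnitPoisson.cellDev (S.Astar i) n j ω ^ q) := fun i j =>
    (((hS.poisson_A i).measurable_cellDev n j).pow_const q).ennreal_ofReal
  have hmS : ∀ i j, Measurable fun ω =>
      ENNReal.ofReal (IsUnitPoisson.cellDev (S.Sstar i) n j ω ^ q) := fun i j =>
    (((hS.poisson_S i).measurable_cellDev n j).pow_const q).ennreal_ofReal
  have hmAS : ∀ i j, Measurable fun ω =>
      ENNReal.ofReal (IsUnitPoisson.cellDev (S.Astar i) n j ω ^ q) +
        ENNReal.ofReal (IsUnitPoisson.cellDev (S.Sstar i) n j ω ^ q) := fun i j =>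
    (hmA i j).add (hmS i j)
  have hmi : ∀ k i, Measurable fun ω => ∑ j ∈ Finset.range k, ENNReal.ofReal (W i j ω ^ q) +
      ∑ j ∈ Finset.range (k + 2), (ENNReal.ofReal (IsUnitPoisson.cellDev (S.Astar i) n j ω ^ q) +
        ENNReal.ofReal (IsUnitPoisson.cellDev (S.Sstar i) n j ω ^ q)) := fun k i =>
    (Finset.measurable_fun_sum _ fun j _ => hmW i j).add
      (Finset.measurable_fun_sum _ fun j _ => hmAS i j)
  have hmN : ∀ k, Measurable (N k) := fun k => Finset.measurable_fun_sum _ fun i _ => hmi k i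
  have hmN' : ∀ k : ℕ, Measurable fun ω => N k ω + (ENNReal.ofReal X0 + k) := fun k =>
    (hmN k).add measurable_const
  have hNint : ∀ k : ℕ, ∫⁻ ω, N k ω ∂P ≤ (A * (k + 2) : ℝ≥0) := by
    intro k
    simp only [hN]
    rw [lintegral_finsetSum _ fun i _ => hmi k i, hA, Finset.sum_mul,
      ENNReal.ofNNReal_finsetSum]
    refine Finset.sum_le_sum fun i _ => ?_
    rw [lintegral_add_left (Finset.measurable_fun_sum _ fun j _ => hmW i j),
      lintegral_finsetSum _ fun j _ => hmW i j,
      lintegral_finsetSum _ fun j _ => hmAS i j]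
    have e1 : ∑ j ∈ Finset.range k, ∫⁻ ω, ENNReal.ofReal (W i j ω ^ q) ∂P ≤ k * Ce i := by
      refine (Finset.sum_le_sum fun j _ => hWint i j).trans (le_of_eq ?_)
      simp
    have e2 : ∑ j ∈ Finset.range (k + 2), ∫⁻ ω,
        (ENNReal.ofReal (IsUnitPoisson.cellDev (S.Astar i) n j ω ^ q) +
        ENNReal.ofReal (IsUnitPoisson.cellDev (S.Sstar i) n j ω ^ q)) ∂P ≤
        (k + 2) * (Cp + Cp) := by
      calc _ ≤ ∑ j ∈ Finset.range (k + 2), ((Cp : ℝ≥0∞) + Cp) := by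
            refine Finset.sum_le_sum fun j _ => ?_
            rw [lintegral_add_left (hmA i j)]
            exact add_le_add (hcell P _ (hS.poisson_A i) n j hn1)
              (hcell P _ (hS.poisson_S i) n j hn1)
        _ = _ := by simp [mul_add]
    refine (add_le_add e1 e2).trans ?_
    have e3 : (k : ℝ≥0) * Ce i + (k + 2) * (Cp + Cp) ≤ (Ce i + 2 * Cp) * (k + 2) := by
      have : (Ce i + 2 * Cp) * ((k : ℝ≥0) + 2) =
        k * Ce i + (k + 2) * (Cp + Cp) + 2 * Ce i := by ring
      rw [this]
      exact le_self_add
    exact_mod_cast e3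
  have hbound : ∀ k : ℕ, ∀ᵐ ω ∂P, ∫⁻ s in Set.Ioc (0 : ℝ) (k * h),
      ENNReal.ofReal (‖S.XHat M n s.toNNReal ω‖ ^ m) ≤
      C1 * (C2 * (∫⁻ s in Set.Ioc (0 : ℝ) (k * h), ENNReal.ofReal
        (runningCost c m (S.XHat M n s.toNNReal ω) (S.UHat n s.toNNReal ω))) +
        (N k ω + (ENNReal.ofReal X0 + k))) := by
    intro k
    filter_upwards [ae_isRegularPath hS hZ, hx₀] with ω H hx
    refine (hpath hS hM hn1 (hB n hn) H (fun i j => W i j ω) (fun i j => hW0 i j ω)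
      (fun i j r hr hr' => ?_) k).trans ?_
    · have hj : 0 ≤ (j : ℝ) * h := by positivity
      have := hWb i j ω r (by rwa [Real.coe_toNNReal _ hj])
        (by rwa [Real.coe_toNNReal _ hj, Real.coe_toNNReal _ hh0.le])
      rwa [Real.coe_toNNReal _ hj] at this
    · have e1 := H.sum_lintegral_qPath_le hM hc hm0 (Set.Ioc 0 (k * h))
      have e2 : (∑ i, |S.xPath M n ω i 0|) ^ m = X0 := by
        simp [hX0, xPath, hx]
      rw [e2]
      refine mul_le_mul_right ?_ _
      calc _ ≤ ENNReal.ofReal X0 + C2 * (∫⁻ s in Set.Ioc (0 : ℝ) (k * h), ENNReal.ofReal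
            (runningCost c m (S.XHat M n s.toNNReal ω) (S.UHat n s.toNNReal ω))) + k + N k ω := by
            gcongr
        _ = _ := by ring
  refine ⟨C1 * (X0.toNNReal + 2 * A), fun k => ?_⟩
  calc expectedMoment M m n P S (k * h) ≤ _ := lintegral_mono_ae (hbound k)
    _ = C1 * (C2 * expectedCost M c m n P S (k * h) + (∫⁻ ω, N k ω ∂P + (ENNReal.ofReal X0 + k))) := by
        rw [lintegral_const_mul' _ _ ENNReal.coe_ne_top,
          lintegral_add_right _ (hmN' k),
          lintegral_const_mul' _ _ ENNReal.coe_ne_top, lintegral_add_right _ measurable_const]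
        simp [expectedCost]
    _ ≤ C1 * (C2 * expectedCost M c m n P S (k * h) +
          ((A * (k + 2) : ℝ≥0) + (X0.toNNReal + k))) := by
        gcongr
        · exact hNint k
        · exact le_rfl
    _ ≤ C1 * ((C2 + 1 + A) * (expectedCost M c m n P S (k * h) + k) + (X0.toNNReal + 2 * A)) := by
        refine mul_le_mul_right ?_ _
        push_cast
        calc _ = C2 * expectedCost M c m n P S (k * h) + (1 + A) * k + (X0.toNNReal + 2 * A) := by
              ring
          _ ≤ (C2 * expectedCost M c m n P S (k * h) + (1 + A) * k +
              ((1 + A) * expectedCost M c m n P S (k * h) + C2 * k)) + (X0.toNNReal + 2 * A) :=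
              add_le_add le_self_add le_rfl
          _ = _ := by ring
    _ = _ := by push_cast; ring

end QueueProcesses

theorem lemma4p1 {d K : ℕ} [NeZero K] (M : ModelParams d K) (hM : M.IsAveragedHW)
    (c m : ℝ) (hc : 0 < c) (hm : 1 ≤ m)
    {Ω : ℕ → Type*} [∀ n, MeasurableSpace (Ω n)]
    (P : ∀ n, Measure (Ω n)) [∀ n, IsProbabilityMeasure (P n)]
    (S : ∀ n, QueueProcesses (Ω n) d K)
    (hS : ∀ n, 1 ≤ n → (S n).IsModel M n (P n))
    (hZ : ∀ n, 1 ≤ n → (S n).IsAdmissible M n (P n))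
    (hcost : ∃ C : ℝ≥0, ∀ n, 1 ≤ n → ergodicCost M c m n (P n) (S n) ≤ C) :
    ∃ C : ℝ≥0, ∀ n, 1 ≤ n →
      longRunAverage (P n) (fun s ω => ‖(S n).XHat M n s ω‖ ^ m) ≤ C := by
  obtain ⟨B, hB⟩ := hcost
  obtain ⟨n₀, h, hh, C, hlarge⟩ := QueueProcesses.exists_expectedMoment_le hM hc hm
  -- systems with at least `n₀` servers
  have h1 : ∀ n, 1 ≤ n → n₀ ≤ n → longRunAverage (P n) (fun s ω => ‖(S n).XHat M n s ω‖ ^ m) ≤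
      (C * (2 * (B + 1) + (2 / h).toNNReal) + 1 : ℝ≥0) := by
    intro n hn hn₀
    obtain ⟨C', hC'⟩ := hlarge (hS n hn) (hZ n hn) hn₀ hn
    exact limsup_average_le (QueueProcesses.monotone_expectedMoment M m n (P n) (S n)) hh hC' (hB n hn)
  -- each of the finitely many smaller systems
  have h2 : ∀ n, ∃ D : ℝ≥0, 1 ≤ n →
      longRunAverage (P n) (fun s ω => ‖(S n).XHat M n s ω‖ ^ m) ≤ D := by
    intro n
    by_cases hn : 1 ≤ n
    · obtain ⟨D, hD⟩ := QueueProcesses.exists_expectedMoment_le_of_fixed hM hc hm (hS n hn) (hZ n hn)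
      refine ⟨_, fun _ => limsup_average_le (C := D) (C' := 0)
        (QueueProcesses.monotone_expectedMoment M m n (P n) (S n)) one_pos (fun k => ?_) (hB n hn)⟩
      have := hD (k * 1) (by positivity)
      rw [mul_one, ENNReal.ofReal_natCast] at this
      rw [mul_one, ENNReal.coe_zero, add_zero]
      exact this
    · exact ⟨0, fun h => absurd h hn⟩
  choose D hD using h2
  refine ⟨max (C * (2 * (B + 1) + (2 / h).toNNReal) + 1) ((Finset.range n₀).sup D), fun n hn => ?_⟩
  rcases le_or_gt n₀ n with h3 | h3
  · exact (h1 n hn h3).trans (by exact_mod_cast le_max_left _ _)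
  · refine (hD n hn).trans ?_
    have := (Finset.le_sup (f := D) (Finset.mem_range.2 h3)).trans
      (le_max_right (C * (2 * (B + 1) + (2 / h).toNNReal) + 1) _)
    exact_mod_cast this
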